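/- Let $\Bbbk$ be a commutative ring in which $2$ is invertible. Modules, superalgebras and Lie superalgebras are over $\Bbbk$; a Lie superalgebra is a $\mathbb Z/2\mathbb Z$-graded module with an even bilinear bracket satisfying $[x,y]=-(-1)^{|x||y|}[y,x]$ and $[x,[y,z]]=[[x,y],z]+(-1)^{|x||y|}[y,[x,z]]$ for homogeneous $x,y,z$; homomorphisms are even; sub-superalgebras are graded submodules closed under the bracket. Let $R$ be a unital associative superalgebra with a superinvolution $\bar{\ }$, i.e. an even $\Bbbk$-linear map with $\overline{ab}=(-1)^{|a||b|}\bar b\bar a$ for homogeneous $a,b$ and $\bar{\bar a}=a$. Let $\rho(a)=(-1)^{|a|}a$ for homogeneous $a$, extended linearly, and let $m\ge 3$. Let $\mathrm M_{m|m}(R)$ be the superalgebra of $2m\times 2m$ matrices over $R$, where the matrix unit $e_{ij}(a)$ has parity $|i|+|j|+|a|$ with $|i|=0$ for $i\le m$ and $|i|=1$ for $i>m$, and put $$\begin{pmatrix}A&B\\C&D\end{pmatrix}^{\mathrm{prp}}=\begin{pmatrix}\overline{D}^t&-\overline{\rho(B)}^t\\ \overline{\rho(C)}^t&\overline{A}^t\end{pmatrix}.$$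 Let $\tilde{\mathfrak p}_m(R,{}^-)=\{X\in \mathrm M_{m|m}(R): X^{\mathrm{prp}}=-X\}$ with the super-commutator as bracket, and let $\mathfrak p_m(R,{}^-)=[\tilde{\mathfrak p}_m(R,{}^-),\tilde{\mathfrak p}_m(R,{}^-)]$. Put $t_{ij}(a)=e_{ij}(a)-e_{m+j,m+i}(\bar a)$, $f_{ij}(a)=e_{i,m+j}(a)+e_{j,m+i}(\rho(\bar a))$ and $g_{ij}(a)=e_{m+i,j}(a)-e_{m+j,i}(\rho(\bar a))$. Let $\mathfrak{stp}_m(R,{}^-)$ be the Lie superalgebra generated by homogeneous elements $\mathbf t_{ij}(a),\mathbf f_{ij}(a),\mathbf g_{ij}(a)$ of parity $|a|,|a|+1,|a|+1$, for homogeneous $a\in R$ and $1\le i\ne j\le m$, subject to the following relations (a chain such as $i\ne j\ne k\ne l\ne i$ only asserts the displayed adjacent inequalities): - $\mathbf t_{ij},\mathbf f_{ij},\mathbf g_{ij}$ are $\Bbbk$-linear; $\mathbf f_{ij}(\bar a)=\mathbf f_{ji}(\rho(a))$ and $\mathbf g_{ij}(\bar a)=-\mathbf g_{ji}(\rho(a))$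 for $i\ne j$; - $[\mathbf t_{ij}(a),\mathbf t_{jk}(b)]=\mathbf t_{ik}(ab)$, $[\mathbf t_{ij}(a),\mathbf f_{jk}(b)]=\mathbf f_{ik}(ab)$, $[\mathbf g_{ij}(a),\mathbf t_{jk}(b)]=\mathbf g_{ik}(ab)$ and $[\mathbf f_{ij}(a),\mathbf g_{jk}(b)]=\mathbf t_{ik}(ab)$ for distinct $i,j,k$; - $[\mathbf t_{ij}(a),\mathbf t_{kl}(b)]=0$ for $i\ne j\ne k\ne l\ne i$; $[\mathbf t_{ij}(a),\mathbf f_{kl}(b)]=0$ for $i\ne j\ne k\ne l\ne j$; $[\mathbf g_{ij}(a),\mathbf t_{kl}(b)]=0$ for $l\ne k\ne j\ne i\ne k$; - $[\mathbf f_{ij}(a),\mathbf f_{kl}(b)]=0=[\mathbf g_{ij}(a),\mathbf g_{kl}(b)]$ for $i\ne j$ and $k\ne l$; $[\mathbf f_{ij}(a),\mathbf g_{kl}(b)]=0$ for distinct $i,j,k,l$. By linearity $\mathbf t_{ij}(a),\mathbf f_{ij}(a),\mathbf g_{ij}(a)$ are defined for all $a\in R$. Define the $\Bbbk$-submodules $$\begin{aligned}\mathfrak{stp}_m^0&=\mathrm{span}\{[\mathbf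 f_{ij}(a),\mathbf g_{ji}(b)]: a,b\in R,\ i\ne j\},\\ \mathfrak{stp}_m^+&=\mathrm{span}\big(\{\mathbf t_{ij}(a),\mathbf f_{ij}(a): a\in R,\ i<j\}\cup\{[\mathbf t_{ij}(1),\mathbf f_{ji}(a)]: a\in R,\ i\ne j\}\big),\\ \mathfrak{stp}_m^-&=\mathrm{span}\big(\{\mathbf t_{ij}(a),\mathbf g_{ij}(a): a\in R,\ i>j\}\cup\{[\mathbf g_{ij}(a),\mathbf t_{ji}(1)]: a\in R,\ i\ne j\}\big).\end{aligned}$$ **Proposition.** (1) $\mathfrak{stp}_m(R,{}^-)=\mathfrak{stp}_m^-\oplus\mathfrak{stp}_m^0\oplus\mathfrak{stp}_m^+$ as $\Bbbk$-modules; the three summands are Lie sub-superalgebras, and $[\mathfrak{stp}_m^0,\mathfrak{stp}_m^{\pm}]\subseteq\mathfrak{stp}_m^{\pm}$. (2) There is a unique homomorphism of Lie superalgebras $\psi:\mathfrak{stp}_m(R,{}^-)\to\mathfrak p_m(R,{}^-)$ with $\psi(\mathbf t_{ij}(a))=t_{ij}(a)$, $\psi(\mathbf f_{ij}(a))=f_{ij}(a)$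 and $\psi(\mathbf g_{ij}(a))=g_{ij}(a)$ for all $a\in R$ and $i\ne j$. It is a central extension, i.e. it is surjective and $\ker\psi$ is contained in the center of $\mathfrak{stp}_m(R,{}^-)$, and moreover $\ker\psi\subseteq\mathfrak{stp}_m^0$. -/

import Mathlib

noncomputable section

/-! ### Lie superalgebras -/

/-- The sign `(-1)^p` of a parity `p`. -/
def superSign (p : ZMod 2) : ℤ := if p = 0 then 1 else -1

/-- A Lie superalgebra structure on the `k`-module `V`: a decomposition of `V` into an even and an
odd part, and a bilinear bracket that is compatible with the parity, super-antisymmetric and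
satisfies the super Jacobi identity. (The base ring will be one in which `2` is invertible.) -/
structure LieSuperalgebra (k V : Type*) [CommRing k] [AddCommGroup V] [Module k V] where
  grade : ZMod 2 → Submodule k V
  isCompl : IsCompl (grade 0) (grade 1)
  bracket : V →ₗ[k] V →ₗ[k] V
  bracket_mem : ∀ {p q : ZMod 2} {x y : V}, x ∈ grade p → y ∈ grade q →
    bracket x y ∈ grade (p + q)
  antisymm : ∀ {p q : ZMod 2} {x y : V}, x ∈ grade p → y ∈ grade q →
    bracket x y = -(superSign (p * q) • bracket y x)
  jacobi : ∀ {p q r : ZMod 2} {x y z : V}, x ∈ grade p → y ∈ grade q → z ∈ grade r →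
    bracket x (bracket y z) =
      bracket (bracket x y) z + superSign (p * q) • bracket y (bracket x z)

namespace LieSuperalgebra

variable {k V W : Type*} [CommRing k] [AddCommGroup V] [Module k V] [AddCommGroup W] [Module k W]

/-- Homomorphisms of Lie superalgebras: even linear maps that preserve the bracket. -/
structure IsHom (L : LieSuperalgebra k V) (M : LieSuperalgebra k W) (φ : V →ₗ[k] W) : Prop where
  map_grade : ∀ p, ∀ x ∈ L.grade p, φ x ∈ M.grade p
  map_bracket : ∀ x y, φ (L.bracket x y) = M.bracket (φ x) (φ y)

/-- The center of a Lie superalgebra. -/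
def center (L : LieSuperalgebra k V) : Submodule k V := LinearMap.ker L.bracket

/-- Central extensions: surjective homomorphisms whose kernel lies in the center. -/
structure IsCentralExtension (L : LieSuperalgebra k V) (M : LieSuperalgebra k W)
    (φ : V →ₗ[k] W) : Prop where
  isHom : IsHom L M φ
  surjective : Function.Surjective φ
  ker_le_center : LinearMap.ker φ ≤ L.center

/-- Lie sub-superalgebras: graded submodules that are closed under the bracket. -/
structure IsSub (L : LieSuperalgebra k V) (N : Submodule k V) : Prop where
  graded : N ≤ (N ⊓ L.grade 0) ⊔ (N ⊓ L.grade 1)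
  bracket_mem : ∀ x ∈ N, ∀ y ∈ N, L.bracket x y ∈ N

/-- A Lie sub-superalgebra as a Lie superalgebra in its own right. -/
def restrict (L : LieSuperalgebra k V) (N : Submodule k V) (hN : L.IsSub N) :
    LieSuperalgebra k N where
  grade p := (L.grade p).comap N.subtype
  isCompl := by
    constructor
    · rw [Submodule.disjoint_def]
      intro x h0 h1
      exact Subtype.ext ((Submodule.disjoint_def.mp L.isCompl.disjoint) _ h0 h1)
    · rw [codisjoint_iff, eq_top_iff]
      rintro ⟨x, hx⟩ -
      obtain ⟨y, hy, z, hz, rfl⟩ := Submodule.mem_sup.mp (hN.graded hx)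
      exact Submodule.mem_sup.mpr ⟨⟨y, hy.1⟩, hy.2, ⟨z, hz.1⟩, hz.2, rfl⟩
  bracket := LinearMap.mk₂ k (fun x y => ⟨L.bracket x y, hN.bracket_mem _ x.2 _ y.2⟩)
    (fun _ _ _ => Subtype.ext (by simp)) (fun _ _ _ => Subtype.ext (by simp))
    (fun _ _ _ => Subtype.ext (by simp)) (fun _ _ _ => Subtype.ext (by simp))
  bracket_mem := fun hx hy => L.bracket_mem hx hy
  antisymm := fun hx hy => Subtype.ext (by simpa using L.antisymm hx hy)
  jacobi := fun hx hy hz => Subtype.ext (by simpa using L.jacobi hx hy hz)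

/-- The derived submodule `[N, N]`. -/
def derived (L : LieSuperalgebra k V) (N : Submodule k V) : Submodule k V :=
  Submodule.span k {z | ∃ x ∈ N, ∃ y ∈ N, z = L.bracket x y}

theorem IsSub.derived_le {L : LieSuperalgebra k V} {N : Submodule k V} (hN : L.IsSub N) :
    L.derived N ≤ N := by
  refine Submodule.span_le.mpr ?_
  rintro _ ⟨x, hx, y, hy, rfl⟩
  exact hN.bracket_mem x hx y hy

theorem IsSub.derived {L : LieSuperalgebra k V} {N : Submodule k V} (hN : L.IsSub N) :
    L.IsSub (L.derived N) where
  graded := by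
    have key : ∀ (p q : ZMod 2), ∀ x ∈ N ⊓ L.grade p, ∀ y ∈ N ⊓ L.grade q,
        L.bracket x y ∈
          (L.derived N ⊓ L.grade 0) ⊔ (L.derived N ⊓ L.grade 1) := by
      intro p q x hx y hy
      have h1 : L.bracket x y ∈ L.derived N :=
        Submodule.subset_span ⟨x, hx.1, y, hy.1, rfl⟩
      have h2 := L.bracket_mem hx.2 hy.2
      have h3 : p + q = 0 ∨ p + q = 1 := by
        generalize p + q = r
        fin_cases r
        · exact Or.inl rfl
        · exact Or.inr rfl
      rcases h3 with h3 | h3 <;> rw [h3] at h2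
      · exact Submodule.mem_sup_left ⟨h1, h2⟩
      · exact Submodule.mem_sup_right ⟨h1, h2⟩
    refine Submodule.span_le.mpr ?_
    rintro _ ⟨x, hx, y, hy, rfl⟩
    obtain ⟨x0, hx0, x1, hx1, rfl⟩ := Submodule.mem_sup.mp (hN.graded hx)
    obtain ⟨y0, hy0, y1, hy1, rfl⟩ := Submodule.mem_sup.mp (hN.graded hy)
    simp only [map_add, LinearMap.add_apply]
    exact add_mem (add_mem (key _ _ _ hx0 _ hy0) (key _ _ _ hx1 _ hy0))
      (add_mem (key _ _ _ hx0 _ hy1) (key _ _ _ hx1 _ hy1))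
  bracket_mem x hx y hy :=
    Submodule.subset_span ⟨x, hN.derived_le hx, y, hN.derived_le hy, rfl⟩

end LieSuperalgebra

/-! ### The Lie superalgebra of an associative superalgebra -/

section Associative

variable {k A : Type*} [CommRing k] [Ring A] [Algebra k A]
  (𝒜 : ZMod 2 → Submodule k A) [GradedAlgebra 𝒜]

/-- The super-commutator: the bilinear map with `[x, y] = x y - (-1)^(p q) y x` for `x` of parity
`p` and `y` of parity `q`. -/
def superCommutator : A →ₗ[k] A →ₗ[k] A :=
  ∑ p : ZMod 2, ∑ q : ZMod 2,
    (LinearMap.mul k A - superSign (p * q) • (LinearMap.mul k A).flip).compl₁₂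
      (GradedAlgebra.proj 𝒜 p) (GradedAlgebra.proj 𝒜 q)

theorem superCommutator_apply {p q : ZMod 2} {x y : A} (hx : x ∈ 𝒜 p) (hy : y ∈ 𝒜 q) :
    superCommutator 𝒜 x y = x * y - superSign (p * q) • (y * x) := by
  have h1 : ∀ r, GradedAlgebra.proj 𝒜 r x = if r = p then x else 0 := by
    intro r
    split_ifs with h
    · subst h; exact DirectSum.decompose_of_mem_same 𝒜 hx
    · exact DirectSum.decompose_of_mem_ne 𝒜 hx (Ne.symm h)
  have h2 : ∀ r, GradedAlgebra.proj 𝒜 r y = if r = q then y else 0 := by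
    intro r
    split_ifs with h
    · subst h; exact DirectSum.decompose_of_mem_same 𝒜 hy
    · exact DirectSum.decompose_of_mem_ne 𝒜 hy (Ne.symm h)
  simp only [superCommutator, LinearMap.sum_apply, LinearMap.compl₁₂_apply]
  rw [Finset.sum_eq_single p, Finset.sum_eq_single q]
  · simp [h1, h2]
  · intro r _ hr
    simp [h2, hr]
  · simp
  · intro r _ hr
    simp [h1, hr]
  · simp

theorem superSign_mul_superSign (p q : ZMod 2) :
    superSign p * superSign q = superSign (p + q) := by
  revert p q; decide

theorem isCompl_of_gradedAlgebra : IsCompl (𝒜 0) (𝒜 1) :=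
  (DirectSum.Decomposition.isInternal 𝒜).isCompl (by decide)
    (by
      refine Set.ext fun p => ⟨fun _ => ?_, fun _ => Set.mem_univ _⟩
      fin_cases p
      · exact Or.inl rfl
      · exact Or.inr rfl)

/-- An associative superalgebra with its super-commutator is a Lie superalgebra. -/
def LieSuperalgebra.ofAssociative : LieSuperalgebra k A where
  grade := 𝒜
  isCompl := isCompl_of_gradedAlgebra 𝒜
  bracket := superCommutator 𝒜
  bracket_mem := by
    intro p q x y hx hy
    rw [superCommutator_apply 𝒜 hx hy]
    refine sub_mem (SetLike.mul_mem_graded hx hy) (zsmul_mem ?_ _)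
    rw [add_comm]
    exact SetLike.mul_mem_graded hy hx
  antisymm := by
    intro p q x y hx hy
    rw [superCommutator_apply 𝒜 hx hy, superCommutator_apply 𝒜 hy hx, smul_sub, smul_smul,
      mul_comm q p, superSign_mul_superSign]
    have : superSign (p * q + p * q) = 1 := by clear hx hy; revert p q; decide
    rw [this, one_smul, neg_sub]
  jacobi := by
    intro p q r x y z hx hy hz
    have hs : ∀ {p q : ZMod 2} {x y : A}, x ∈ 𝒜 p → y ∈ 𝒜 q →
        x * y - superSign (p * q) • (y * x) ∈ 𝒜 (p + q) := by
      intro p q x y hx hy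
      refine sub_mem (SetLike.mul_mem_graded hx hy) (zsmul_mem ?_ _)
      rw [add_comm]
      exact SetLike.mul_mem_graded hy hx
    rw [superCommutator_apply 𝒜 hy hz, superCommutator_apply 𝒜 hx hy,
      superCommutator_apply 𝒜 hx hz, superCommutator_apply 𝒜 hx (hs hy hz),
      superCommutator_apply 𝒜 (hs hx hy) hz, superCommutator_apply 𝒜 hy (hs hx hz)]
    have e1 : ∀ p q r, superSign (p * (q + r)) = superSign (p * q) * superSign (p * r) := by
      decide
    have e2 := e1 r p q
    rw [mul_comm, mul_comm r p, mul_comm r q] at e2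
    have e3 := e1 q p r
    rw [mul_comm q p] at e3
    rw [e1, e2, e3]
    have e4 : ∀ p, superSign p = 1 ∨ superSign p = -1 := by decide
    rcases e4 (p * q) with h | h <;> rcases e4 (p * r) with h' | h' <;>
      rcases e4 (q * r) with h'' | h'' <;> rw [h, h', h''] <;>
      simp only [mul_one, mul_neg, neg_neg, one_smul, neg_smul] <;> noncomm_ring

end Associative

/-! ### Superalgebras with superinvolution and periplectic Lie superalgebras -/

section Periplectic

variable {k R : Type*} [CommRing k] [Ring R] [Algebra k R]

/-- A superinvolution of the superalgebra `(R, 𝒜)`. -/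
structure Superinvolution (𝒜 : ZMod 2 → Submodule k R) where
  bar : R →ₗ[k] R
  bar_mem : ∀ {p : ZMod 2} {a : R}, a ∈ 𝒜 p → bar a ∈ 𝒜 p
  bar_mul : ∀ {p q : ZMod 2} {a b : R}, a ∈ 𝒜 p → b ∈ 𝒜 q →
    bar (a * b) = superSign (p * q) • (bar b * bar a)
  bar_bar : ∀ a, bar (bar a) = a

variable (𝒜 : ZMod 2 → Submodule k R) [GradedAlgebra 𝒜]

/-- The sign map, `ρ a = (-1)^p a` for `a` of parity `p`. -/
def signMap : R →ₗ[k] R :=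
  ∑ p : ZMod 2, superSign p • GradedAlgebra.proj 𝒜 p

theorem signMap_apply {p : ZMod 2} {a : R} (ha : a ∈ 𝒜 p) :
    signMap 𝒜 a = superSign p • a := by
  simp only [signMap, LinearMap.sum_apply, LinearMap.smul_apply]
  rw [Finset.sum_eq_single p]
  · rw [GradedAlgebra.proj_apply, DirectSum.decompose_of_mem_same 𝒜 ha]
  · intro r _ hr
    rw [GradedAlgebra.proj_apply, DirectSum.decompose_of_mem_ne 𝒜 ha (Ne.symm hr), smul_zero]
  · simp

/-- Square matrices of size `2m`, with rows and columns indexed by two copies of `Fin m`: `inl i`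
stands for the index `i ≤ m` and `inr i` for the index `m + i`. -/
abbrev SuperMatrix (R : Type*) (m : ℕ) := Matrix (Fin m ⊕ Fin m) (Fin m ⊕ Fin m) R

/-- The parity of an index. -/
def indexParity {m : ℕ} : Fin m ⊕ Fin m → ZMod 2
  | .inl _ => 0
  | .inr _ => 1

/-- The grading of the matrix superalgebra `M_{m|m}(R)`: the matrix unit `e_{ij}(a)` has parity
`|i| + |j| + |a|`. -/
def matrixGrade (m : ℕ) (p : ZMod 2) : Submodule k (SuperMatrix R m) where
  carrier := {X | ∀ i j, X i j ∈ 𝒜 (p + indexParity i + indexParity j)}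
  add_mem' hX hY i j := add_mem (hX i j) (hY i j)
  zero_mem' _ _ := zero_mem _
  smul_mem' c _ hX i j := Submodule.smul_mem _ c (hX i j)

/-- The component of parity `p` of a matrix. -/
def matrixProj (m : ℕ) (p : ZMod 2) : SuperMatrix R m →+ matrixGrade 𝒜 m p where
  toFun X := ⟨fun i j => (DirectSum.decompose 𝒜 (X i j) (p + indexParity i + indexParity j) : R),
    fun _ _ => SetLike.coe_mem _⟩
  map_zero' := by ext i j; simp
  map_add' X Y := by
    ext i j
    change (DirectSum.decompose 𝒜 (X i j + Y i j) _ : R) = _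
    rw [DirectSum.decompose_add]
    rfl

instance matrixGradedMonoid (m : ℕ) : SetLike.GradedMonoid (matrixGrade 𝒜 m) where
  one_mem i j := by
    by_cases h : i = j
    · subst h
      rw [Matrix.one_apply_eq]
      have : (0 : ZMod 2) + indexParity i + indexParity i = 0 := by
        generalize indexParity i = r; revert r; decide
      rw [this]
      exact SetLike.one_mem_graded 𝒜
    · rw [Matrix.one_apply_ne h]
      exact zero_mem _
  mul_mem p q X Y hX hY i j := by
    rw [Matrix.mul_apply]
    refine sum_mem fun l _ => ?_
    have h := SetLike.mul_mem_graded (hX i l) (hY l j)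
    have e : ∀ p q a b c : ZMod 2, p + a + c + (q + c + b) = p + q + a + b := by decide
    rwa [e] at h

instance matrixDecomposition (m : ℕ) : DirectSum.Decomposition (matrixGrade 𝒜 m) :=
  DirectSum.Decomposition.ofAddHom _
    (∑ p : ZMod 2, (DirectSum.of (fun p => matrixGrade 𝒜 m p) p).comp (matrixProj 𝒜 m p))
    (by
      classical
      ext X i j
      have h2 : ∀ (r : R) (a b : ZMod 2),
          ∑ p : ZMod 2, (DirectSum.decompose 𝒜 r (p + a + b) : R) = r := by
        intro r a b
        refine (Fintype.sum_equiv ((Equiv.addRight a).trans (Equiv.addRight b)) _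
          (fun p => (DirectSum.decompose 𝒜 r p : R)) (fun _ => rfl)).trans ?_
        conv_rhs => rw [← DirectSum.sum_support_decompose 𝒜 r]
        refine (Finset.sum_subset (Finset.subset_univ _) fun p _ hp => ?_).symm
        simpa using hp
      simp only [AddMonoidHom.comp_apply, AddMonoidHom.finsetSum_apply, map_sum,
        DirectSum.coeAddMonoidHom_of, AddMonoidHom.id_apply, Matrix.sum_apply]
      exact h2 _ _ _)
    (by
      ext p Y : 2
      simp only [AddMonoidHom.comp_apply, AddMonoidHom.finsetSum_apply,
        DirectSum.coeAddMonoidHom_of, AddMonoidHom.id_apply]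
      rw [Finset.sum_eq_single p]
      · congr 1
        ext i j
        exact DirectSum.decompose_of_mem_same 𝒜 (Y.2 i j)
      · intro q _ hq
        have : matrixProj 𝒜 m q (Y : SuperMatrix R m) = 0 := by
          ext i j
          refine DirectSum.decompose_of_mem_ne 𝒜 (Y.2 i j) fun h => hq ?_
          simpa using h.symm
        rw [this, map_zero]
      · simp)

instance matrixGradedAlgebra (m : ℕ) : GradedAlgebra (matrixGrade 𝒜 m) where

/-- The Lie superalgebra `gl_{m|m}(R)`. -/
def glLie (m : ℕ) : LieSuperalgebra k (SuperMatrix R m) :=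
  LieSuperalgebra.ofAssociative (matrixGrade 𝒜 m)

variable {𝒜}

/-- The periplectic superinvolution of `M_{m|m}(R)`, given on block matrices by
`(A, B; C, D) ↦ (bar D ^ t, - bar (ρ B) ^ t; bar (ρ C) ^ t, bar A ^ t)`. -/
def prp (σ : Superinvolution 𝒜) {m : ℕ} (X : SuperMatrix R m) : SuperMatrix R m :=
  Matrix.fromBlocks
    (X.toBlocks₂₂.map σ.bar).transpose
    (-((X.toBlocks₁₂.map (signMap 𝒜)).map σ.bar).transpose)
    ((X.toBlocks₂₁.map (signMap 𝒜)).map σ.bar).transpose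
    (X.toBlocks₁₁.map σ.bar).transpose

theorem prp_add (σ : Superinvolution 𝒜) {m : ℕ} (X Y : SuperMatrix R m) :
    prp σ (X + Y) = prp σ X + prp σ Y := by
  ext (i | i) (j | j) <;>
    simp [prp, Matrix.toBlocks₁₁, Matrix.toBlocks₁₂, Matrix.toBlocks₂₁, Matrix.toBlocks₂₂, add_comm]

theorem prp_smul (σ : Superinvolution 𝒜) {m : ℕ} (c : k) (X : SuperMatrix R m) :
    prp σ (c • X) = c • prp σ X := by
  ext (i | i) (j | j) <;>
    simp [prp, Matrix.toBlocks₁₁, Matrix.toBlocks₁₂, Matrix.toBlocks₂₁, Matrix.toBlocks₂₂]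

theorem signMap_mem {p : ZMod 2} {a : R} (ha : a ∈ 𝒜 p) : signMap 𝒜 a ∈ 𝒜 p := by
  rw [signMap_apply 𝒜 ha]
  exact zsmul_mem ha _

theorem prp_mem (σ : Superinvolution 𝒜) {m : ℕ} {p : ZMod 2} {X : SuperMatrix R m}
    (hX : X ∈ matrixGrade 𝒜 m p) : prp σ X ∈ matrixGrade 𝒜 m p := by
  have e : ∀ p : ZMod 2, p + 1 + 1 = p := by decide
  rintro (i | i) (j | j)
  · have h := hX (.inr j) (.inr i)
    simp only [indexParity, add_zero, e] at h ⊢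
    exact σ.bar_mem h
  · have h := hX (.inl j) (.inr i)
    simp only [indexParity, add_zero] at h ⊢
    exact neg_mem (σ.bar_mem (signMap_mem h))
  · have h := hX (.inr j) (.inl i)
    simp only [indexParity, add_zero] at h ⊢
    exact σ.bar_mem (signMap_mem h)
  · have h := hX (.inl j) (.inl i)
    simp only [indexParity, add_zero, e] at h ⊢
    exact σ.bar_mem h

set_option linter.unusedSimpArgs false in
theorem prp_mul (σ : Superinvolution 𝒜) {m : ℕ} {p q : ZMod 2} {X Y : SuperMatrix R m}
    (hX : X ∈ matrixGrade 𝒜 m p) (hY : Y ∈ matrixGrade 𝒜 m q) :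
    prp σ (X * Y) = superSign (p * q) • (prp σ Y * prp σ X) := by
  have e : ∀ p : ZMod 2, p + 1 + 1 = p := by decide
  have hA : ∀ i j, X (.inl i) (.inl j) ∈ 𝒜 p := fun i j => by
    simpa [indexParity] using hX (.inl i) (.inl j)
  have hB : ∀ i j, X (.inl i) (.inr j) ∈ 𝒜 (p + 1) := fun i j => by
    simpa [indexParity] using hX (.inl i) (.inr j)
  have hC : ∀ i j, X (.inr i) (.inl j) ∈ 𝒜 (p + 1) := fun i j => by
    simpa [indexParity] using hX (.inr i) (.inl j)
  have hD : ∀ i j, X (.inr i) (.inr j) ∈ 𝒜 p := fun i j => by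
    simpa [indexParity, e] using hX (.inr i) (.inr j)
  have hA' : ∀ i j, Y (.inl i) (.inl j) ∈ 𝒜 q := fun i j => by
    simpa [indexParity] using hY (.inl i) (.inl j)
  have hB' : ∀ i j, Y (.inl i) (.inr j) ∈ 𝒜 (q + 1) := fun i j => by
    simpa [indexParity] using hY (.inl i) (.inr j)
  have hC' : ∀ i j, Y (.inr i) (.inl j) ∈ 𝒜 (q + 1) := fun i j => by
    simpa [indexParity] using hY (.inr i) (.inl j)
  have hD' : ∀ i j, Y (.inr i) (.inr j) ∈ 𝒜 q := fun i j => by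
    simpa [indexParity, e] using hY (.inr i) (.inr j)
  have hXY := SetLike.mul_mem_graded hX hY
  have h₁₁ : ∀ {r : ZMod 2} {Z : SuperMatrix R m}, Z ∈ matrixGrade 𝒜 m r → ∀ i j,
      prp σ Z (.inl i) (.inl j) = σ.bar (Z (.inr j) (.inr i)) := fun _ _ _ => rfl
  have h₂₂ : ∀ {r : ZMod 2} {Z : SuperMatrix R m}, Z ∈ matrixGrade 𝒜 m r → ∀ i j,
      prp σ Z (.inr i) (.inr j) = σ.bar (Z (.inl j) (.inl i)) := fun _ _ _ => rfl
  have h₁₂ : ∀ {r : ZMod 2} {Z : SuperMatrix R m}, Z ∈ matrixGrade 𝒜 m r → ∀ i j,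
      prp σ Z (.inl i) (.inr j) = superSign r • σ.bar (Z (.inl j) (.inr i)) := fun {r Z} hZ i j => by
    have h : Z (.inl j) (.inr i) ∈ 𝒜 (r + 1) := by
      simpa [indexParity] using hZ (.inl j) (.inr i)
    change -σ.bar (signMap 𝒜 (Z (.inl j) (.inr i))) = _
    have e : ∀ r, superSign (r + 1) = - superSign r := by decide
    rw [signMap_apply 𝒜 h, e, map_zsmul, neg_smul, neg_neg]
  have h₂₁ : ∀ {r : ZMod 2} {Z : SuperMatrix R m}, Z ∈ matrixGrade 𝒜 m r → ∀ i j,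
      prp σ Z (.inr i) (.inl j) = -(superSign r • σ.bar (Z (.inr j) (.inl i))) :=
      fun {r Z} hZ i j => by
    have h : Z (.inr j) (.inl i) ∈ 𝒜 (r + 1) := by
      simpa [indexParity] using hZ (.inr j) (.inl i)
    change σ.bar (signMap 𝒜 (Z (.inr j) (.inl i))) = _
    have e : ∀ r, superSign (r + 1) = - superSign r := by decide
    rw [signMap_apply 𝒜 h, e, map_zsmul, neg_smul]
  have s1 : ∀ p q, superSign (p + q) = superSign p * superSign q := by decide
  have s2 : ∀ p q, superSign ((p + 1) * q) = superSign (p * q) * superSign q := by decide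
  have s3 : ∀ p q, superSign (p * (q + 1)) = superSign (p * q) * superSign p := by decide
  have s4 : ∀ p q, superSign ((p + 1) * (q + 1)) =
    -(superSign (p * q) * superSign p * superSign q) := by decide
  have s5 : ∀ p, superSign p = 1 ∨ superSign p = -1 := by decide
  ext (i | i) (j | j)
  · rw [h₁₁ hXY, Matrix.smul_apply, Matrix.mul_apply, Matrix.mul_apply, Fintype.sum_sum_type,
      Fintype.sum_sum_type]
    simp only [h₁₁ hX, h₁₁ hY, h₁₂ hY, h₂₁ hX, map_add, map_sum, σ.bar_mul (hC _ _) (hB' _ _),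
      σ.bar_mul (hD _ _) (hD' _ _), s4]
    simp only [smul_add, Finset.smul_sum, neg_add, ← Finset.sum_neg_distrib]
    refine (add_comm _ _).trans ?_
    refine congrArg₂ _ (Finset.sum_congr rfl fun l _ => ?_)
      (Finset.sum_congr rfl fun l _ => ?_) <;>
      rcases s5 p with h | h <;> rcases s5 q with h' | h' <;>
      simp only [h, h', mul_one, mul_neg, neg_mul, neg_neg, neg_smul, smul_neg, one_smul]
  · rw [h₁₂ hXY, Matrix.smul_apply, Matrix.mul_apply, Matrix.mul_apply, Fintype.sum_sum_type,
      Fintype.sum_sum_type]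
    simp only [h₁₁ hY, h₁₂ hY, h₁₂ hX, h₂₂ hX, map_add, map_sum, σ.bar_mul (hA _ _) (hB' _ _),
      σ.bar_mul (hB _ _) (hD' _ _), s2, s3, s1]
    simp only [smul_add, Finset.smul_sum, neg_add, ← Finset.sum_neg_distrib]
    refine (add_comm _ _).trans ?_
    refine congrArg₂ _ (Finset.sum_congr rfl fun l _ => ?_)
      (Finset.sum_congr rfl fun l _ => ?_) <;>
      rcases s5 p with h | h <;> rcases s5 q with h' | h' <;>
      simp only [h, h', mul_one, mul_neg, neg_mul, neg_neg, neg_smul, smul_neg, one_smul]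
  · rw [h₂₁ hXY, Matrix.smul_apply, Matrix.mul_apply, Matrix.mul_apply, Fintype.sum_sum_type,
      Fintype.sum_sum_type]
    simp only [h₂₁ hY, h₁₁ hX, h₂₂ hY, h₂₁ hX, map_add, map_sum, σ.bar_mul (hC _ _) (hA' _ _),
      σ.bar_mul (hD _ _) (hC' _ _), s2, s3, s1]
    simp only [smul_add, Finset.smul_sum, neg_add, ← Finset.sum_neg_distrib]
    refine (add_comm _ _).trans ?_
    refine congrArg₂ _ (Finset.sum_congr rfl fun l _ => ?_)
      (Finset.sum_congr rfl fun l _ => ?_) <;>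
      rcases s5 p with h | h <;> rcases s5 q with h' | h' <;>
      simp only [h, h', mul_one, mul_neg, neg_mul, neg_neg, neg_smul, smul_neg, one_smul]
  · rw [h₂₂ hXY, Matrix.smul_apply, Matrix.mul_apply, Matrix.mul_apply, Fintype.sum_sum_type,
      Fintype.sum_sum_type]
    simp only [h₂₂ hY, h₂₂ hX, h₂₁ hY, h₁₂ hX, map_add, map_sum, σ.bar_mul (hA _ _) (hA' _ _),
      σ.bar_mul (hB _ _) (hC' _ _), s4]
    simp only [smul_add, Finset.smul_sum, neg_add, ← Finset.sum_neg_distrib]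
    refine (add_comm _ _).trans ?_
    refine congrArg₂ _ (Finset.sum_congr rfl fun l _ => ?_)
      (Finset.sum_congr rfl fun l _ => ?_) <;>
      rcases s5 p with h | h <;> rcases s5 q with h' | h' <;>
      simp only [h, h', mul_one, mul_neg, neg_mul, neg_neg, neg_smul, smul_neg, one_smul]

/-- The Lie superalgebra of all matrices that are skew-symmetric for the periplectic
superinvolution. -/
def pTilde (σ : Superinvolution 𝒜) (m : ℕ) : Submodule k (SuperMatrix R m) where
  carrier := {X | prp σ X = -X}
  add_mem' {X Y} hX hY := by
    change prp σ (X + Y) = _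
    rw [prp_add, hX, hY, neg_add]
  zero_mem' := by
    change prp σ 0 = _
    simpa using prp_smul σ (0 : k) (0 : SuperMatrix R m)
  smul_mem' c X hX := by
    change prp σ (c • X) = _
    rw [prp_smul, hX, smul_neg]

theorem pTilde_isSub (σ : Superinvolution 𝒜) (m : ℕ) : (glLie 𝒜 m).IsSub (pTilde σ m) := by
  have hc := (glLie 𝒜 m).isCompl
  have hg : pTilde σ m ≤
      (pTilde σ m ⊓ (glLie 𝒜 m).grade 0) ⊔ (pTilde σ m ⊓ (glLie 𝒜 m).grade 1) := by
    intro X hX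
    obtain ⟨Y, hY, Z, hZ, rfl⟩ := Submodule.mem_sup.mp
      (hc.sup_eq_top.symm ▸ Submodule.mem_top : X ∈ (glLie 𝒜 m).grade 0 ⊔ (glLie 𝒜 m).grade 1)
    have hX' : prp σ (Y + Z) = -(Y + Z) := hX
    rw [prp_add] at hX'
    have h1 : prp σ Y + Y = -(prp σ Z + Z) := by
      rw [eq_neg_iff_add_eq_zero]
      calc prp σ Y + Y + (prp σ Z + Z) = (prp σ Y + prp σ Z) + (Y + Z) := by abel
        _ = 0 := by rw [hX']; abel
    have h2 : prp σ Y + Y = 0 := by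
      refine (Submodule.disjoint_def.mp hc.disjoint) _ (add_mem (prp_mem σ hY) hY) ?_
      rw [h1]
      exact neg_mem (add_mem (prp_mem σ hZ) hZ)
    rw [h2, eq_comm, neg_eq_zero] at h1
    exact Submodule.mem_sup.mpr ⟨Y, ⟨eq_neg_of_add_eq_zero_left h2, hY⟩, Z,
      ⟨eq_neg_of_add_eq_zero_left h1, hZ⟩, rfl⟩
  refine ⟨hg, ?_⟩
  have key : ∀ (p q : ZMod 2), ∀ X ∈ pTilde σ m ⊓ (glLie 𝒜 m).grade p,
      ∀ Y ∈ pTilde σ m ⊓ (glLie 𝒜 m).grade q, (glLie 𝒜 m).bracket X Y ∈ pTilde σ m := by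
    rintro p q X ⟨hX, hXp⟩ Y ⟨hY, hYq⟩
    have e := superCommutator_apply (matrixGrade 𝒜 m) hXp hYq
    change superCommutator (matrixGrade 𝒜 m) X Y ∈ _
    rw [e]
    have hX' : prp σ X = -X := hX
    have hY' : prp σ Y = -Y := hY
    have e2 : superSign (q * p) = superSign (p * q) := by rw [mul_comm]
    have e3 : superSign (p * q) = 1 ∨ superSign (p * q) = -1 := by
      generalize p * q = r
      revert r
      decide
    have e4 : ∀ X : SuperMatrix R m, prp σ (-X) = -prp σ X := fun X => by
      simpa using prp_smul σ (-1 : k) X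
    change prp σ _ = _
    rcases e3 with h | h <;>
      simp [h, e2, sub_eq_add_neg, prp_add, e4, prp_mul σ hXp hYq, prp_mul σ hYq hXp, hX', hY',
        add_comm]
  intro X hX Y hY
  obtain ⟨X0, hX0, X1, hX1, rfl⟩ := Submodule.mem_sup.mp (hg hX)
  obtain ⟨Y0, hY0, Y1, hY1, rfl⟩ := Submodule.mem_sup.mp (hg hY)
  simp only [map_add, LinearMap.add_apply]
  exact add_mem (add_mem (key _ _ _ hX0 _ hY0) (key _ _ _ hX1 _ hY0))
    (add_mem (key _ _ _ hX0 _ hY1) (key _ _ _ hX1 _ hY1))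

/-- The carrier of the generalized periplectic Lie superalgebra, the derived algebra of the
skew-symmetric matrices. -/
def periplectic (σ : Superinvolution 𝒜) (m : ℕ) : Submodule k (SuperMatrix R m) :=
  (glLie 𝒜 m).derived (pTilde σ m)

/-- The generalized periplectic Lie superalgebra `p_m(R, bar)`. -/
def periplecticLie (σ : Superinvolution 𝒜) (m : ℕ) : LieSuperalgebra k (periplectic σ m) :=
  (glLie 𝒜 m).restrict _ (pTilde_isSub σ m).derived

/-- The matrix `t_{ij}(a) = e_{ij}(a) - e_{m+j,m+i}(bar a)`. -/
def tMat (σ : Superinvolution 𝒜) {m : ℕ} (i j : Fin m) (a : R) : SuperMatrix R m :=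
  Matrix.single (.inl i) (.inl j) a - Matrix.single (.inr j) (.inr i) (σ.bar a)

/-- The matrix `f_{ij}(a) = e_{i,m+j}(a) + e_{j,m+i}(ρ (bar a))`. -/
def fMat (σ : Superinvolution 𝒜) {m : ℕ} (i j : Fin m) (a : R) : SuperMatrix R m :=
  Matrix.single (.inl i) (.inr j) a + Matrix.single (.inl j) (.inr i) (signMap 𝒜 (σ.bar a))

/-- The matrix `g_{ij}(a) = e_{m+i,j}(a) - e_{m+j,i}(ρ (bar a))`. -/
def gMat (σ : Superinvolution 𝒜) {m : ℕ} (i j : Fin m) (a : R) : SuperMatrix R m :=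
  Matrix.single (.inr i) (.inl j) a - Matrix.single (.inr j) (.inl i) (signMap 𝒜 (σ.bar a))

end Periplectic

/-! ### Lie superalgebras given by generators and relations -/

section Presentation

variable (k : Type*) {X : Type*} [CommRing k] (deg : X → ZMod 2)

/-- The parity of a non-associative word. -/
def wordParity : FreeMagma X → ZMod 2
  | .of x => deg x
  | .mul u v => wordParity u + wordParity v

/-- The elements of parity `p` of the free non-associative algebra on `X`: the combinations of
words of parity `p`. -/
def freeGrade (p : ZMod 2) : Submodule k (FreeNonUnitalNonAssocAlgebra k X) :=
  Submodule.span k {x | ∃ w : FreeMagma X, wordParity deg w = p ∧ x = MonoidAlgebra.single w 1}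

variable (rel : FreeNonUnitalNonAssocAlgebra k X → Prop)

/-- Ideals of the free non-associative algebra that contain the given relators and modulo which
the axioms of a Lie superalgebra hold. -/
structure IsLieIdealFor (I : Submodule k (FreeNonUnitalNonAssocAlgebra k X)) : Prop where
  mul_mem_left : ∀ x, ∀ y ∈ I, x * y ∈ I
  mul_mem_right : ∀ x ∈ I, ∀ y, x * y ∈ I
  rel_mem : ∀ x, rel x → x ∈ I
  antisymm_mem : ∀ p q, ∀ x ∈ freeGrade k deg p, ∀ y ∈ freeGrade k deg q,
    x * y + superSign (p * q) • (y * x) ∈ I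
  jacobi_mem : ∀ p q r, ∀ x ∈ freeGrade k deg p, ∀ y ∈ freeGrade k deg q,
    ∀ z ∈ freeGrade k deg r,
    x * (y * z) - ((x * y) * z + superSign (p * q) • (y * (x * z))) ∈ I

/-- The smallest such ideal. -/
def presentedIdeal : Submodule k (FreeNonUnitalNonAssocAlgebra k X) :=
  sInf {I | IsLieIdealFor k deg rel I}

theorem presentedIdeal_isLieIdealFor :
    IsLieIdealFor k deg rel (presentedIdeal k deg rel) where
  mul_mem_left x y hy := by
    rw [presentedIdeal, Submodule.mem_sInf] at hy ⊢
    exact fun I hI => hI.mul_mem_left x y (hy I hI)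
  mul_mem_right x hx y := by
    rw [presentedIdeal, Submodule.mem_sInf] at hx ⊢
    exact fun I hI => hI.mul_mem_right x (hx I hI) y
  rel_mem x hx := by
    rw [presentedIdeal, Submodule.mem_sInf]
    exact fun I hI => hI.rel_mem x hx
  antisymm_mem p q x hx y hy := by
    rw [presentedIdeal, Submodule.mem_sInf]
    exact fun I hI => hI.antisymm_mem p q x hx y hy
  jacobi_mem p q r x hx y hy z hz := by
    rw [presentedIdeal, Submodule.mem_sInf]
    exact fun I hI => hI.jacobi_mem p q r x hx y hy z hz

/-- The underlying module of the Lie superalgebra generated by `X` subject to the relators. -/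
abbrev Presented := FreeNonUnitalNonAssocAlgebra k X ⧸ presentedIdeal k deg rel

/-- The bracket of the presented Lie superalgebra, induced by the product of the free algebra. -/
def presentedBracket :
    Presented k deg rel →ₗ[k] Presented k deg rel →ₗ[k] Presented k deg rel :=
  (presentedIdeal k deg rel).liftQ
    { toFun := fun x => (presentedIdeal k deg rel).mapQ (presentedIdeal k deg rel)
        (LinearMap.mul k (FreeNonUnitalNonAssocAlgebra k X) x)
        (fun y hy => (presentedIdeal_isLieIdealFor k deg rel).mul_mem_left x y hy)
      map_add' := fun x y => Submodule.linearMap_qext _ (LinearMap.ext fun z =>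
        congrArg Submodule.Quotient.mk (add_mul x y z))
      map_smul' := fun c x => Submodule.linearMap_qext _ (LinearMap.ext fun z =>
        congrArg Submodule.Quotient.mk (smul_mul_assoc c x z)) }
    (by
      intro x hx
      rw [LinearMap.mem_ker]
      refine Submodule.linearMap_qext _ (LinearMap.ext fun y => ?_)
      exact (Submodule.Quotient.mk_eq_zero _).mpr
        ((presentedIdeal_isLieIdealFor k deg rel).mul_mem_right x hx y))

variable {k deg rel}

theorem presentedBracket_mk (x y : FreeNonUnitalNonAssocAlgebra k X) :
    presentedBracket k deg rel (Submodule.Quotient.mk x) (Submodule.Quotient.mk y) =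
      Submodule.Quotient.mk (x * y) := rfl

theorem of_mem_freeGrade (x : X) :
    FreeNonUnitalNonAssocAlgebra.of k x ∈ freeGrade k deg (deg x) :=
  Submodule.subset_span ⟨FreeMagma.of x, rfl, rfl⟩

theorem mul_mem_freeGrade {p q : ZMod 2} {x y : FreeNonUnitalNonAssocAlgebra k X}
    (hx : x ∈ freeGrade k deg p) (hy : y ∈ freeGrade k deg q) :
    x * y ∈ freeGrade k deg (p + q) := by
  induction hx using Submodule.span_induction with
  | mem x h =>
    obtain ⟨u, hu, rfl⟩ := h
    induction hy using Submodule.span_induction with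
    | mem y h =>
      obtain ⟨v, hv, rfl⟩ := h
      refine Submodule.subset_span ⟨u * v, ?_, ?_⟩
      · rw [← hu, ← hv]; rfl
      · rw [MonoidAlgebra.single_mul_single, one_mul]
    | zero => simp
    | add a b _ _ ha hb => rw [mul_add]; exact add_mem ha hb
    | smul c a _ ha => rw [mul_smul_comm]; exact Submodule.smul_mem _ c ha
  | zero => simp
  | add a b _ _ ha hb => rw [add_mul]; exact add_mem ha hb
  | smul c a _ ha => rw [smul_mul_assoc]; exact Submodule.smul_mem _ c ha

theorem freeGrade_sup_eq_top : freeGrade k deg 0 ⊔ freeGrade k deg 1 = ⊤ := by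
  have h : ∀ p : ZMod 2, p = 0 ∨ p = 1 := by decide
  rw [eq_top_iff]
  rintro x -
  induction x using MonoidAlgebra.induction_linear with
  | zero => exact zero_mem _
  | add a b ha hb => exact add_mem ha hb
  | single w c =>
    have e : (MonoidAlgebra.single w c : FreeNonUnitalNonAssocAlgebra k X) =
        c • MonoidAlgebra.single w 1 := by
      rw [MonoidAlgebra.smul_single, smul_eq_mul, mul_one]
    rw [e]
    refine Submodule.smul_mem _ c ?_
    rcases h (wordParity deg w) with h | h
    · exact Submodule.mem_sup_left (Submodule.subset_span ⟨w, h, rfl⟩)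
    · exact Submodule.mem_sup_right (Submodule.subset_span ⟨w, h, rfl⟩)

/-- The parity automorphism of the free non-associative algebra. -/
def parityMap (k : Type*) [CommRing k] (deg : X → ZMod 2) :
    FreeNonUnitalNonAssocAlgebra k X →ₙₐ[k] FreeNonUnitalNonAssocAlgebra k X :=
  FreeNonUnitalNonAssocAlgebra.lift k
    (fun x => superSign (deg x) • FreeNonUnitalNonAssocAlgebra.of k x)

theorem parityMap_single (w : FreeMagma X) :
    parityMap k deg (MonoidAlgebra.single w (1 : k)) =
      superSign (wordParity deg w) • MonoidAlgebra.single w (1 : k) := by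
  induction w using FreeMagma.recOnMul with
  | ih1 x => exact FreeNonUnitalNonAssocAlgebra.lift_of_apply k _ x
  | ih2 u v hu hv =>
    have e : (MonoidAlgebra.single (u * v) 1 : FreeNonUnitalNonAssocAlgebra k X) =
        MonoidAlgebra.single u 1 * MonoidAlgebra.single v 1 := by
      rw [MonoidAlgebra.single_mul_single, one_mul]
    rw [e, map_mul, hu, hv, smul_mul_smul_comm, superSign_mul_superSign]
    rfl

theorem parityMap_apply {p : ZMod 2} {x : FreeNonUnitalNonAssocAlgebra k X}
    (hx : x ∈ freeGrade k deg p) : parityMap k deg x = superSign p • x := by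
  induction hx using Submodule.span_induction with
  | mem x h =>
    obtain ⟨u, rfl, rfl⟩ := h
    exact parityMap_single u
  | zero => simp
  | add a b _ _ ha hb => rw [map_add, ha, hb, smul_add]
  | smul c a _ ha => rw [map_smul, ha, smul_comm]

theorem parityMap_mem (hrel : ∀ x, rel x → ∃ p, x ∈ freeGrade k deg p)
    {x : FreeNonUnitalNonAssocAlgebra k X} (hx : x ∈ presentedIdeal k deg rel) :
    parityMap k deg x ∈ presentedIdeal k deg rel := by
  have hI := presentedIdeal_isLieIdealFor k deg rel
  let J : Submodule k (FreeNonUnitalNonAssocAlgebra k X) :=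
    (presentedIdeal k deg rel).comap (parityMap k deg : _ →ₗ[k] _)
  have hJ : IsLieIdealFor k deg rel J := by
    have hom : ∀ p, ∀ x ∈ freeGrade k deg p, x ∈ presentedIdeal k deg rel → x ∈ J := by
      intro p x hx hxI
      change parityMap k deg x ∈ presentedIdeal k deg rel
      rw [parityMap_apply hx]
      exact zsmul_mem hxI _
    refine ⟨?_, ?_, ?_, ?_, ?_⟩
    · intro x y hy
      change parityMap k deg (x * y) ∈ presentedIdeal k deg rel
      rw [map_mul]
      exact hI.mul_mem_left _ _ hy
    · intro x hx y
      change parityMap k deg (x * y) ∈ presentedIdeal k deg rel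
      rw [map_mul]
      exact hI.mul_mem_right _ hx _
    · intro x hx
      obtain ⟨p, hp⟩ := hrel x hx
      exact hom p x hp (hI.rel_mem x hx)
    · intro p q x hx y hy
      refine hom (p + q) _ (add_mem (mul_mem_freeGrade hx hy) (zsmul_mem ?_ _))
        (hI.antisymm_mem p q x hx y hy)
      rw [add_comm]
      exact mul_mem_freeGrade hy hx
    · intro p q r x hx y hy z hz
      refine hom (p + (q + r)) _ (sub_mem (mul_mem_freeGrade hx (mul_mem_freeGrade hy hz))
        (add_mem ?_ (zsmul_mem ?_ _))) (hI.jacobi_mem p q r x hx y hy z hz)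
      · rw [← add_assoc]
        exact mul_mem_freeGrade (mul_mem_freeGrade hx hy) hz
      · rw [add_left_comm]
        exact mul_mem_freeGrade hy (mul_mem_freeGrade hx hz)
  exact (sInf_le hJ : presentedIdeal k deg rel ≤ J) hx

variable (k deg rel)

/-- The Lie superalgebra generated by elements `x` of `X` of parity `deg x` subject to the given
homogeneous relators. -/
def presentedLie [Invertible (2 : k)] (hrel : ∀ x, rel x → ∃ p, x ∈ freeGrade k deg p) :
    LieSuperalgebra k (Presented k deg rel) where
  grade p := (freeGrade k deg p).map (presentedIdeal k deg rel).mkQ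
  isCompl := by
    constructor
    · rw [Submodule.disjoint_def]
      rintro _ ⟨y, hy, rfl⟩ ⟨z, hz, h⟩
      have h1 : y - z ∈ presentedIdeal k deg rel := (Submodule.Quotient.eq _).mp h.symm
      have h2 := parityMap_mem hrel h1
      have s0 : superSign 0 = 1 := by decide
      have s1 : superSign 1 = -1 := by decide
      rw [map_sub, parityMap_apply hy, parityMap_apply hz, s0, s1, one_smul, neg_smul, one_smul,
        sub_neg_eq_add] at h2
      have h3 : (2 : k) • y ∈ presentedIdeal k deg rel := by
        have := add_mem h1 h2
        rwa [sub_add_add_cancel, ← two_smul k] at this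
      have h4 := Submodule.smul_mem _ (⅟(2 : k)) h3
      rw [smul_smul, invOf_mul_self, one_smul] at h4
      exact (Submodule.Quotient.mk_eq_zero _).mpr h4
    · rw [codisjoint_iff, ← Submodule.map_sup, freeGrade_sup_eq_top, Submodule.map_top,
        Submodule.range_mkQ]
  bracket := presentedBracket k deg rel
  bracket_mem := by
    rintro p q _ _ ⟨x, hx, rfl⟩ ⟨y, hy, rfl⟩
    exact ⟨x * y, mul_mem_freeGrade hx hy, rfl⟩
  antisymm := by
    rintro p q _ _ ⟨x, hx, rfl⟩ ⟨y, hy, rfl⟩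
    rw [eq_neg_iff_add_eq_zero]
    exact (Submodule.Quotient.mk_eq_zero _).mpr
      ((presentedIdeal_isLieIdealFor k deg rel).antisymm_mem p q x hx y hy)
  jacobi := by
    rintro p q r _ _ _ ⟨x, hx, rfl⟩ ⟨y, hy, rfl⟩ ⟨z, hz, rfl⟩
    exact (Submodule.Quotient.eq _).mpr
      ((presentedIdeal_isLieIdealFor k deg rel).jacobi_mem p q r x hx y hy z hz)

end Presentation

/-! ### Steinberg periplectic Lie superalgebras -/

section Steinberg

variable {k R : Type*} [CommRing k] [Ring R] [Algebra k R]

/-- The generators `t_{ij}(a)`, `f_{ij}(a)`, `g_{ij}(a)` for `i ≠ j` and homogeneous `a`. -/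
inductive SteinbergGen (𝒜 : ZMod 2 → Submodule k R) (m : ℕ) : Type _
  | t (i j : Fin m) (hij : i ≠ j) (p : ZMod 2) (a : 𝒜 p)
  | f (i j : Fin m) (hij : i ≠ j) (p : ZMod 2) (a : 𝒜 p)
  | g (i j : Fin m) (hij : i ≠ j) (p : ZMod 2) (a : 𝒜 p)

namespace SteinbergGen

variable {𝒜 : ZMod 2 → Submodule k R} {m : ℕ}

/-- The parities of the generators are `|a|`, `|a| + 1` and `|a| + 1`. -/
def parity : SteinbergGen 𝒜 m → ZMod 2
  | t _ _ _ p _ => p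
  | f _ _ _ p _ => p + 1
  | g _ _ _ p _ => p + 1

/-- The generators as elements of the free non-associative algebra. -/
def T {i j : Fin m} (hij : i ≠ j) {p : ZMod 2} (a : 𝒜 p) :
    FreeNonUnitalNonAssocAlgebra k (SteinbergGen 𝒜 m) :=
  FreeNonUnitalNonAssocAlgebra.of k (t i j hij p a)

def F {i j : Fin m} (hij : i ≠ j) {p : ZMod 2} (a : 𝒜 p) :
    FreeNonUnitalNonAssocAlgebra k (SteinbergGen 𝒜 m) :=
  FreeNonUnitalNonAssocAlgebra.of k (f i j hij p a)

def G {i j : Fin m} (hij : i ≠ j) {p : ZMod 2} (a : 𝒜 p) :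
    FreeNonUnitalNonAssocAlgebra k (SteinbergGen 𝒜 m) :=
  FreeNonUnitalNonAssocAlgebra.of k (g i j hij p a)

end SteinbergGen

open SteinbergGen in
/-- The defining relators of the Steinberg periplectic Lie superalgebra, a relation `u = v` being
represented by `u - v`. The product of the free algebra stands for the bracket. -/
inductive SteinbergRel {𝒜 : ZMod 2 → Submodule k R} [SetLike.GradedMonoid 𝒜]
    (σ : Superinvolution 𝒜) (m : ℕ) :
    FreeNonUnitalNonAssocAlgebra k (SteinbergGen 𝒜 m) → Prop
  | t_linear {i j : Fin m} (hij : i ≠ j) {p : ZMod 2} (c d : k) (a b : 𝒜 p) :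
      SteinbergRel σ m (T hij (c • a + d • b) - (c • T hij a + d • T hij b))
  | f_linear {i j : Fin m} (hij : i ≠ j) {p : ZMod 2} (c d : k) (a b : 𝒜 p) :
      SteinbergRel σ m (F hij (c • a + d • b) - (c • F hij a + d • F hij b))
  | g_linear {i j : Fin m} (hij : i ≠ j) {p : ZMod 2} (c d : k) (a b : 𝒜 p) :
      SteinbergRel σ m (G hij (c • a + d • b) - (c • G hij a + d • G hij b))
  /-- `f_{ij}(bar a) = f_{ji}(ρ a)` -/
  | f_bar {i j : Fin m} (hij : i ≠ j) {p : ZMod 2} (a : 𝒜 p) :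
      SteinbergRel σ m (F hij ⟨σ.bar a, σ.bar_mem a.2⟩ - F hij.symm (superSign p • a))
  /-- `g_{ij}(bar a) = - g_{ji}(ρ a)` -/
  | g_bar {i j : Fin m} (hij : i ≠ j) {p : ZMod 2} (a : 𝒜 p) :
      SteinbergRel σ m (G hij ⟨σ.bar a, σ.bar_mem a.2⟩ + G hij.symm (superSign p • a))
  /-- `[t_{ij}(a), t_{jk}(b)] = t_{ik}(ab)` -/
  | t_t {i j l : Fin m} (hij : i ≠ j) (hjl : j ≠ l) (hil : i ≠ l) {p q : ZMod 2}
      (a : 𝒜 p) (b : 𝒜 q) :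
      SteinbergRel σ m
        (T hij a * T hjl b - T hil ⟨(a : R) * (b : R), SetLike.mul_mem_graded a.2 b.2⟩)
  /-- `[t_{ij}(a), t_{kl}(b)] = 0` for `i ≠ j ≠ k ≠ l ≠ i` -/
  | t_t_zero {i j n l : Fin m} (hij : i ≠ j) (_ : j ≠ n) (hnl : n ≠ l) (_ : l ≠ i)
      {p q : ZMod 2} (a : 𝒜 p) (b : 𝒜 q) :
      SteinbergRel σ m (T hij a * T hnl b)
  /-- `[t_{ij}(a), f_{jk}(b)] = f_{ik}(ab)` -/
  | t_f {i j l : Fin m} (hij : i ≠ j) (hjl : j ≠ l) (hil : i ≠ l) {p q : ZMod 2}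
      (a : 𝒜 p) (b : 𝒜 q) :
      SteinbergRel σ m
        (T hij a * F hjl b - F hil ⟨(a : R) * (b : R), SetLike.mul_mem_graded a.2 b.2⟩)
  /-- `[t_{ij}(a), f_{kl}(b)] = 0` for `i ≠ j ≠ k ≠ l ≠ j` -/
  | t_f_zero {i j n l : Fin m} (hij : i ≠ j) (_ : j ≠ n) (hnl : n ≠ l) (_ : l ≠ j)
      {p q : ZMod 2} (a : 𝒜 p) (b : 𝒜 q) :
      SteinbergRel σ m (T hij a * F hnl b)
  /-- `[g_{ij}(a), t_{jk}(b)] = g_{ik}(ab)` -/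
  | g_t {i j l : Fin m} (hij : i ≠ j) (hjl : j ≠ l) (hil : i ≠ l) {p q : ZMod 2}
      (a : 𝒜 p) (b : 𝒜 q) :
      SteinbergRel σ m
        (G hij a * T hjl b - G hil ⟨(a : R) * (b : R), SetLike.mul_mem_graded a.2 b.2⟩)
  /-- `[g_{ij}(a), t_{kl}(b)] = 0` for `l ≠ k ≠ j ≠ i ≠ k` -/
  | g_t_zero {i j n l : Fin m} (hij : i ≠ j) (hnl : n ≠ l) (_ : n ≠ j) (_ : i ≠ n)
      {p q : ZMod 2} (a : 𝒜 p) (b : 𝒜 q) :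
      SteinbergRel σ m (G hij a * T hnl b)
  /-- `[f_{ij}(a), f_{kl}(b)] = 0` -/
  | f_f {i j n l : Fin m} (hij : i ≠ j) (hnl : n ≠ l) {p q : ZMod 2} (a : 𝒜 p) (b : 𝒜 q) :
      SteinbergRel σ m (F hij a * F hnl b)
  /-- `[g_{ij}(a), g_{kl}(b)] = 0` -/
  | g_g {i j n l : Fin m} (hij : i ≠ j) (hnl : n ≠ l) {p q : ZMod 2} (a : 𝒜 p) (b : 𝒜 q) :
      SteinbergRel σ m (G hij a * G hnl b)
  /-- `[f_{ij}(a), g_{jk}(b)] = t_{ik}(ab)` -/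
  | f_g {i j l : Fin m} (hij : i ≠ j) (hjl : j ≠ l) (hil : i ≠ l) {p q : ZMod 2}
      (a : 𝒜 p) (b : 𝒜 q) :
      SteinbergRel σ m
        (F hij a * G hjl b - T hil ⟨(a : R) * (b : R), SetLike.mul_mem_graded a.2 b.2⟩)
  /-- `[f_{ij}(a), g_{kl}(b)] = 0` for distinct `i, j, k, l` -/
  | f_g_zero {i j n l : Fin m} (hij : i ≠ j) (_ : i ≠ n) (_ : i ≠ l) (_ : j ≠ n) (_ : j ≠ l)
      (hnl : n ≠ l) {p q : ZMod 2} (a : 𝒜 p) (b : 𝒜 q) :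
      SteinbergRel σ m (F hij a * G hnl b)

variable {𝒜 : ZMod 2 → Submodule k R} [GradedAlgebra 𝒜] (σ : Superinvolution 𝒜) (m : ℕ)

open SteinbergGen in
theorem steinbergRel_homogeneous (x : FreeNonUnitalNonAssocAlgebra k (SteinbergGen 𝒜 m))
    (hx : SteinbergRel σ m x) : ∃ p, x ∈ freeGrade k SteinbergGen.parity p := by
  have hT : ∀ {i j : Fin m} (hij : i ≠ j) {p : ZMod 2} (a : 𝒜 p),
      T hij a ∈ freeGrade k SteinbergGen.parity p := by
    intro i j hij p a
    exact of_mem_freeGrade (SteinbergGen.t i j hij p a)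
  have hF : ∀ {i j : Fin m} (hij : i ≠ j) {p : ZMod 2} (a : 𝒜 p),
      F hij a ∈ freeGrade k SteinbergGen.parity (p + 1) := by
    intro i j hij p a
    exact of_mem_freeGrade (SteinbergGen.f i j hij p a)
  have hG : ∀ {i j : Fin m} (hij : i ≠ j) {p : ZMod 2} (a : 𝒜 p),
      G hij a ∈ freeGrade k SteinbergGen.parity (p + 1) := by
    intro i j hij p a
    exact of_mem_freeGrade (SteinbergGen.g i j hij p a)
  cases hx with
  | t_linear hij c d a b =>
    exact ⟨_, sub_mem (hT _ _) (add_mem (Submodule.smul_mem _ _ (hT _ _))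
      (Submodule.smul_mem _ _ (hT _ _)))⟩
  | f_linear hij c d a b =>
    exact ⟨_, sub_mem (hF _ _) (add_mem (Submodule.smul_mem _ _ (hF _ _))
      (Submodule.smul_mem _ _ (hF _ _)))⟩
  | g_linear hij c d a b =>
    exact ⟨_, sub_mem (hG _ _) (add_mem (Submodule.smul_mem _ _ (hG _ _))
      (Submodule.smul_mem _ _ (hG _ _)))⟩
  | f_bar hij a => exact ⟨_, sub_mem (hF _ _) (hF _ _)⟩
  | g_bar hij a => exact ⟨_, add_mem (hG _ _) (hG _ _)⟩
  | t_t hij hjl hil a b => exact ⟨_, sub_mem (mul_mem_freeGrade (hT _ _) (hT _ _)) (hT _ _)⟩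
  | t_t_zero hij _ hnl _ a b => exact ⟨_, mul_mem_freeGrade (hT _ _) (hT _ _)⟩
  | @t_f _ _ _ hij hjl hil p q a b =>
    refine ⟨_, sub_mem (mul_mem_freeGrade (hT _ _) (hF _ _)) ?_⟩
    rw [← add_assoc]
    exact hF _ _
  | t_f_zero hij _ hnl _ a b => exact ⟨_, mul_mem_freeGrade (hT _ _) (hF _ _)⟩
  | @g_t _ _ _ hij hjl hil p q a b =>
    refine ⟨_, sub_mem (mul_mem_freeGrade (hG _ _) (hT _ _)) ?_⟩
    rw [add_right_comm]
    exact hG _ _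
  | g_t_zero hij hnl _ _ a b => exact ⟨_, mul_mem_freeGrade (hG _ _) (hT _ _)⟩
  | f_f hij hnl a b => exact ⟨_, mul_mem_freeGrade (hF _ _) (hF _ _)⟩
  | g_g hij hnl a b => exact ⟨_, mul_mem_freeGrade (hG _ _) (hG _ _)⟩
  | @f_g _ _ _ hij hjl hil p q a b =>
    refine ⟨_, sub_mem (mul_mem_freeGrade (hF _ _) (hG _ _)) ?_⟩
    have e : ∀ p q : ZMod 2, p + 1 + (q + 1) = p + q := by decide
    rw [e]
    exact hT _ _
  | f_g_zero hij _ _ _ _ hnl a b => exact ⟨_, mul_mem_freeGrade (hF _ _) (hG _ _)⟩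

/-- The underlying module of the Steinberg periplectic Lie superalgebra. -/
abbrev Stp := Presented k (SteinbergGen.parity (𝒜 := 𝒜) (m := m)) (SteinbergRel σ m)

/-- The Steinberg periplectic Lie superalgebra `stp_m(R, bar)`. -/
def stpLie [Invertible (2 : k)] : LieSuperalgebra k (Stp σ m) :=
  presentedLie k _ _ (steinbergRel_homogeneous σ m)

namespace Stp

variable {m}

/-- The element `t_{ij}(a)` for an arbitrary `a` in `R`. -/
def t {i j : Fin m} (hij : i ≠ j) (a : R) : Stp σ m :=
  ∑ p : ZMod 2, Submodule.Quotient.mk (SteinbergGen.T hij (DirectSum.decompose 𝒜 a p))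

/-- The element `f_{ij}(a)` for an arbitrary `a` in `R`. -/
def f {i j : Fin m} (hij : i ≠ j) (a : R) : Stp σ m :=
  ∑ p : ZMod 2, Submodule.Quotient.mk (SteinbergGen.F hij (DirectSum.decompose 𝒜 a p))

/-- The element `g_{ij}(a)` for an arbitrary `a` in `R`. -/
def g {i j : Fin m} (hij : i ≠ j) (a : R) : Stp σ m :=
  ∑ p : ZMod 2, Submodule.Quotient.mk (SteinbergGen.G hij (DirectSum.decompose 𝒜 a p))

variable [Invertible (2 : k)]

/-- The element `f_i(a) = [t_{ij}(1), f_{ji}(a)]`. For `m ≥ 3` it does not depend on `j`. -/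
def fDiag {i j : Fin m} (hij : i ≠ j) (a : R) : Stp σ m :=
  (stpLie σ m).bracket (t σ hij 1) (f σ hij.symm a)

/-- The element `g_i(a) = [g_{ij}(a), t_{ji}(1)]`. For `m ≥ 3` it does not depend on `j`. -/
def gDiag {i j : Fin m} (hij : i ≠ j) (a : R) : Stp σ m :=
  (stpLie σ m).bracket (g σ hij a) (t σ hij.symm 1)

/-- The element `h_{ij}(a, b) = [f_{ij}(a), g_{ji}(b)]`. -/
def h {i j : Fin m} (hij : i ≠ j) (a b : R) : Stp σ m :=
  (stpLie σ m).bracket (f σ hij a) (g σ hij.symm b)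

variable (m)

/-- The span `stp_m^0` of the elements `h_{ij}(a, b)`. -/
def zeroPart : Submodule k (Stp σ m) :=
  Submodule.span k {x | ∃ (i j : Fin m) (hij : i ≠ j) (a b : R), x = h σ hij a b}

/-- The span `stp_m^+` of the `t_{ij}(a)`, `f_{ij}(a)` with `i < j` and of the `f_i(a)`. -/
def posPart : Submodule k (Stp σ m) :=
  Submodule.span k
    ({x | ∃ (i j : Fin m) (hij : i < j) (a : R), x = t σ hij.ne a} ∪
      {x | ∃ (i j : Fin m) (hij : i < j) (a : R), x = f σ hij.ne a} ∪
      {x | ∃ (i j : Fin m) (hij : i ≠ j) (a : R), x = fDiag σ hij a})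

/-- The span `stp_m^-` of the `t_{ij}(a)`, `g_{ij}(a)` with `i > j` and of the `g_i(a)`. -/
def negPart : Submodule k (Stp σ m) :=
  Submodule.span k
    ({x | ∃ (i j : Fin m) (hij : j < i) (a : R), x = t σ hij.ne' a} ∪
      {x | ∃ (i j : Fin m) (hij : j < i) (a : R), x = g σ hij.ne' a} ∪
      {x | ∃ (i j : Fin m) (hij : i ≠ j) (a : R), x = gDiag σ hij a})

/-- The canonical homomorphism: a homomorphism of Lie superalgebras `stp_m → p_m` that sends
`t_{ij}(a)`, `f_{ij}(a)`, `g_{ij}(a)` to the matrices of the same names. -/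
structure IsCanonicalHom (ψ : Stp σ m →ₗ[k] periplectic σ m) : Prop where
  isHom : LieSuperalgebra.IsHom (stpLie σ m) (periplecticLie σ m) ψ
  map_t : ∀ (i j : Fin m) (hij : i ≠ j) (a : R), (ψ (t σ hij a) : SuperMatrix R m) = tMat σ i j a
  map_f : ∀ (i j : Fin m) (hij : i ≠ j) (a : R), (ψ (f σ hij a) : SuperMatrix R m) = fMat σ i j a
  map_g : ∀ (i j : Fin m) (hij : i ≠ j) (a : R), (ψ (g σ hij a) : SuperMatrix R m) = gMat σ i j a

end Stp

end Steinberg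

end

/-! Both `Stp σ m` and the skew-symmetric matrices are governed by a set of 2m signed indices with
the fixed point free involution `s` that exchanges i and m + i. To a pair (u, v) belongs a root
space E u v = E (s v) (s u), consisting of t's, f's or g's. Once whole submodules are bracketed
instead of elements, the signs in antisymmetry and in the Jacobi identity become irrelevant, and the
defining relations take the uniform shape [E u v, E v w] = E u w, with zero when no indices match.
They cover only pairs with v ≠ u, s u. The remaining root spaces E u (s u), spanned by the f_i(a) or
the g_i(a), are brackets of the others. This is the notion `IsRootFamily`, and `isRootFamily` proves
it for `Stp σ m`; m ≥ 3 always supplies a third index through which to factor a bracket.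

From these axioms alone, repeated use of Jacobi (`brSub_jacobi`, `brSub_jacobi_left`) shows that the
span `cartan` of the brackets of opposite root spaces is a subalgebra normalizing every root space,
and that a sum of root spaces over a strict order reversed by `s` is a subalgebra. The function
`height` gives two opposite orders of this kind, which yield the positive and the negative part, and
`zeroPart` is the Cartan part. Together the three parts contain the generators and are closed under
the bracket, so they span everything (`sup_eq_top`).

Directness needs a representation. Checking the relations on matrices gives φ to all of M_{m|m}(R),
and `posSection` and `negSection` recover the positive and the negative component of an element from
entries of its matrix. The factor 1/2 at the diagonal places is legitimate because f_i and g_i are,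
up to sign, invariant under a ↦ ρ(bar a) (`fDiag_signMap_bar`, `gDiag_signMap_bar`). Hence φ(n + p +
z) = 0 forces n = p = 0 (`parts_eq_zero`), which makes the sum direct and puts the kernel into the
zero part.

Centrality is then formal: a kernel element lies in the zero part, so it normalizes the positive and
the negative part, where φ is injective; it therefore kills both, and by Jacobi it kills the zero
part as well. For surjectivity, every skew-symmetric matrix is an image plus a diagonal t_ll(a) with
l chosen freely. A suitable l makes that term commute with a given root vector, so the image is
normalized by all skew-symmetric matrices (`brSub_pTilde_range_le`), and two such corrections at
different places commute with each other (`periplectic_le_range`). -/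

namespace LieSuperalgebra

/-! ### Calculus of brackets of graded submodules. -/

variable {k V W : Type*} [CommRing k] [AddCommGroup V] [Module k V] [AddCommGroup W] [Module k W]

/-- The span of the brackets `[x, y]` with `x` in `N` and `y` in `P`. -/
def brSub (L : LieSuperalgebra k V) (N P : Submodule k V) : Submodule k V :=
  Submodule.map₂ L.bracket N P

/-- Graded submodules. -/
class IsGraded (L : LieSuperalgebra k V) (N : Submodule k V) : Prop where
  le : N ≤ (N ⊓ L.grade 0) ⊔ (N ⊓ L.grade 1)

section

variable (L : LieSuperalgebra k V) {N P Q X : Submodule k V}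

theorem mem_graded {p : ZMod 2} {x : V} (hx : x ∈ N) (hp : x ∈ L.grade p) :
    x ∈ (N ⊓ L.grade 0) ⊔ (N ⊓ L.grade 1) := by
  have h : p = 0 ∨ p = 1 := by clear hp; revert p; decide
  rcases h with rfl | rfl
  · exact Submodule.mem_sup_left ⟨hx, hp⟩
  · exact Submodule.mem_sup_right ⟨hx, hp⟩

instance : L.IsGraded (⊥ : Submodule k V) := ⟨bot_le⟩

instance isGraded_iSup {ι : Sort*} (F : ι → Submodule k V) [h : ∀ i, L.IsGraded (F i)] :
    L.IsGraded (⨆ i, F i) :=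
  ⟨iSup_le fun i => (h i).le.trans (sup_le_sup (inf_le_inf_right _ (le_iSup F i))
    (inf_le_inf_right _ (le_iSup F i)))⟩

variable {L} in
theorem brSub_mem {x y : V} (hx : x ∈ N) (hy : y ∈ P) : L.bracket x y ∈ L.brSub N P :=
  Submodule.apply_mem_map₂ _ hx hy

variable {L} in
theorem brSub_le : L.brSub N P ≤ X ↔ ∀ x ∈ N, ∀ y ∈ P, L.bracket x y ∈ X :=
  Submodule.map₂_le

theorem brSub_mono {N' P' : Submodule k V} (h : N ≤ N') (h' : P ≤ P') :
    L.brSub N P ≤ L.brSub N' P' :=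
  Submodule.map₂_le_map₂ h h'

theorem brSub_sup_left : L.brSub (N ⊔ P) Q = L.brSub N Q ⊔ L.brSub P Q :=
  Submodule.map₂_sup_left _ _ _ _

theorem brSub_sup_right : L.brSub Q (N ⊔ P) = L.brSub Q N ⊔ L.brSub Q P :=
  Submodule.map₂_sup_right _ _ _ _

theorem brSub_iSup_left {ι : Sort*} (F : ι → Submodule k V) :
    L.brSub (⨆ i, F i) P = ⨆ i, L.brSub (F i) P :=
  Submodule.map₂_iSup_left _ _ _

theorem brSub_iSup_right {ι : Sort*} (F : ι → Submodule k V) :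
    L.brSub P (⨆ i, F i) = ⨆ i, L.brSub P (F i) :=
  Submodule.map₂_iSup_right _ _ _

@[simp] theorem brSub_bot_left : L.brSub ⊥ P = ⊥ := Submodule.map₂_bot_left _ _

@[simp] theorem brSub_bot_right : L.brSub P ⊥ = ⊥ := Submodule.map₂_bot_right _ _

/-- Bracket containments may be tested on homogeneous elements. -/
theorem brSub_le_of_homogeneous [hN : L.IsGraded N] [hP : L.IsGraded P]
    (h : ∀ p q, ∀ x ∈ N ⊓ L.grade p, ∀ y ∈ P ⊓ L.grade q, L.bracket x y ∈ X) :
    L.brSub N P ≤ X := by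
  refine (L.brSub_mono hN.le hP.le).trans ?_
  rw [brSub_sup_left, brSub_sup_right, brSub_sup_right]
  exact sup_le (sup_le (brSub_le.mpr (h _ _)) (brSub_le.mpr (h _ _)))
    (sup_le (brSub_le.mpr (h _ _)) (brSub_le.mpr (h _ _)))

instance isGraded_brSub [L.IsGraded N] [L.IsGraded P] : L.IsGraded (L.brSub N P) :=
  ⟨L.brSub_le_of_homogeneous fun _ _ _ hx _ hy =>
    L.mem_graded (brSub_mem hx.1 hy.1) (L.bracket_mem hx.2 hy.2)⟩

/-- The sign produced by antisymmetry is ±1 and is absorbed by the submodule. Gradedness is needed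
because antisymmetry is only given for homogeneous elements. -/
theorem brSub_comm_le [L.IsGraded N] [L.IsGraded P] : L.brSub N P ≤ L.brSub P N :=
  L.brSub_le_of_homogeneous fun p q x hx y hy => by
    rw [L.antisymm hx.2 hy.2]
    exact neg_mem (zsmul_mem (brSub_mem hy.1 hx.1) _)

variable (N P) in
theorem brSub_comm [L.IsGraded N] [L.IsGraded P] : L.brSub N P = L.brSub P N :=
  le_antisymm L.brSub_comm_le L.brSub_comm_le

-- For homogeneous x, y, z the super Jacobi identity writes [x,[y,z]] as an element of [[N,P],Q]
-- plus or minus one of [P,[N,Q]]. In this form the identity is used throughout: to bound a triple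
-- bracket, bound the two others.
variable {L} in
theorem brSub_jacobi [L.IsGraded N] [L.IsGraded P] [L.IsGraded Q]
    (h1 : L.brSub (L.brSub N P) Q ≤ X) (h2 : L.brSub P (L.brSub N Q) ≤ X) :
    L.brSub N (L.brSub P Q) ≤ X := by
  have key : ∀ p, ∀ x ∈ N ⊓ L.grade p, L.brSub P Q ≤ X.comap (L.bracket x) := fun p x hx =>
    L.brSub_le_of_homogeneous fun q r y hy z hz => by
      change L.bracket x (L.bracket y z) ∈ X
      rw [L.jacobi hx.2 hy.2 hz.2]
      exact add_mem (h1 (brSub_mem (brSub_mem hx.1 hy.1) hz.1))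
        (zsmul_mem (h2 (brSub_mem hy.1 (brSub_mem hx.1 hz.1))) _)
  exact L.brSub_le_of_homogeneous fun p q x hx y hy => key p x hx hy.1

-- The same principle for a bracket nested on the left: move Q to the front by commutativity and
-- expand [Q,[N,P]].
variable {L} in
theorem brSub_jacobi_left [L.IsGraded N] [L.IsGraded P] [L.IsGraded Q]
    (h1 : L.brSub N (L.brSub P Q) ≤ X) (h2 : L.brSub P (L.brSub N Q) ≤ X) :
    L.brSub (L.brSub N P) Q ≤ X := by
  rw [L.brSub_comm]
  refine brSub_jacobi ?_ ?_
  · rwa [L.brSub_comm Q N, L.brSub_comm]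
  · rwa [L.brSub_comm Q P]

end

theorem IsHom.map_brSub {L : LieSuperalgebra k V} {M : LieSuperalgebra k W} {φ : V →ₗ[k] W}
    (hφ : L.IsHom M φ) (N P : Submodule k V) :
    (L.brSub N P).map φ = M.brSub (N.map φ) (P.map φ) := by
  rw [brSub, brSub, Submodule.map_map₂, Submodule.map₂_map_map]
  congr 1
  ext x y
  exact hφ.map_bracket x y

theorem IsHom.isGraded_map {L : LieSuperalgebra k V} {M : LieSuperalgebra k W} {φ : V →ₗ[k] W}
    (hφ : L.IsHom M φ) (N : Submodule k V) [hN : L.IsGraded N] : M.IsGraded (N.map φ) := by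
  refine ⟨Submodule.map_le_iff_le_comap.mpr (hN.le.trans (sup_le ?_ ?_))⟩ <;>
  · rintro x ⟨hx, hp⟩
    exact M.mem_graded (Submodule.mem_map_of_mem hx) (hφ.map_grade _ x hp)

/-- If y is even, z is odd and y + z is killed, then φ y = -φ z is both even and odd, hence zero. -/
theorem IsHom.isGraded_ker {L : LieSuperalgebra k V} {M : LieSuperalgebra k W} {φ : V →ₗ[k] W}
    (hφ : L.IsHom M φ) : L.IsGraded (LinearMap.ker φ) := by
  refine ⟨fun x hx => ?_⟩
  obtain ⟨y, hy, z, hz, rfl⟩ := Submodule.mem_sup.mp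
    (L.isCompl.sup_eq_top.symm ▸ Submodule.mem_top : x ∈ L.grade 0 ⊔ L.grade 1)
  have h : φ y = -φ z := eq_neg_of_add_eq_zero_left (by simpa using hx)
  have hy' : φ y = 0 := Submodule.disjoint_def.mp M.isCompl.disjoint _ (hφ.map_grade _ y hy)
    (h ▸ neg_mem (hφ.map_grade _ z hz))
  have hz' : φ z = 0 := by rw [hy'] at h; exact neg_eq_zero.mp h.symm
  exact Submodule.mem_sup.mpr ⟨y, ⟨hy', hy⟩, z, ⟨hz', hz⟩, rfl⟩

theorem isSub_of_brSub_le {L : LieSuperalgebra k V} {N : Submodule k V} [hN : L.IsGraded N]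
    (h : L.brSub N N ≤ N) : L.IsSub N :=
  ⟨hN.le, brSub_le.mp h⟩

end LieSuperalgebra

/-! ### Root families: brackets of root spaces. -/

namespace LieSuperalgebra

variable {k V : Type*} [CommRing k] [AddCommGroup V] [Module k V]

/-- A family of graded submodules `E u v`, indexed by the pairs of elements of a set with a fixed
point free involution `s`, that multiply like the root spaces of a Lie superalgebra of skew-symmetric
matrices: `E u v` plays the role of the span of the `e_{uv}(a) ± e_{s v, s u}(a')`. -/
structure IsRootFamily (L : LieSuperalgebra k V) {I : Type*} (s : I → I)
    (E : I → I → Submodule k V) : Prop where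
  invol : ∀ u, s (s u) = u
  ne : ∀ u, s u ≠ u
  exists_third : ∀ u v, ∃ w, w ≠ u ∧ w ≠ s u ∧ w ≠ v ∧ w ≠ s v
  graded : ∀ u v, L.IsGraded (E u v)
  symm : ∀ u v, E u v = E (s v) (s u)
  brSub_eq : ∀ u v w, u ≠ v → u ≠ s v → v ≠ w → v ≠ s w → u ≠ w → u ≠ s w →
    L.brSub (E u v) (E v w) = E u w
  brSub_eq_bot : ∀ u v w x, u ≠ v → u ≠ s v → w ≠ x → w ≠ s x → v ≠ w → u ≠ x → v ≠ s x →
    u ≠ s w → L.brSub (E u v) (E w x) = ⊥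
  diag : ∀ u, E u (s u) = ⨆ y, ⨆ (_ : y ≠ u ∧ y ≠ s u), L.brSub (E u y) (E y (s u))

namespace IsRootFamily

variable {L : LieSuperalgebra k V} {I : Type*} {s : I → I} {E : I → I → Submodule k V}

/-- The axiom gives a sum over all intermediate indices, but each summand is already the whole
space. To pass from x to y, split E x (s u) as [E x y, E y (s u)]; one Jacobi term is the summand of
y, the other contains [E u x, E y (s u)] = 0. -/
theorem diag_eq (h : L.IsRootFamily s E) {u y : I} (h1 : y ≠ u) (h2 : y ≠ s u) :
    E u (s u) = L.brSub (E u y) (E y (s u)) := by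
  have := h.graded
  have h0 := h.invol
  have key : ∀ x y, x ≠ u → x ≠ s u → y ≠ u → y ≠ s u → x ≠ y → x ≠ s y →
      L.brSub (E u x) (E x (s u)) ≤ L.brSub (E u y) (E y (s u)) := by
    intro x y h1 h2 h3 h4 h5 h6
    rw [← h.brSub_eq x y (s u) (by grind) (by grind) (by grind) (by grind) (by grind) (by grind)]
    refine brSub_jacobi ?_ ?_
    · rw [h.brSub_eq u x y (by grind) (by grind) (by grind) (by grind) (by grind) (by grind)]
    · rw [h.brSub_eq_bot u x y (s u) (by grind) (by grind) (by grind) (by grind) (by grind)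
        (by grind [h.ne]) (by grind) (by grind)]
      simp
  refine le_antisymm ?_ ?_
  · rw [h.diag]
    refine iSup_le fun x => iSup_le fun hx => ?_
    -- If x and y differ neither as indices nor up to `s`, the comparison goes directly. Otherwise
    -- it passes through an index z unrelated to u and y.
    by_cases hxy : x = y ∨ x = s y
    · obtain ⟨z, hz1, hz2, hz3, hz4⟩ := h.exists_third u y
      exact (key x z hx.1 hx.2 hz1 hz2 (by grind) (by grind)).trans
        (key z y hz1 hz2 h1 h2 (by grind) (by grind))
    · exact key x y hx.1 hx.2 h1 h2 (by grind) (by grind)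
  · rw [h.diag]
    exact le_iSup_of_le y (le_iSup_of_le ⟨h1, h2⟩ le_rfl)

/-- Factor E u (s u) through a third index x. Both Jacobi terms then involve only the product axiom,
the second one after reflecting E u x to E (s x) (s u). -/
theorem brSub_diag_left (h : L.IsRootFamily s E) {u w : I} (h1 : w ≠ u) (h2 : w ≠ s u) :
    L.brSub (E u (s u)) (E (s u) w) ≤ E u w := by
  have := h.graded
  have h0 := h.invol
  obtain ⟨x, hx1, hx2, hx3, hx4⟩ := h.exists_third u w
  rw [h.diag_eq hx1 hx2]
  refine brSub_jacobi_left ?_ ?_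
  · rw [h.brSub_eq x (s u) w (by grind) (by grind) (by grind) (by grind) (by grind) (by grind),
      h.brSub_eq u x w (by grind) (by grind) (by grind) (by grind) (by grind) (by grind)]
  · rw [h.symm u x, h.brSub_eq (s x) (s u) w (by grind) (by grind) (by grind) (by grind)
      (by grind) (by grind), h.symm x (s u), h.invol,
      h.brSub_eq u (s x) w (by grind) (by grind) (by grind) (by grind) (by grind) (by grind)]

theorem brSub_le (h : L.IsRootFamily s E) {u v w : I} (huv : u ≠ v) (hvw : v ≠ w) (huw : u ≠ w) :
    L.brSub (E u v) (E v w) ≤ E u w := by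
  have := h.graded
  have h0 := h.invol
  by_cases h1 : v = s u
  · subst h1
    exact h.brSub_diag_left huw.symm hvw.symm
  by_cases h2 : w = s v
  · subst h2
    -- Reflection by `s` turns a diagonal space in the second factor into one in the first.
    rw [h.symm u v, h.symm u, L.brSub_comm, h.invol]
    convert h.brSub_diag_left (u := v) (w := s u) (by grind) (by grind) using 2
  by_cases h3 : w = s u
  · subst h3
    rw [← h.diag_eq huv.symm (by grind)]
  exact (h.brSub_eq u v w huv (by grind) hvw (by grind) huw (by grind)).le

/-- E u (s u) is factored through an index that makes the Jacobi terms vanish: a third index when w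
= u, and otherwise x itself. The case x = s u is the reflection of w = u. -/
theorem brSub_diag_eq_bot (h : L.IsRootFamily s E) {u w x : I} (hwx : w ≠ x) (hwx' : w ≠ s x)
    (h1 : w ≠ s u) (h2 : x ≠ u) : L.brSub (E u (s u)) (E w x) = ⊥ := by
  have := h.graded
  have h0 := h.invol
  have key : ∀ x, x ≠ u → x ≠ s u → L.brSub (E u (s u)) (E u x) = ⊥ := by
    intro x hx hx'
    obtain ⟨y, hy1, hy2, hy3, hy4⟩ := h.exists_third u x
    rw [h.diag_eq hy1 hy2, eq_bot_iff]
    refine brSub_jacobi_left ?_ ?_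
    · rw [h.brSub_eq_bot y (s u) u x (by grind) (by grind) (by grind) (by grind)
        (by grind [h.ne]) (by grind) (by grind) (by grind)]
      simp
    · rw [h.brSub_eq_bot u y u x (by grind) (by grind) (by grind) (by grind)
        (by grind) (by grind) (by grind) (by grind [h.ne])]
      simp
  by_cases hw : w = u
  · subst hw
    exact key x h2 (by grind)
  by_cases hx : x = s u
  · subst hx
    rw [h.symm w, h.invol]
    exact key _ (by grind) (by grind)
  -- With x as intermediate index, [E w x, E x (s u)] becomes E w (s u), which E u x kills, while E
  -- u x and E w x commute.
  rw [h.diag_eq (y := x) (by grind) (by grind), eq_bot_iff]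
  refine brSub_jacobi_left ?_ ?_
  · rw [L.brSub_comm (E x (s u)), h.brSub_eq w x (s u) (by grind) (by grind) (by grind) (by grind)
        (by grind) (by grind), h.brSub_eq_bot u x w (s u) (by grind) (by grind) (by grind)
        (by grind) (by grind) (by grind [h.ne]) (by grind) (by grind)]
  · rw [h.brSub_eq_bot u x w x (by grind) (by grind) (by grind) (by grind)
        (by grind) (by grind) (by grind [h.ne]) (by grind)]
    simp

/-- This extends the vanishing axiom to the diagonal spaces. If both factors are diagonal, the
second is written as a bracket of two spaces that both commute with the first. -/
theorem brSub_eq_bot' (h : L.IsRootFamily s E) {u v w x : I} (huv : u ≠ v) (hwx : w ≠ x)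
    (h1 : v ≠ w) (h2 : u ≠ x) (h3 : v ≠ s x) (h4 : u ≠ s w) : L.brSub (E u v) (E w x) = ⊥ := by
  have := h.graded
  have h0 := h.invol
  by_cases hu : v = s u
  · subst hu
    by_cases hw : x = s w
    · subst hw
      obtain ⟨y, hy1, hy2, hy3, hy4⟩ := h.exists_third u w
      rw [h.diag_eq hy3 hy4, eq_bot_iff]
      refine brSub_jacobi ?_ ?_
      · rw [h.brSub_diag_eq_bot (by grind) (by grind) (by grind) (by grind)]
        simp
      · rw [h.brSub_diag_eq_bot (by grind) (by grind) (by grind) (by grind)]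
        simp
    · exact h.brSub_diag_eq_bot (by grind) (by grind) (by grind) (by grind)
  · by_cases hw : x = s w
    · subst hw
      rw [L.brSub_comm]
      exact h.brSub_diag_eq_bot (by grind) (by grind) (by grind) (by grind)
    · exact h.brSub_eq_bot u v w x (by grind) (by grind) (by grind) (by grind) (by grind)
        (by grind) (by grind) (by grind)

/-! ### The Cartan part and its action on the root spaces. -/

/-- The span of the brackets of opposite root spaces. -/
def _root_.LieSuperalgebra.cartan (L : LieSuperalgebra k V) (s : I → I)
    (E : I → I → Submodule k V) : Submodule k V :=
  ⨆ u, ⨆ v, ⨆ (_ : u ≠ v ∧ u ≠ s v), L.brSub (E u v) (E v u)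

theorem le_cartan {u v : I} (h1 : u ≠ v) (h2 : u ≠ s v) :
    L.brSub (E u v) (E v u) ≤ L.cartan s E :=
  le_iSup_of_le u (le_iSup_of_le v (le_iSup_of_le ⟨h1, h2⟩ le_rfl))

theorem isGraded_cartan (h : L.IsRootFamily s E) : L.IsGraded (L.cartan s E) := by
  have := h.graded
  unfold cartan
  infer_instance

/-- Two opposite root spaces bracket into the cartan part attached to any third index. -/
theorem brSub_opposite_le (h : L.IsRootFamily s E) {u v z : I} (huv : u ≠ v) (huv' : u ≠ s v)
    (h1 : z ≠ u) (h2 : z ≠ s u) (h3 : z ≠ v) (h4 : z ≠ s v) :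
    L.brSub (E u v) (E v u) ≤ L.brSub (E u z) (E z u) ⊔ L.brSub (E z v) (E v z) := by
  have := h.graded
  have h0 := h.invol
  rw [← h.brSub_eq u z v (by grind) (by grind) (by grind) (by grind) (by grind) (by grind)]
  refine brSub_jacobi_left ?_ ?_
  · rw [h.brSub_eq z v u (by grind) (by grind) (by grind) (by grind) (by grind) (by grind)]
    exact le_sup_left
  · rw [L.brSub_comm (E u z), h.brSub_eq v u z (by grind) (by grind) (by grind) (by grind)
      (by grind) (by grind)]
    exact le_sup_right

/-- Opposite diagonal spaces are reached by factoring E u (s u) through y: the Jacobi terms land in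
[E u y, E y u] and in [E y (s u), E (s u) y]. -/
theorem brSub_le_cartan (h : L.IsRootFamily s E) {u v : I} (huv : u ≠ v) :
    L.brSub (E u v) (E v u) ≤ L.cartan s E := by
  have := h.graded
  have h0 := h.invol
  by_cases hu : v = s u
  · subst hu
    obtain ⟨y, hy1, hy2, -, -⟩ := h.exists_third u u
    rw [h.diag_eq hy1 hy2]
    refine brSub_jacobi_left ?_ ?_
    · exact (L.brSub_mono le_rfl (h.brSub_le (by grind) (by grind) (by grind))).trans
        (le_cartan (by grind) (by grind))
    · rw [L.brSub_comm (E u y)]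
      refine (L.brSub_mono le_rfl (h.brSub_le (by grind) (by grind) (by grind))).trans
        (le_cartan (by grind) (by grind))
  · exact le_cartan huv (by grind)

/-- The inner bracket replaces one index of the pair and the outer one restores it. In the excluded
cases E u v is E x y itself, so that the inner bracket would fall into the Cartan part instead of a
root space. -/
theorem brSub_opposite_brSub_le_aux (h : L.IsRootFamily s E) {x y u v : I} (hxy : x ≠ y)
    (huv : u ≠ v) (h1 : ¬ (u = x ∧ v = y)) (h2 : ¬ (u = s y ∧ v = s x)) :
    L.brSub (E x y) (L.brSub (E y x) (E u v)) ≤ E u v := by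
  have := h.graded
  have h0 := h.invol
  have key : ∀ u v, u ≠ v → ¬ (u = x ∧ v = y) → x = u →
      L.brSub (E x y) (L.brSub (E y x) (E u v)) ≤ E u v := by
    rintro u v huv h1 rfl
    refine (L.brSub_mono le_rfl (h.brSub_le (by grind) (by grind) (by grind))).trans
      (h.brSub_le (by grind) (by grind) (by grind))
  have key' : ∀ u v, u ≠ v → ¬ (u = x ∧ v = y) → y = v →
      L.brSub (E x y) (L.brSub (E y x) (E u v)) ≤ E u v := by
    rintro u v huv h1 rfl
    rw [L.brSub_comm (E y x)]
    refine (L.brSub_mono le_rfl (h.brSub_le (by grind) (by grind) (by grind))).trans ?_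
    rw [L.brSub_comm]
    exact h.brSub_le (by grind) (by grind) (by grind)
  by_cases e1 : x = u
  · exact key u v huv h1 e1
  by_cases e2 : y = v
  · exact key' u v huv h1 e2
  by_cases e3 : x = s v
  · rw [h.symm u v]
    exact key _ _ (by grind) (by grind) (by grind)
  by_cases e4 : y = s u
  · rw [h.symm u v]
    exact key' _ _ (by grind) (by grind) (by grind)
  rw [h.brSub_eq_bot' (by grind) (by grind) (by grind) (by grind) (by grind) (by grind)]
  simp

/-- By Jacobi this reduces to the two orders of E x y and E y x acting successively. That argument
fails only when E u v is E x y or E y x. -/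
theorem brSub_opposite_brSub_le (h : L.IsRootFamily s E) {x y u v : I} (hxy : x ≠ y)
    (hxy' : x ≠ s y) (huv : u ≠ v) :
    L.brSub (L.brSub (E x y) (E y x)) (E u v) ≤ E u v := by
  have := h.graded
  have h0 := h.invol
  have key : ∀ x y, x ≠ y → ¬ (u = x ∧ v = y) → ¬ (u = y ∧ v = x) →
      ¬ (u = s x ∧ v = s y) → ¬ (u = s y ∧ v = s x) →
      L.brSub (L.brSub (E x y) (E y x)) (E u v) ≤ E u v := by
    intro x y hxy h1 h2 h3 h4
    refine brSub_jacobi_left ?_ ?_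
    · exact h.brSub_opposite_brSub_le_aux hxy huv h1 h4
    · exact h.brSub_opposite_brSub_le_aux hxy.symm huv h2 h3
  obtain ⟨z, hz1, hz2, hz3, hz4⟩ := h.exists_third x y
  by_cases h1 : ¬ (u = x ∧ v = y) ∧ ¬ (u = y ∧ v = x) ∧ ¬ (u = s x ∧ v = s y) ∧
      ¬ (u = s y ∧ v = s x)
  · exact key x y hxy h1.1 h1.2.1 h1.2.2.1 h1.2.2.2
  -- In the exceptional cases [E x y, E y x] is replaced by brackets of opposite spaces through z,
  -- and E u v is exceptional for neither of them.
  refine (L.brSub_mono (h.brSub_opposite_le hxy hxy' hz1 hz2 hz3 hz4) le_rfl).trans ?_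
  rw [brSub_sup_left]
  exact sup_le (key x z (by grind) (by grind) (by grind) (by grind) (by grind))
    (key z y (by grind) (by grind) (by grind) (by grind) (by grind))

theorem brSub_cartan_le (h : L.IsRootFamily s E) {u v : I} (huv : u ≠ v) :
    L.brSub (L.cartan s E) (E u v) ≤ E u v := by
  simp only [cartan, brSub_iSup_left, iSup_le_iff]
  exact fun x y hxy => h.brSub_opposite_brSub_le hxy.1 hxy.2 huv

theorem brSub_cartan_cartan_le (h : L.IsRootFamily s E) :
    L.brSub (L.cartan s E) (L.cartan s E) ≤ L.cartan s E := by
  have := h.graded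
  have := h.isGraded_cartan
  have e : L.cartan s E = ⨆ u, ⨆ v, ⨆ (_ : u ≠ v ∧ u ≠ s v), L.brSub (E u v) (E v u) := rfl
  conv_lhs => arg 3; rw [e]
  simp only [brSub_iSup_right, iSup_le_iff]
  intro u v huv
  refine brSub_jacobi ?_ ?_
  · exact (L.brSub_mono (h.brSub_cartan_le huv.1) le_rfl).trans (le_cartan huv.1 huv.2)
  · exact (L.brSub_mono le_rfl (h.brSub_cartan_le huv.1.symm)).trans (le_cartan huv.1 huv.2)

/-! ### Sums of root spaces. -/

/-- The sum of the root spaces whose index pairs satisfy `r`. -/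
def _root_.LieSuperalgebra.rootSum (E : I → I → Submodule k V) (r : I → I → Prop) :
    Submodule k V :=
  ⨆ u, ⨆ v, ⨆ (_ : r u v), E u v

theorem le_rootSum {r : I → I → Prop} {u v : I} (huv : r u v) : E u v ≤ rootSum E r :=
  le_iSup_of_le u (le_iSup_of_le v (le_iSup_of_le huv le_rfl))

theorem isGraded_rootSum (h : L.IsRootFamily s E) (r : I → I → Prop) :
    L.IsGraded (rootSum E r) := by
  have := h.graded
  unfold rootSum
  infer_instance

/-- Two off-diagonal root spaces can interact only if a pair of their indices matches in one of four
ways. Commutativity and reflection bring each of these to the form [E a b, E b c]; without a match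
the bracket vanishes. -/
theorem brSub_le_of_match (h : L.IsRootFamily s E) {u v w x : I} (huv : u ≠ v)
    (hwx : w ≠ x) {X : Submodule k V} (h1 : v = w → L.brSub (E u v) (E v x) ≤ X)
    (h2 : u = x → L.brSub (E w u) (E u v) ≤ X)
    (h3 : v = s x → L.brSub (E u v) (E v (s w)) ≤ X)
    (h4 : u = s w → L.brSub (E (s x) u) (E u v) ≤ X) :
    L.brSub (E u v) (E w x) ≤ X := by
  have := h.graded
  have h0 := h.invol
  by_cases e1 : v = w
  · subst e1; exact h1 rfl
  by_cases e2 : u = x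
  · subst e2; rw [L.brSub_comm]; exact h2 rfl
  by_cases e3 : v = s x
  · rw [h.symm w x, ← e3]; exact h3 e3
  by_cases e4 : u = s w
  · rw [h.symm w x, ← e4, L.brSub_comm]; exact h4 e4
  rw [h.brSub_eq_bot' huv hwx e1 e2 e3 e4]
  exact bot_le

/-- The hypotheses make r a strict order reversed by `s`. Transitivity handles a product of matching
spaces, reversal handles the matches that need a reflection, and irreflexivity keeps the products
away from the Cartan part. -/
theorem brSub_rootSum_le (h : L.IsRootFamily s E) {r : I → I → Prop} (hr : ∀ u, ¬ r u u)
    (ht : ∀ u v w, r u v → r v w → r u w) (hs : ∀ u v, r u v → r (s v) (s u)) :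
    L.brSub (rootSum E r) (rootSum E r) ≤ rootSum E r := by
  have key : ∀ u v w, r u v → r v w → L.brSub (E u v) (E v w) ≤ rootSum E r := by
    intro u v w huv hvw
    have huw := ht u v w huv hvw
    exact (h.brSub_le (by grind) (by grind) (by grind)).trans (le_rootSum huw)
  conv_lhs => unfold rootSum
  simp only [brSub_iSup_left, brSub_iSup_right, iSup_le_iff]
  intro w x hwx u v huv
  refine h.brSub_le_of_match (by grind) (by grind) ?_ ?_ ?_ ?_ <;> intro e
  · exact key _ _ _ huv (e ▸ hwx)
  · exact key _ _ _ (e ▸ hwx) huv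
  · exact key _ _ _ huv (e ▸ hs _ _ hwx)
  · exact key _ _ _ (e ▸ hs _ _ hwx) huv

theorem brSub_cartan_rootSum_le (h : L.IsRootFamily s E) {r : I → I → Prop} (hr : ∀ u, ¬ r u u) :
    L.brSub (L.cartan s E) (rootSum E r) ≤ rootSum E r := by
  simp only [rootSum, brSub_iSup_right, iSup_le_iff]
  intro u v huv
  exact (h.brSub_cartan_le (by grind)).trans (le_rootSum huv)

/-- The root spaces and the cartan part together are closed under the bracket. -/
theorem brSub_sup_le (h : L.IsRootFamily s E) :
    L.brSub (rootSum E (· ≠ ·) ⊔ L.cartan s E) (rootSum E (· ≠ ·) ⊔ L.cartan s E) ≤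
      rootSum E (· ≠ ·) ⊔ L.cartan s E := by
  have := h.isGraded_cartan
  have := h.isGraded_rootSum (· ≠ ·)
  have key : ∀ u v w, u ≠ v → v ≠ w →
      L.brSub (E u v) (E v w) ≤ rootSum E (· ≠ ·) ⊔ L.cartan s E := by
    intro u v w huv hvw
    by_cases huw : u = w
    · subst huw
      exact (h.brSub_le_cartan huv).trans le_sup_right
    · exact ((h.brSub_le huv hvw huw).trans (le_rootSum huw)).trans le_sup_left
  rw [brSub_sup_left, brSub_sup_right, brSub_sup_right]
  refine sup_le (sup_le ?_ ?_) (sup_le ?_ ?_)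
  · conv_lhs => unfold rootSum
    simp only [brSub_iSup_left, brSub_iSup_right, iSup_le_iff]
    intro w x hwx u v huv
    have h0 := h.invol
    refine h.brSub_le_of_match huv hwx ?_ ?_ ?_ ?_ <;> intro e
    · exact key _ _ _ huv (by grind)
    · exact key _ _ _ (by grind) huv
    · exact key _ _ _ huv (by grind)
    · exact key _ _ _ (by grind) huv
  · rw [L.brSub_comm]
    exact (h.brSub_cartan_rootSum_le (by simp)).trans le_sup_left
  · exact (h.brSub_cartan_rootSum_le (by simp)).trans le_sup_left
  · exact h.brSub_cartan_cartan_le.trans le_sup_right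

end IsRootFamily

end LieSuperalgebra

/-! ### The universal property of a presentation. -/

namespace LieSuperalgebra

variable {k V W : Type*} [CommRing k] [AddCommGroup V] [Module k V] [AddCommGroup W] [Module k W]

/-- The underlying module of a Lie superalgebra, with the bracket as its product. -/
def BracketAlgebra (_ : LieSuperalgebra k W) : Type _ := W

namespace BracketAlgebra

variable (M : LieSuperalgebra k W)

instance : AddCommGroup M.BracketAlgebra := inferInstanceAs (AddCommGroup W)

instance : Module k M.BracketAlgebra := inferInstanceAs (Module k W)

instance : NonUnitalNonAssocRing M.BracketAlgebra :=
  { (inferInstance : AddCommGroup M.BracketAlgebra) with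
    mul := fun x y => M.bracket x y
    left_distrib := fun x y z => map_add (M.bracket x) y z
    right_distrib := fun x y z => LinearMap.map_add₂ M.bracket x y z
    zero_mul := fun x => LinearMap.map_zero₂ M.bracket x
    mul_zero := fun x => map_zero (M.bracket x) }

instance : IsScalarTower k M.BracketAlgebra M.BracketAlgebra :=
  ⟨fun c x y => LinearMap.map_smul₂ M.bracket c x y⟩

instance : SMulCommClass k M.BracketAlgebra M.BracketAlgebra :=
  ⟨fun c x y => ((M.bracket x).map_smul c y).symm⟩

end BracketAlgebra

variable {X : Type*} (M : LieSuperalgebra k W) (φ : X → W)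

/-- The linear extension of a map to a Lie superalgebra to the free non-associative algebra. -/
noncomputable def freeLift : FreeNonUnitalNonAssocAlgebra k X →ₗ[k] W where
  toFun x := FreeNonUnitalNonAssocAlgebra.lift k (A := M.BracketAlgebra) φ x
  map_add' := map_add (FreeNonUnitalNonAssocAlgebra.lift k (A := M.BracketAlgebra) φ)
  map_smul' := map_smul (FreeNonUnitalNonAssocAlgebra.lift k (A := M.BracketAlgebra) φ)

theorem freeLift_of (x : X) : M.freeLift φ (FreeNonUnitalNonAssocAlgebra.of k x) = φ x :=
  FreeNonUnitalNonAssocAlgebra.lift_of_apply k (A := M.BracketAlgebra) φ x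

theorem freeLift_mul (x y : FreeNonUnitalNonAssocAlgebra k X) :
    M.freeLift φ (x * y) = M.bracket (M.freeLift φ x) (M.freeLift φ y) :=
  map_mul (FreeNonUnitalNonAssocAlgebra.lift k (A := M.BracketAlgebra) φ) x y

variable {M φ} {deg : X → ZMod 2}

theorem freeLift_mem (hφ : ∀ x, φ x ∈ M.grade (deg x)) {p : ZMod 2}
    {x : FreeNonUnitalNonAssocAlgebra k X} (hx : x ∈ freeGrade k deg p) :
    M.freeLift φ x ∈ M.grade p := by
  have hw : ∀ w : FreeMagma X,
      M.freeLift φ (MonoidAlgebra.single w 1) ∈ M.grade (wordParity deg w) := by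
    intro w
    induction w using FreeMagma.recOnMul with
    | ih1 x =>
      have := hφ x
      rwa [← M.freeLift_of φ x] at this
    | ih2 u v hu hv =>
      have e : (MonoidAlgebra.single (u * v) 1 : FreeNonUnitalNonAssocAlgebra k X) =
          MonoidAlgebra.single u 1 * MonoidAlgebra.single v 1 := by
        rw [MonoidAlgebra.single_mul_single, one_mul]
      rw [e, freeLift_mul]
      exact M.bracket_mem hu hv
  have h : freeGrade k deg p ≤ (M.grade p).comap (M.freeLift φ) := by
    refine Submodule.span_le.mpr ?_
    rintro _ ⟨w, rfl, rfl⟩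
    exact hw w
  exact h hx

/-- The universal property of a presented Lie superalgebra. -/
theorem exists_isHom_presented [Invertible (2 : k)] {rel : FreeNonUnitalNonAssocAlgebra k X → Prop}
    (hrel : ∀ x, rel x → ∃ p, x ∈ freeGrade k deg p) (hφ : ∀ x, φ x ∈ M.grade (deg x))
    (h : ∀ x, rel x → M.freeLift φ x = 0) :
    ∃ ψ : Presented k deg rel →ₗ[k] W, (presentedLie k deg rel hrel).IsHom M ψ ∧
      ∀ x, ψ (Submodule.Quotient.mk (FreeNonUnitalNonAssocAlgebra.of k x)) = φ x := by
  -- The kernel of the free lift is one of the ideals whose infimum defines the presentation: it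
  -- contains the relators by hypothesis, and the antisymmetry and Jacobi elements because `M` is a
  -- Lie superalgebra.
  have hI : IsLieIdealFor k deg rel (LinearMap.ker (M.freeLift φ)) := by
    refine ⟨?_, ?_, h, ?_, ?_⟩
    · intro x y hy
      rw [LinearMap.mem_ker] at hy ⊢
      rw [freeLift_mul, hy, map_zero]
    · intro x hx y
      rw [LinearMap.mem_ker] at hx ⊢
      rw [freeLift_mul, hx, LinearMap.map_zero₂]
    · intro p q x hx y hy
      rw [LinearMap.mem_ker, map_add, map_zsmul, freeLift_mul, freeLift_mul,
        M.antisymm (freeLift_mem hφ hx) (freeLift_mem hφ hy), neg_add_cancel]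
    · intro p q r x hx y hy z hz
      simp only [LinearMap.mem_ker, map_sub, map_add, map_zsmul, freeLift_mul]
      rw [M.jacobi (freeLift_mem hφ hx) (freeLift_mem hφ hy) (freeLift_mem hφ hz), sub_self]
  refine ⟨(presentedIdeal k deg rel).liftQ (M.freeLift φ) (sInf_le hI), ⟨?_, ?_⟩,
    M.freeLift_of φ⟩
  · rintro p _ ⟨x, hx, rfl⟩
    exact freeLift_mem hφ hx
  · intro x y
    obtain ⟨x, rfl⟩ := Submodule.Quotient.mk_surjective _ x
    obtain ⟨y, rfl⟩ := Submodule.Quotient.mk_surjective _ y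
    exact M.freeLift_mul φ x y

/-- A submodule of a presented Lie superalgebra that contains the generators and is closed under the
bracket is everything. -/
theorem eq_top_of_presented [Invertible (2 : k)] {rel : FreeNonUnitalNonAssocAlgebra k X → Prop}
    (hrel : ∀ x, rel x → ∃ p, x ∈ freeGrade k deg p) {N : Submodule k (Presented k deg rel)}
    (hgen : ∀ x, Submodule.Quotient.mk (FreeNonUnitalNonAssocAlgebra.of k x) ∈ N)
    (hN : (presentedLie k deg rel hrel).brSub N N ≤ N) : N = ⊤ := by
  rw [eq_top_iff]
  rintro x -
  obtain ⟨x, rfl⟩ := Submodule.Quotient.mk_surjective _ x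
  induction x using MonoidAlgebra.induction_linear with
  | zero => exact zero_mem N
  | add a b ha hb => exact add_mem ha hb
  | single w c =>
    have e : (MonoidAlgebra.single w c : FreeNonUnitalNonAssocAlgebra k X) =
        c • MonoidAlgebra.single w 1 := by
      rw [MonoidAlgebra.smul_single, smul_eq_mul, mul_one]
    rw [e]
    refine Submodule.smul_mem N c (x := Submodule.Quotient.mk (MonoidAlgebra.single w (1 : k))) ?_
    induction w using FreeMagma.recOnMul with
    | ih1 x => exact hgen x
    | ih2 u v hu hv =>
      have e : (MonoidAlgebra.single (u * v) 1 : FreeNonUnitalNonAssocAlgebra k X) =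
          MonoidAlgebra.single u 1 * MonoidAlgebra.single v 1 := by
        rw [MonoidAlgebra.single_mul_single, one_mul]
      rw [e]
      exact brSub_le.mp hN _ (hu (by rw [MonoidAlgebra.smul_single, smul_eq_mul, mul_one])) _
        (hv (by rw [MonoidAlgebra.smul_single, smul_eq_mul, mul_one]))

end LieSuperalgebra

/-! ### Reduction to homogeneous elements; the sign map and the superinvolution. -/

section Homogeneous

variable {k R : Type*} [CommRing k] [Ring R] [Algebra k R] (𝒜 : ZMod 2 → Submodule k R)
  [GradedAlgebra 𝒜]

theorem superSign_eq (p : ZMod 2) : superSign p = 1 ∨ superSign p = -1 := by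
  revert p; decide

theorem decompose_zero_add_one (a : R) :
    (DirectSum.decompose 𝒜 a 0 : R) + (DirectSum.decompose 𝒜 a 1 : R) = a := by
  obtain ⟨x, hx, y, hy, rfl⟩ := Submodule.mem_sup.mp
    ((isCompl_of_gradedAlgebra 𝒜).sup_eq_top.symm ▸ Submodule.mem_top : a ∈ 𝒜 0 ⊔ 𝒜 1)
  have h : (0 : ZMod 2) ≠ 1 := by decide
  simp only [DirectSum.decompose_add, DirectSum.add_apply, Submodule.coe_add,
    DirectSum.decompose_of_mem_same 𝒜 hx, DirectSum.decompose_of_mem_same 𝒜 hy,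
    DirectSum.decompose_of_mem_ne 𝒜 hx h, DirectSum.decompose_of_mem_ne 𝒜 hy h.symm,
    zero_add, add_zero]

theorem homogeneous_induction {C : R → Prop} (hom : ∀ p, ∀ a ∈ 𝒜 p, C a)
    (add : ∀ a b, C a → C b → C (a + b)) (a : R) : C a := by
  rw [← decompose_zero_add_one 𝒜 a]
  exact add _ _ (hom 0 _ (SetLike.coe_mem _)) (hom 1 _ (SetLike.coe_mem _))

/-- Two bilinear maps that agree on homogeneous elements are equal. -/
theorem homogeneous_ext₂ {W : Type*} [AddCommGroup W] [Module k W] {B B' : R →ₗ[k] R →ₗ[k] W}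
    (h : ∀ p q, ∀ a ∈ 𝒜 p, ∀ b ∈ 𝒜 q, B a b = B' a b) : B = B' := by
  ext a b
  induction a using homogeneous_induction 𝒜 with
  | add a a' ha ha' => rw [map_add, map_add, LinearMap.add_apply, LinearMap.add_apply, ha, ha']
  | hom p a ha =>
    induction b using homogeneous_induction 𝒜 with
    | add b b' hb hb' => rw [map_add, map_add, hb, hb']
    | hom q b hb => exact h p q a ha b hb

theorem signMap_signMap (a : R) : signMap 𝒜 (signMap 𝒜 a) = a := by
  induction a using homogeneous_induction 𝒜 with
  | add a b ha hb => rw [map_add, map_add, ha, hb]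
  | hom p a ha =>
    rw [signMap_apply 𝒜 ha, map_zsmul, signMap_apply 𝒜 ha, smul_smul]
    rcases superSign_eq p with h | h <;> simp [h]

variable {𝒜} (σ : Superinvolution 𝒜)

theorem signMap_bar (a : R) : signMap 𝒜 (σ.bar a) = σ.bar (signMap 𝒜 a) := by
  induction a using homogeneous_induction 𝒜 with
  | add a b ha hb => simp only [map_add, ha, hb]
  | hom p a ha => rw [signMap_apply 𝒜 ha, signMap_apply 𝒜 (σ.bar_mem ha), map_zsmul]

/-- The map a ↦ ρ(bar a) is thus an involution. It is the one that relates f_ij to f_ji and g_ij to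
g_ji, and written through it most bracket formulas carry no parity sign. -/
theorem signMap_bar_signMap_bar (a : R) : signMap 𝒜 (σ.bar (signMap 𝒜 (σ.bar a))) = a := by
  rw [← signMap_bar, signMap_signMap, σ.bar_bar]

end Homogeneous

/-! ### Brackets of the matrices t, f and g. -/

section Matrices

variable {k R : Type*} [CommRing k] [Ring R] [Algebra k R] {𝒜 : ZMod 2 → Submodule k R}
  [GradedAlgebra 𝒜] (σ : Superinvolution 𝒜) {m : ℕ}

theorem single_mul_single_ite (u v w x : Fin m ⊕ Fin m) (a b : R) :
    Matrix.single u v a * Matrix.single w x b =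
      if v = w then Matrix.single u x (a * b) else (0 : SuperMatrix R m) := by
  split_ifs with h
  · subst h
    exact Matrix.single_mul_single_same _ _ _ _ _
  · exact Matrix.single_mul_single_of_ne _ _ _ _ h _

omit [GradedAlgebra 𝒜] in
theorem single_mem_matrixGrade {p : ZMod 2} {u v : Fin m ⊕ Fin m} {a : R}
    (ha : a ∈ 𝒜 (p + indexParity u + indexParity v)) :
    (Matrix.single u v a : SuperMatrix R m) ∈ matrixGrade 𝒜 m p := by
  intro i j
  rw [Matrix.single_apply]
  split_ifs with h
  · rw [← h.1, ← h.2]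
    exact ha
  · exact zero_mem _

omit [GradedAlgebra 𝒜] in
theorem tMat_mem {p : ZMod 2} (i j : Fin m) {a : R} (ha : a ∈ 𝒜 p) :
    tMat σ i j a ∈ matrixGrade 𝒜 m p := by
  have e : p + 1 + 1 = p := by clear ha; revert p; decide
  refine sub_mem (single_mem_matrixGrade ?_) (single_mem_matrixGrade ?_)
  · simpa [indexParity] using ha
  · simpa [indexParity, e] using σ.bar_mem ha

theorem fMat_mem {p : ZMod 2} (i j : Fin m) {a : R} (ha : a ∈ 𝒜 p) :
    fMat σ i j a ∈ matrixGrade 𝒜 m (p + 1) := by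
  have e : p + 1 + 1 = p := by clear ha; revert p; decide
  refine add_mem (single_mem_matrixGrade ?_) (single_mem_matrixGrade ?_)
  · simpa [indexParity, e] using ha
  · simpa [indexParity, e] using signMap_mem (σ.bar_mem ha)

theorem gMat_mem {p : ZMod 2} (i j : Fin m) {a : R} (ha : a ∈ 𝒜 p) :
    gMat σ i j a ∈ matrixGrade 𝒜 m (p + 1) := by
  have e : p + 1 + 1 = p := by clear ha; revert p; decide
  refine sub_mem (single_mem_matrixGrade ?_) (single_mem_matrixGrade ?_)
  · simpa [indexParity, e] using ha
  · simpa [indexParity, e] using signMap_mem (σ.bar_mem ha)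

omit [GradedAlgebra 𝒜] in
theorem tMat_add (i j : Fin m) (a b : R) : tMat σ i j (a + b) = tMat σ i j a + tMat σ i j b := by
  simp only [tMat, map_add, Matrix.single_add]; abel

omit [GradedAlgebra 𝒜] in
theorem tMat_smul (i j : Fin m) (c : k) (a : R) : tMat σ i j (c • a) = c • tMat σ i j a := by
  simp only [tMat, map_smul, smul_sub, Matrix.smul_single]

theorem fMat_add (i j : Fin m) (a b : R) : fMat σ i j (a + b) = fMat σ i j a + fMat σ i j b := by
  simp only [fMat, map_add, Matrix.single_add]; abel

theorem fMat_smul (i j : Fin m) (c : k) (a : R) : fMat σ i j (c • a) = c • fMat σ i j a := by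
  simp only [fMat, map_smul, smul_add, Matrix.smul_single]

theorem gMat_add (i j : Fin m) (a b : R) : gMat σ i j (a + b) = gMat σ i j a + gMat σ i j b := by
  simp only [gMat, map_add, Matrix.single_add]; abel

theorem gMat_smul (i j : Fin m) (c : k) (a : R) : gMat σ i j (c • a) = c • gMat σ i j a := by
  simp only [gMat, map_smul, smul_sub, Matrix.smul_single]

/-- `tMat` as a linear map. -/
def tMatₗ (i j : Fin m) : R →ₗ[k] SuperMatrix R m where
  toFun := tMat σ i j
  map_add' := tMat_add σ i j
  map_smul' := tMat_smul σ i j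

theorem fMat_signMap_bar (i j : Fin m) (a : R) :
    fMat σ i j (signMap 𝒜 (σ.bar a)) = fMat σ j i a := by
  rw [fMat, fMat, signMap_bar_signMap_bar, add_comm]

theorem gMat_signMap_bar (i j : Fin m) (a : R) :
    gMat σ i j (signMap 𝒜 (σ.bar a)) = -gMat σ j i a := by
  rw [gMat, gMat, signMap_bar_signMap_bar, neg_sub]

theorem glLie_bracket {p q : ZMod 2} {X Y : SuperMatrix R m} (hX : X ∈ matrixGrade 𝒜 m p)
    (hY : Y ∈ matrixGrade 𝒜 m q) :
    (glLie 𝒜 m).bracket X Y = X * Y - superSign (p * q) • (Y * X) :=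
  superCommutator_apply (matrixGrade 𝒜 m) hX hY

omit [GradedAlgebra 𝒜] in
theorem superMatrix_single_neg (u v : Fin m ⊕ Fin m) (a : R) :
    (Matrix.single u v (-a) : SuperMatrix R m) = -Matrix.single u v a :=
  map_neg (Matrix.singleAddMonoidHom u v) a

theorem superSign_add (p q : ZMod 2) : superSign (p + q) = superSign p * superSign q := by
  revert p q; decide

theorem superSign_one : superSign 1 = -1 := by decide

/-- The factor (-1)^{pq} in front of the term with ba keeps this formula homogeneous, whereas the
mixed ones below extend bilinearly to all of R. The index coincidences stay as conditionals, so that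
a single formula covers all the relations and also the diagonal matrices. -/
theorem glLie_tMat_tMat {p q : ZMod 2} (i j n l : Fin m) {a b : R} (ha : a ∈ 𝒜 p) (hb : b ∈ 𝒜 q) :
    (glLie 𝒜 m).bracket (tMat σ i j a) (tMat σ n l b) =
      (if j = n then tMat σ i l (a * b) else 0) -
        superSign (p * q) • (if i = l then tMat σ n j (b * a) else 0) := by
  rw [glLie_bracket (tMat_mem σ i j ha) (tMat_mem σ n l hb)]
  simp only [tMat, sub_mul, mul_sub, single_mul_single_ite, σ.bar_mul ha hb, σ.bar_mul hb ha,
    mul_comm q p, Sum.inl.injEq, Sum.inr.injEq, reduceCtorEq, if_false, @eq_comm _ n j,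
    @eq_comm _ l i]
  split_ifs <;> rcases superSign_eq (p * q) with h | h <;>
    simp only [h, one_smul, neg_smul, smul_zero, superMatrix_single_neg] <;> abel

/-- The two terms correspond to the two descriptions f_nl(b) = f_ln(ρ(bar b)) of the second factor.
-/
theorem glLie_tMat_fMat_hom {p q : ZMod 2} (i j n l : Fin m) {a b : R} (ha : a ∈ 𝒜 p)
    (hb : b ∈ 𝒜 q) :
    (glLie 𝒜 m).bracket (tMat σ i j a) (fMat σ n l b) =
      (if j = n then fMat σ i l (a * b) else 0) +
        (if j = l then fMat σ i n (a * signMap 𝒜 (σ.bar b)) else 0) := by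
  rw [glLie_bracket (tMat_mem σ i j ha) (fMat_mem σ n l hb)]
  have hb' := σ.bar_mem hb
  have ha' := σ.bar_mem ha
  simp only [fMat, tMat, sub_mul, mul_sub, add_mul, mul_add, single_mul_single_ite,
    signMap_apply 𝒜 hb', mul_smul_comm, smul_mul_assoc, map_zsmul, σ.bar_mul ha hb,
    σ.bar_mul ha hb', signMap_apply 𝒜 (SetLike.mul_mem_graded hb' ha'),
    signMap_apply 𝒜 (SetLike.mul_mem_graded hb ha'), σ.bar_bar, Sum.inl.injEq, Sum.inr.injEq,
    reduceCtorEq, if_false, @eq_comm _ n j, @eq_comm _ l j, superSign_add,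
    mul_one]
  split_ifs <;> rcases superSign_eq (p * q) with h | h <;> rcases superSign_eq p with h' | h' <;>
    rcases superSign_eq q with h'' | h'' <;>
    simp only [h, h', h'', one_smul, neg_smul, superMatrix_single_neg, smul_neg, mul_one,
      mul_neg, neg_neg] <;> abel

theorem glLie_gMat_tMat_hom {p q : ZMod 2} (i j n l : Fin m) {a b : R} (ha : a ∈ 𝒜 p)
    (hb : b ∈ 𝒜 q) :
    (glLie 𝒜 m).bracket (gMat σ i j a) (tMat σ n l b) =
      (if j = n then gMat σ i l (a * b) else 0) -
        (if i = n then gMat σ j l (signMap 𝒜 (σ.bar a) * b) else 0) := by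
  rw [glLie_bracket (gMat_mem σ i j ha) (tMat_mem σ n l hb)]
  have hb' := σ.bar_mem hb
  have ha' := σ.bar_mem ha
  simp only [gMat, tMat, sub_mul, mul_sub, add_mul, single_mul_single_ite,
    signMap_apply 𝒜 ha', mul_smul_comm, smul_mul_assoc, map_zsmul, σ.bar_mul ha hb,
    σ.bar_mul ha' hb, signMap_apply 𝒜 (SetLike.mul_mem_graded hb' ha'),
    signMap_apply 𝒜 (SetLike.mul_mem_graded hb' ha), σ.bar_bar, Sum.inl.injEq, Sum.inr.injEq,
    reduceCtorEq, if_false, @eq_comm _ n j, @eq_comm _ n i, superSign_add,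
    one_mul]
  split_ifs <;> rcases superSign_eq (p * q) with h | h <;> rcases superSign_eq p with h' | h' <;>
    rcases superSign_eq q with h'' | h'' <;>
    simp only [h, h', h'', one_smul, neg_smul, superMatrix_single_neg, smul_neg, mul_one,
      mul_neg, neg_neg] <;> abel

/-- The four terms come from the two descriptions of each factor. The minus signs belong to those
using g_nl(b) = -g_ln(ρ(bar b)). -/
theorem glLie_fMat_gMat_hom {p q : ZMod 2} (i j n l : Fin m) {a b : R} (ha : a ∈ 𝒜 p)
    (hb : b ∈ 𝒜 q) :
    (glLie 𝒜 m).bracket (fMat σ i j a) (gMat σ n l b) =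
      (if j = n then tMat σ i l (a * b) else 0) +
        (if i = n then tMat σ j l (signMap 𝒜 (σ.bar a) * b) else 0) -
        (if j = l then tMat σ i n (a * signMap 𝒜 (σ.bar b)) else 0) -
        (if i = l then tMat σ j n (signMap 𝒜 (σ.bar a) * signMap 𝒜 (σ.bar b)) else 0) := by
  rw [glLie_bracket (fMat_mem σ i j ha) (gMat_mem σ n l hb)]
  have hb' := σ.bar_mem hb
  have ha' := σ.bar_mem ha
  simp only [fMat, gMat, tMat, sub_mul, mul_sub, add_mul, mul_add, single_mul_single_ite,
    signMap_apply 𝒜 ha', signMap_apply 𝒜 hb', mul_smul_comm, smul_mul_assoc, map_zsmul,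
    σ.bar_mul ha hb, σ.bar_mul ha' hb, σ.bar_mul ha hb', σ.bar_mul ha' hb', σ.bar_bar,
    Sum.inl.injEq, Sum.inr.injEq, @eq_comm _ n j, @eq_comm _ n i, @eq_comm _ l j, @eq_comm _ l i,
    superSign_add, superSign_one, one_mul, mul_one]
  split_ifs <;> rcases superSign_eq (p * q) with h | h <;> rcases superSign_eq p with h' | h' <;>
    rcases superSign_eq q with h'' | h'' <;>
    simp only [h, h', h'', one_smul, neg_smul, superMatrix_single_neg, smul_neg, mul_one,
      mul_neg, neg_neg] <;> abel

theorem glLie_fMat_fMat_hom {p q : ZMod 2} (i j n l : Fin m) {a b : R} (ha : a ∈ 𝒜 p)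
    (hb : b ∈ 𝒜 q) : (glLie 𝒜 m).bracket (fMat σ i j a) (fMat σ n l b) = 0 := by
  rw [glLie_bracket (fMat_mem σ i j ha) (fMat_mem σ n l hb)]
  simp [fMat, add_mul, mul_add]

theorem glLie_gMat_gMat_hom {p q : ZMod 2} (i j n l : Fin m) {a b : R} (ha : a ∈ 𝒜 p)
    (hb : b ∈ 𝒜 q) : (glLie 𝒜 m).bracket (gMat σ i j a) (gMat σ n l b) = 0 := by
  rw [glLie_bracket (gMat_mem σ i j ha) (gMat_mem σ n l hb)]
  simp [gMat, sub_mul, mul_sub]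

theorem glLie_tMat_fMat (i j n l : Fin m) (a b : R) :
    (glLie 𝒜 m).bracket (tMat σ i j a) (fMat σ n l b) =
      (if j = n then fMat σ i l (a * b) else 0) +
        (if j = l then fMat σ i n (a * signMap 𝒜 (σ.bar b)) else 0) := by
  induction a using homogeneous_induction 𝒜 with
  | add a a' ha ha' =>
    simp only [tMat_add, map_add, LinearMap.add_apply, ha, ha', add_mul, fMat_add]
    split_ifs <;> abel
  | hom p a ha =>
    induction b using homogeneous_induction 𝒜 with
    | add b b' hb hb' =>
      simp only [map_add, hb, hb', mul_add, fMat_add]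
      split_ifs <;> abel
    | hom q b hb => exact glLie_tMat_fMat_hom σ i j n l ha hb

theorem glLie_gMat_tMat (i j n l : Fin m) (a b : R) :
    (glLie 𝒜 m).bracket (gMat σ i j a) (tMat σ n l b) =
      (if j = n then gMat σ i l (a * b) else 0) -
        (if i = n then gMat σ j l (signMap 𝒜 (σ.bar a) * b) else 0) := by
  induction a using homogeneous_induction 𝒜 with
  | add a a' ha ha' =>
    simp only [gMat_add, map_add, LinearMap.add_apply, ha, ha', add_mul]
    split_ifs <;> abel
  | hom p a ha =>
    induction b using homogeneous_induction 𝒜 with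
    | add b b' hb hb' =>
      simp only [map_add, hb, hb', mul_add, gMat_add, tMat_add]
      split_ifs <;> abel
    | hom q b hb => exact glLie_gMat_tMat_hom σ i j n l ha hb

theorem glLie_fMat_gMat (i j n l : Fin m) (a b : R) :
    (glLie 𝒜 m).bracket (fMat σ i j a) (gMat σ n l b) =
      (if j = n then tMat σ i l (a * b) else 0) +
        (if i = n then tMat σ j l (signMap 𝒜 (σ.bar a) * b) else 0) -
        (if j = l then tMat σ i n (a * signMap 𝒜 (σ.bar b)) else 0) -
        (if i = l then tMat σ j n (signMap 𝒜 (σ.bar a) * signMap 𝒜 (σ.bar b)) else 0) := by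
  induction a using homogeneous_induction 𝒜 with
  | add a a' ha ha' =>
    simp only [fMat_add, map_add, LinearMap.add_apply, ha, ha', add_mul, tMat_add]
    split_ifs <;> abel
  | hom p a ha =>
    induction b using homogeneous_induction 𝒜 with
    | add b b' hb hb' =>
      simp only [gMat_add, map_add, hb, hb', mul_add, tMat_add]
      split_ifs <;> abel
    | hom q b hb => exact glLie_fMat_gMat_hom σ i j n l ha hb

/-- Diagonal `t`-matrices commute with the `t`-matrices that avoid their index. -/
theorem glLie_tMat_tMat_diag {i n l : Fin m} (hn : i ≠ n) (hl : i ≠ l) (a b : R) :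
    (glLie 𝒜 m).bracket (tMat σ i i a) (tMat σ n l b) = 0 := by
  induction a using homogeneous_induction 𝒜 with
  | add a a' ha ha' => simp only [tMat_add, map_add, LinearMap.add_apply, ha, ha', add_zero]
  | hom p a ha =>
    induction b using homogeneous_induction 𝒜 with
    | add b b' hb hb' => simp only [tMat_add, map_add, hb, hb', add_zero]
    | hom q b hb =>
      rw [glLie_tMat_tMat σ i i n l ha hb, if_neg hn, if_neg hl, smul_zero, sub_zero]

end Matrices

/-! ### The defining relations, extended from homogeneous elements to all of R. -/

section Steinberg

variable {k R : Type*} [CommRing k] [Ring R] [Algebra k R] {𝒜 : ZMod 2 → Submodule k R}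
  [GradedAlgebra 𝒜]

/-- A linear map on `R` given on homogeneous elements. -/
def gradedLift {W : Type*} [AddCommGroup W] [Module k W] (u : ∀ p, 𝒜 p → W)
    (hu : ∀ (p) (c d : k) (a b : 𝒜 p), u p (c • a + d • b) = c • u p a + d • u p b) :
    R →ₗ[k] W where
  toFun a := ∑ p : ZMod 2, u p (DirectSum.decompose 𝒜 a p)
  map_add' a b := by
    rw [← Finset.sum_add_distrib]
    refine Finset.sum_congr rfl fun p _ => ?_
    have := hu p 1 1 (DirectSum.decompose 𝒜 a p) (DirectSum.decompose 𝒜 b p)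
    simp only [one_smul] at this
    rw [← this, DirectSum.decompose_add, DirectSum.add_apply]
  map_smul' c a := by
    rw [RingHom.id_apply, Finset.smul_sum]
    refine Finset.sum_congr rfl fun p _ => ?_
    have := hu p c 0 (DirectSum.decompose 𝒜 a p) 0
    simp only [zero_smul, smul_zero, add_zero] at this
    rw [← this, DirectSum.decompose_smul, DirectSum.smul_apply]

theorem gradedLift_apply {W : Type*} [AddCommGroup W] [Module k W] (u : ∀ p, 𝒜 p → W)
    (hu : ∀ (p) (c d : k) (a b : 𝒜 p), u p (c • a + d • b) = c • u p a + d • u p b)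
    {p : ZMod 2} {a : R} (ha : a ∈ 𝒜 p) : gradedLift u hu a = u p ⟨a, ha⟩ := by
  have h0 : ∀ q, u q 0 = 0 := fun q => by simpa using hu q 0 0 0 0
  change ∑ q : ZMod 2, u q (DirectSum.decompose 𝒜 a q) = _
  rw [Finset.sum_eq_single p]
  · congr 1
    exact Subtype.ext (DirectSum.decompose_of_mem_same 𝒜 ha)
  · intro q _ hq
    convert h0 q
    exact Subtype.ext (DirectSum.decompose_of_mem_ne 𝒜 ha (Ne.symm hq))
  · simp

namespace Stp

open SteinbergGen

variable (σ : Superinvolution 𝒜) {m : ℕ}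

variable {σ} in
theorem mk_eq_zero {x : FreeNonUnitalNonAssocAlgebra k (SteinbergGen 𝒜 m)}
    (h : SteinbergRel σ m x) : (Submodule.Quotient.mk x : Stp σ m) = 0 :=
  (Submodule.Quotient.mk_eq_zero _).mpr ((presentedIdeal_isLieIdealFor k _ _).rel_mem x h)

variable {σ} in
theorem mk_eq_mk {x y : FreeNonUnitalNonAssocAlgebra k (SteinbergGen 𝒜 m)}
    (h : SteinbergRel σ m (x - y)) :
    (Submodule.Quotient.mk x : Stp σ m) = Submodule.Quotient.mk y :=
  sub_eq_zero.mp (mk_eq_zero h)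

/-- The elements `t_{ij}(a)`, `f_{ij}(a)` and `g_{ij}(a)` as linear functions of `a`. -/
noncomputable def tₗ {i j : Fin m} (hij : i ≠ j) : R →ₗ[k] Stp σ m :=
  gradedLift (fun p (a : 𝒜 p) => Submodule.Quotient.mk (T hij a))
    (fun _ c d a b => mk_eq_mk (.t_linear hij c d a b))

noncomputable def fₗ {i j : Fin m} (hij : i ≠ j) : R →ₗ[k] Stp σ m :=
  gradedLift (fun p (a : 𝒜 p) => Submodule.Quotient.mk (F hij a))
    (fun _ c d a b => mk_eq_mk (.f_linear hij c d a b))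

noncomputable def gₗ {i j : Fin m} (hij : i ≠ j) : R →ₗ[k] Stp σ m :=
  gradedLift (fun p (a : 𝒜 p) => Submodule.Quotient.mk (G hij a))
    (fun _ c d a b => mk_eq_mk (.g_linear hij c d a b))

variable {i j l n : Fin m}

theorem tₗ_apply (hij : i ≠ j) (a : R) : tₗ σ hij a = t σ hij a := rfl

theorem fₗ_apply (hij : i ≠ j) (a : R) : fₗ σ hij a = f σ hij a := rfl

theorem gₗ_apply (hij : i ≠ j) (a : R) : gₗ σ hij a = g σ hij a := rfl

theorem t_of_mem (hij : i ≠ j) {p : ZMod 2} {a : R} (ha : a ∈ 𝒜 p) :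
    t σ hij a = Submodule.Quotient.mk (T hij ⟨a, ha⟩) := by
  rw [← tₗ_apply]
  exact gradedLift_apply _ _ ha

theorem f_of_mem (hij : i ≠ j) {p : ZMod 2} {a : R} (ha : a ∈ 𝒜 p) :
    f σ hij a = Submodule.Quotient.mk (F hij ⟨a, ha⟩) := by
  rw [← fₗ_apply]
  exact gradedLift_apply _ _ ha

theorem g_of_mem (hij : i ≠ j) {p : ZMod 2} {a : R} (ha : a ∈ 𝒜 p) :
    g σ hij a = Submodule.Quotient.mk (G hij ⟨a, ha⟩) := by
  rw [← gₗ_apply]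
  exact gradedLift_apply _ _ ha

theorem t_add (hij : i ≠ j) (a b : R) : t σ hij (a + b) = t σ hij a + t σ hij b :=
  (tₗ σ hij).map_add a b

theorem f_add (hij : i ≠ j) (a b : R) : f σ hij (a + b) = f σ hij a + f σ hij b :=
  (fₗ σ hij).map_add a b

theorem g_add (hij : i ≠ j) (a b : R) : g σ hij (a + b) = g σ hij a + g σ hij b :=
  (gₗ σ hij).map_add a b

/-- This is the defining symmetry of the f's evaluated at ρ(a), where the sign cancels; in this form
it is linear in a. -/
theorem f_signMap_bar (hij : i ≠ j) (a : R) :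
    f σ hij (signMap 𝒜 (σ.bar a)) = f σ hij.symm a := by
  induction a using homogeneous_induction 𝒜 with
  | add a b ha hb => simp only [map_add, f_add, ha, hb]
  | hom p a ha =>
    have h := signMap_mem ha
    rw [signMap_bar, f_of_mem σ hij (σ.bar_mem h), f_of_mem σ hij.symm ha]
    refine (mk_eq_mk (.f_bar hij (⟨_, h⟩ : 𝒜 p))).trans ?_
    congr 2
    refine Subtype.ext ?_
    change superSign p • signMap 𝒜 a = a
    rw [← signMap_apply 𝒜 h, signMap_signMap]

theorem g_signMap_bar (hij : i ≠ j) (a : R) :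
    g σ hij (signMap 𝒜 (σ.bar a)) = -g σ hij.symm a := by
  induction a using homogeneous_induction 𝒜 with
  | add a b ha hb => simp only [map_add, g_add, ha, hb]; abel
  | hom p a ha =>
    have h := signMap_mem ha
    rw [signMap_bar, g_of_mem σ hij (σ.bar_mem h), g_of_mem σ hij.symm ha]
    have h0 := mk_eq_zero (SteinbergRel.g_bar (σ := σ) hij (⟨_, h⟩ : 𝒜 p))
    rw [Submodule.Quotient.mk_add] at h0
    refine (eq_neg_of_add_eq_zero_left h0).trans ?_
    congr 3
    refine Subtype.ext ?_
    change superSign p • signMap 𝒜 a = a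
    rw [← signMap_apply 𝒜 h, signMap_signMap]

variable [Invertible (2 : k)]

theorem t_mem (hij : i ≠ j) {p : ZMod 2} {a : R} (ha : a ∈ 𝒜 p) :
    t σ hij a ∈ (stpLie σ m).grade p := by
  rw [t_of_mem σ hij ha]
  exact ⟨_, of_mem_freeGrade (SteinbergGen.t i j hij p ⟨a, ha⟩), rfl⟩

theorem f_mem (hij : i ≠ j) {p : ZMod 2} {a : R} (ha : a ∈ 𝒜 p) :
    f σ hij a ∈ (stpLie σ m).grade (p + 1) := by
  rw [f_of_mem σ hij ha]
  exact ⟨_, of_mem_freeGrade (SteinbergGen.f i j hij p ⟨a, ha⟩), rfl⟩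

theorem g_mem (hij : i ≠ j) {p : ZMod 2} {a : R} (ha : a ∈ 𝒜 p) :
    g σ hij a ∈ (stpLie σ m).grade (p + 1) := by
  rw [g_of_mem σ hij ha]
  exact ⟨_, of_mem_freeGrade (SteinbergGen.g i j hij p ⟨a, ha⟩), rfl⟩

/-- Both sides are bilinear in (a, b), so a relation imposed only on homogeneous generators holds
for all a and b. -/
theorem bracket_eq_of_homogeneous {x y z : R →ₗ[k] Stp σ m}
    (h : ∀ p q, ∀ a ∈ 𝒜 p, ∀ b ∈ 𝒜 q, (stpLie σ m).bracket (x a) (y b) = z (a * b)) (a b : R) :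
    (stpLie σ m).bracket (x a) (y b) = z (a * b) :=
  LinearMap.congr_fun₂ (homogeneous_ext₂ 𝒜 (B := (stpLie σ m).bracket.compl₁₂ x y)
    (B' := (LinearMap.mul k R).compr₂ z) h) a b

theorem bracket_eq_zero_of_homogeneous {x y : R →ₗ[k] Stp σ m}
    (h : ∀ p q, ∀ a ∈ 𝒜 p, ∀ b ∈ 𝒜 q, (stpLie σ m).bracket (x a) (y b) = 0) (a b : R) :
    (stpLie σ m).bracket (x a) (y b) = 0 :=
  bracket_eq_of_homogeneous σ (z := 0) h a b

theorem bracket_t_t (hij : i ≠ j) (hjl : j ≠ l) (hil : i ≠ l) (a b : R) :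
    (stpLie σ m).bracket (t σ hij a) (t σ hjl b) = t σ hil (a * b) :=
  bracket_eq_of_homogeneous σ (x := tₗ σ hij) (y := tₗ σ hjl) (z := tₗ σ hil)
    (fun p q a ha b hb => by
      simp only [tₗ_apply, t_of_mem σ _ ha, t_of_mem σ _ hb,
        t_of_mem σ _ (SetLike.mul_mem_graded ha hb)]
      exact mk_eq_mk (.t_t hij hjl hil ⟨a, ha⟩ ⟨b, hb⟩)) a b

theorem bracket_t_f (hij : i ≠ j) (hjl : j ≠ l) (hil : i ≠ l) (a b : R) :
    (stpLie σ m).bracket (t σ hij a) (f σ hjl b) = f σ hil (a * b) :=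
  bracket_eq_of_homogeneous σ (x := tₗ σ hij) (y := fₗ σ hjl) (z := fₗ σ hil)
    (fun p q a ha b hb => by
      simp only [tₗ_apply, fₗ_apply, t_of_mem σ _ ha, f_of_mem σ _ hb,
        f_of_mem σ _ (SetLike.mul_mem_graded ha hb)]
      exact mk_eq_mk (.t_f hij hjl hil ⟨a, ha⟩ ⟨b, hb⟩)) a b

theorem bracket_g_t (hij : i ≠ j) (hjl : j ≠ l) (hil : i ≠ l) (a b : R) :
    (stpLie σ m).bracket (g σ hij a) (t σ hjl b) = g σ hil (a * b) :=
  bracket_eq_of_homogeneous σ (x := gₗ σ hij) (y := tₗ σ hjl) (z := gₗ σ hil)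
    (fun p q a ha b hb => by
      simp only [tₗ_apply, gₗ_apply, g_of_mem σ _ ha, t_of_mem σ _ hb,
        g_of_mem σ _ (SetLike.mul_mem_graded ha hb)]
      exact mk_eq_mk (.g_t hij hjl hil ⟨a, ha⟩ ⟨b, hb⟩)) a b

theorem bracket_f_g (hij : i ≠ j) (hjl : j ≠ l) (hil : i ≠ l) (a b : R) :
    (stpLie σ m).bracket (f σ hij a) (g σ hjl b) = t σ hil (a * b) :=
  bracket_eq_of_homogeneous σ (x := fₗ σ hij) (y := gₗ σ hjl) (z := tₗ σ hil)
    (fun p q a ha b hb => by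
      simp only [tₗ_apply, fₗ_apply, gₗ_apply, f_of_mem σ _ ha, g_of_mem σ _ hb,
        t_of_mem σ _ (SetLike.mul_mem_graded ha hb)]
      exact mk_eq_mk (.f_g hij hjl hil ⟨a, ha⟩ ⟨b, hb⟩)) a b

theorem bracket_t_t_zero (hij : i ≠ j) (hjn : j ≠ n) (hnl : n ≠ l) (hli : l ≠ i) (a b : R) :
    (stpLie σ m).bracket (t σ hij a) (t σ hnl b) = 0 :=
  bracket_eq_zero_of_homogeneous σ (x := tₗ σ hij) (y := tₗ σ hnl)
    (fun p q a ha b hb => by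
      simp only [tₗ_apply, t_of_mem σ _ ha, t_of_mem σ _ hb]
      exact mk_eq_zero (.t_t_zero hij hjn hnl hli ⟨a, ha⟩ ⟨b, hb⟩)) a b

theorem bracket_t_f_zero (hij : i ≠ j) (hjn : j ≠ n) (hnl : n ≠ l) (hlj : l ≠ j) (a b : R) :
    (stpLie σ m).bracket (t σ hij a) (f σ hnl b) = 0 :=
  bracket_eq_zero_of_homogeneous σ (x := tₗ σ hij) (y := fₗ σ hnl)
    (fun p q a ha b hb => by
      simp only [tₗ_apply, fₗ_apply, t_of_mem σ _ ha, f_of_mem σ _ hb]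
      exact mk_eq_zero (.t_f_zero hij hjn hnl hlj ⟨a, ha⟩ ⟨b, hb⟩)) a b

theorem bracket_g_t_zero (hij : i ≠ j) (hnl : n ≠ l) (hnj : n ≠ j) (hin : i ≠ n) (a b : R) :
    (stpLie σ m).bracket (g σ hij a) (t σ hnl b) = 0 :=
  bracket_eq_zero_of_homogeneous σ (x := gₗ σ hij) (y := tₗ σ hnl)
    (fun p q a ha b hb => by
      simp only [tₗ_apply, gₗ_apply, g_of_mem σ _ ha, t_of_mem σ _ hb]
      exact mk_eq_zero (.g_t_zero hij hnl hnj hin ⟨a, ha⟩ ⟨b, hb⟩)) a b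

theorem bracket_f_f (hij : i ≠ j) (hnl : n ≠ l) (a b : R) :
    (stpLie σ m).bracket (f σ hij a) (f σ hnl b) = 0 :=
  bracket_eq_zero_of_homogeneous σ (x := fₗ σ hij) (y := fₗ σ hnl)
    (fun p q a ha b hb => by
      simp only [fₗ_apply, f_of_mem σ _ ha, f_of_mem σ _ hb]
      exact mk_eq_zero (.f_f hij hnl ⟨a, ha⟩ ⟨b, hb⟩)) a b

theorem bracket_g_g (hij : i ≠ j) (hnl : n ≠ l) (a b : R) :
    (stpLie σ m).bracket (g σ hij a) (g σ hnl b) = 0 :=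
  bracket_eq_zero_of_homogeneous σ (x := gₗ σ hij) (y := gₗ σ hnl)
    (fun p q a ha b hb => by
      simp only [gₗ_apply, g_of_mem σ _ ha, g_of_mem σ _ hb]
      exact mk_eq_zero (.g_g hij hnl ⟨a, ha⟩ ⟨b, hb⟩)) a b

theorem bracket_f_g_zero (hij : i ≠ j) (hin : i ≠ n) (hil : i ≠ l) (hjn : j ≠ n) (hjl : j ≠ l)
    (hnl : n ≠ l) (a b : R) :
    (stpLie σ m).bracket (f σ hij a) (g σ hnl b) = 0 :=
  bracket_eq_zero_of_homogeneous σ (x := fₗ σ hij) (y := gₗ σ hnl)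
    (fun p q a ha b hb => by
      simp only [fₗ_apply, gₗ_apply, f_of_mem σ _ ha, g_of_mem σ _ hb]
      exact mk_eq_zero (.f_g_zero hij hin hil hjn hjl hnl ⟨a, ha⟩ ⟨b, hb⟩)) a b

/-! #### The elements `f_i(a)` and `g_i(a)` -/

theorem fDiag_add (hij : i ≠ j) (a b : R) :
    fDiag σ hij (a + b) = fDiag σ hij a + fDiag σ hij b := by
  simp only [fDiag, f_add, map_add]

theorem gDiag_add (hij : i ≠ j) (a b : R) :
    gDiag σ hij (a + b) = gDiag σ hij a + gDiag σ hij b := by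
  simp only [gDiag, g_add, map_add, LinearMap.add_apply]

/-- `f_i(a)` and `g_i(a)` as linear functions of `a`. -/
noncomputable def fDiagₗ (hij : i ≠ j) : R →ₗ[k] Stp σ m :=
  (stpLie σ m).bracket (t σ hij 1) ∘ₗ fₗ σ hij.symm

noncomputable def gDiagₗ (hij : i ≠ j) : R →ₗ[k] Stp σ m :=
  (stpLie σ m).bracket.flip (t σ hij.symm 1) ∘ₗ gₗ σ hij

theorem fDiagₗ_apply (hij : i ≠ j) (a : R) : fDiagₗ σ hij a = fDiag σ hij a := rfl

theorem gDiagₗ_apply (hij : i ≠ j) (a : R) : gDiagₗ σ hij a = gDiag σ hij a := rfl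

/-- Write f_ji(cb) = [t_jl(c), f_li(b)] and apply Jacobi; the second term contains [t_ij(a),
f_li(b)] = 0. The factor c moves across while the auxiliary index changes from j to l, which
explains why f_i depends neither on the auxiliary index nor on how the product is split. -/
theorem bracket_t_f_shift (hij : i ≠ j) (hjl : j ≠ l) (hil : i ≠ l) {p q r : ZMod 2} {a b c : R}
    (ha : a ∈ 𝒜 p) (hb : b ∈ 𝒜 q) (hc : c ∈ 𝒜 r) :
    (stpLie σ m).bracket (t σ hij a) (f σ hij.symm (c * b)) =
      (stpLie σ m).bracket (t σ hil (a * c)) (f σ hil.symm b) := by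
  rw [← bracket_t_f σ hjl hil.symm hij.symm,
    (stpLie σ m).jacobi (t_mem σ hij ha) (t_mem σ hjl hc) (f_mem σ hil.symm hb),
    bracket_t_t σ hij hjl hil, bracket_t_f_zero σ hij hjl hil.symm hij, map_zero, smul_zero,
    add_zero]

theorem bracket_g_t_shift (hij : i ≠ j) (hjl : j ≠ l) (hil : i ≠ l) {p q r : ZMod 2} {a b c : R}
    (ha : a ∈ 𝒜 p) (hb : b ∈ 𝒜 q) (hc : c ∈ 𝒜 r) :
    (stpLie σ m).bracket (g σ hij (a * c)) (t σ hij.symm b) =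
      (stpLie σ m).bracket (g σ hil a) (t σ hil.symm (c * b)) := by
  rw [← bracket_t_t σ hjl.symm hij.symm hil.symm,
    (stpLie σ m).jacobi (g_mem σ hil ha) (t_mem σ hjl.symm hc) (t_mem σ hij.symm hb),
    bracket_g_t σ hil hjl.symm hij, bracket_g_t_zero σ hil hij.symm hjl hij, map_zero, smul_zero,
    add_zero]

omit [Invertible (2 : k)] in
theorem exists_third_index (hm : 3 ≤ m) (i j : Fin m) : ∃ l, i ≠ l ∧ j ≠ l := by
  have : ({i, j} : Finset (Fin m)).card < (Finset.univ : Finset (Fin m)).card := by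
    rw [Finset.card_univ, Fintype.card_fin]
    exact Finset.card_le_two.trans_lt hm
  obtain ⟨l, -, hl⟩ := Finset.exists_mem_notMem_of_card_lt_card this
  simp only [Finset.mem_insert, Finset.mem_singleton, not_or] at hl
  exact ⟨l, Ne.symm hl.1, Ne.symm hl.2⟩

/-- `[t_{ij}(a), f_{ji}(b)] = f_i(ab)`, whatever `j` is. -/
theorem bracket_t_f_diag (hm : 3 ≤ m) (hij : i ≠ j) (hil : i ≠ l) (a b : R) :
    (stpLie σ m).bracket (t σ hij a) (f σ hij.symm b) = fDiag σ hil (a * b) := by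
  refine bracket_eq_of_homogeneous σ (x := tₗ σ hij) (y := fₗ σ hij.symm) (z := fDiagₗ σ hil)
    (fun p q a ha b hb => ?_) a b
  have h1 : (1 : R) ∈ 𝒜 0 := SetLike.one_mem_graded 𝒜
  have key : ∀ {j l : Fin m} (hij : i ≠ j) (hil : i ≠ l), j ≠ l →
      (stpLie σ m).bracket (t σ hij a) (f σ hij.symm b) = fDiag σ hil (a * b) := by
    intro j l hij hil hjl
    have := bracket_t_f_shift σ hil hjl.symm hij h1 hb ha
    rw [one_mul] at this
    exact this.symm
  -- The shift always changes the auxiliary index; returning to the same index takes two shifts, by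
  -- way of n.
  by_cases hjl : j = l
  · subst hjl
    obtain ⟨n, hn, hn'⟩ := exists_third_index hm i j
    have := bracket_t_f_shift σ hij hn' hn ha hb h1
    rw [one_mul, mul_one] at this
    exact this.trans (key hn hij hn'.symm)
  · exact key hij hil hjl

/-- `[g_{ij}(a), t_{ji}(b)] = g_i(ab)`, whatever `j` is. -/
theorem bracket_g_t_diag (hm : 3 ≤ m) (hij : i ≠ j) (hil : i ≠ l) (a b : R) :
    (stpLie σ m).bracket (g σ hij a) (t σ hij.symm b) = gDiag σ hil (a * b) := by
  refine bracket_eq_of_homogeneous σ (x := gₗ σ hij) (y := tₗ σ hij.symm) (z := gDiagₗ σ hil)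
    (fun p q a ha b hb => ?_) a b
  have h1 : (1 : R) ∈ 𝒜 0 := SetLike.one_mem_graded 𝒜
  have key : ∀ {j l : Fin m} (hij : i ≠ j) (hil : i ≠ l), j ≠ l →
      (stpLie σ m).bracket (g σ hij a) (t σ hij.symm b) = gDiag σ hil (a * b) := by
    intro j l hij hil hjl
    have := bracket_g_t_shift σ hil hjl.symm hij ha h1 hb
    rw [mul_one] at this
    exact this.symm
  by_cases hjl : j = l
  · subst hjl
    obtain ⟨n, hn, hn'⟩ := exists_third_index hm i j
    have := bracket_g_t_shift σ hij hn' hn ha hb h1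
    rw [one_mul, mul_one] at this
    exact this.trans (key hn hij hn'.symm)
  · exact key hij hil hjl

theorem fDiag_eq (hm : 3 ≤ m) (hij : i ≠ j) (hil : i ≠ l) (a : R) :
    fDiag σ hij a = fDiag σ hil a := by
  rw [fDiag, bracket_t_f_diag σ hm hij hil, one_mul]

theorem gDiag_eq (hm : 3 ≤ m) (hij : i ≠ j) (hil : i ≠ l) (a : R) :
    gDiag σ hij a = gDiag σ hil a := by
  rw [gDiag, bracket_g_t_diag σ hm hij hil, mul_one]

/-- The left side is [t_ij(1), f_ij(a)]. Writing f_ij(a) = [t_il(1), f_lj(a)] and commuting t_ij(1)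
past t_il(1) leads to [t_il(1), f_li(a)] = f_i(a). -/
theorem fDiag_signMap_bar (hm : 3 ≤ m) (hij : i ≠ j) (a : R) :
    fDiag σ hij (signMap 𝒜 (σ.bar a)) = fDiag σ hij a := by
  induction a using homogeneous_induction 𝒜 with
  | add a b ha hb => simp only [map_add, fDiag_add, ha, hb]
  | hom p a ha =>
    have h1 : (1 : R) ∈ 𝒜 0 := SetLike.one_mem_graded 𝒜
    have s0 : superSign (0 * 0) = 1 := by decide
    obtain ⟨l, hil, hjl⟩ := exists_third_index hm i j
    conv_lhs => rw [fDiag, f_signMap_bar]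
    conv_lhs => rw [← one_mul a, ← bracket_t_f σ hil hjl.symm hij,
      (stpLie σ m).jacobi (t_mem σ hij h1) (t_mem σ hil h1) (f_mem σ hjl.symm ha),
      bracket_t_t_zero σ hij hij.symm hil hil.symm, LinearMap.map_zero₂, zero_add, s0, one_smul,
      ← f_signMap_bar σ hjl, bracket_t_f σ hij hjl hil, one_mul, f_signMap_bar]
    exact fDiag_eq σ hm hil hij a

theorem gDiag_signMap_bar (hm : 3 ≤ m) (hij : i ≠ j) (a : R) :
    gDiag σ hij (signMap 𝒜 (σ.bar a)) = -gDiag σ hij a := by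
  induction a using homogeneous_induction 𝒜 with
  | add a b ha hb => simp only [map_add, gDiag_add, ha, hb]; abel
  | hom p a ha =>
    have h1 : (1 : R) ∈ 𝒜 0 := SetLike.one_mem_graded 𝒜
    obtain ⟨l, hil, hjl⟩ := exists_third_index hm i j
    have e1 : (stpLie σ m).bracket (g σ hjl a) (t σ hij.symm 1) = g σ hil a := by
      have h := g_signMap_bar σ hjl.symm a
      rw [eq_neg_iff_add_eq_zero, add_comm, ← eq_neg_iff_add_eq_zero] at h
      rw [h, map_neg, LinearMap.neg_apply, bracket_g_t σ hjl.symm hij.symm hil.symm, mul_one,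
        g_signMap_bar, neg_neg]
    -- Since t_li(1) and t_ji(1) commute, the Jacobi identity for g_jl(a) and these two compares
    -- [g_ji(a), t_ji(1)] with [g_il(a), t_li(1)] = g_i(a).
    have e2 := (stpLie σ m).jacobi (g_mem σ hjl ha) (t_mem σ hil.symm h1) (t_mem σ hij.symm h1)
    have s0 : superSign ((p + 1) * 0) = 1 := by simp [superSign]
    have s1 : superSign (0 * (p + 1)) = 1 := by simp [superSign]
    rw [bracket_t_t_zero σ hil.symm hij hij.symm hil, map_zero, e1,
      bracket_g_t σ hjl hil.symm hij.symm, mul_one,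
      (stpLie σ m).antisymm (t_mem σ hil.symm h1) (g_mem σ hil ha), s0, s1, one_smul, one_smul,
      eq_comm, ← sub_eq_add_neg, sub_eq_zero] at e2
    rw [gDiag, g_signMap_bar, map_neg, LinearMap.neg_apply, e2]
    exact congrArg _ (gDiag_eq σ hm hil hij a)

end Stp

end Steinberg

/-! ### The root spaces of the Steinberg Lie superalgebra. -/

section Steinberg

variable {k R : Type*} [CommRing k] [Ring R] [Algebra k R] {𝒜 : ZMod 2 → Submodule k R}
  [GradedAlgebra 𝒜] [Invertible (2 : k)]

namespace Stp

open LieSuperalgebra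

variable (σ : Superinvolution 𝒜) {m : ℕ}

/-- The span of the `t_{ij}(a)`. -/
noncomputable def tSub (i j : Fin m) : Submodule k (Stp σ m) :=
  if h : i ≠ j then LinearMap.range (tₗ σ h) else ⊥

/-- The span of the `f_{ij}(a)` if `i ≠ j`, of the `f_i(a)` if `i = j`. -/
noncomputable def fSub (i j : Fin m) : Submodule k (Stp σ m) :=
  if h : i ≠ j then LinearMap.range (fₗ σ h)
  else Submodule.span k {x | ∃ (l : Fin m) (h : i ≠ l) (a : R), x = fDiag σ h a}

/-- The span of the `g_{ij}(a)` if `i ≠ j`, of the `g_i(a)` if `i = j`. -/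
noncomputable def gSub (i j : Fin m) : Submodule k (Stp σ m) :=
  if h : i ≠ j then LinearMap.range (gₗ σ h)
  else Submodule.span k {x | ∃ (l : Fin m) (h : i ≠ l) (a : R), x = gDiag σ h a}

/-- The root space of the pair `(u, v)`. -/
noncomputable def rootSpace : Fin m ⊕ Fin m → Fin m ⊕ Fin m → Submodule k (Stp σ m)
  | .inl i, .inl j => tSub σ i j
  | .inr i, .inr j => tSub σ j i
  | .inl i, .inr j => fSub σ i j
  | .inr i, .inl j => gSub σ i j

variable {i j l n : Fin m}

omit [Invertible (2 : k)] in
theorem tSub_of_ne (h : i ≠ j) : tSub σ i j = LinearMap.range (tₗ σ h) := dif_pos h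

theorem fSub_of_ne (h : i ≠ j) : fSub σ i j = LinearMap.range (fₗ σ h) := dif_pos h

theorem gSub_of_ne (h : i ≠ j) : gSub σ i j = LinearMap.range (gₗ σ h) := dif_pos h

theorem fSub_self : fSub σ i i =
    Submodule.span k {x | ∃ (l : Fin m) (h : i ≠ l) (a : R), x = fDiag σ h a} :=
  dif_neg (by simp)

theorem gSub_self : gSub σ i i =
    Submodule.span k {x | ∃ (l : Fin m) (h : i ≠ l) (a : R), x = gDiag σ h a} :=
  dif_neg (by simp)

theorem fSub_comm (i j : Fin m) : fSub σ i j = fSub σ j i := by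
  have key : ∀ {i j : Fin m} (h : i ≠ j),
      LinearMap.range (fₗ σ h) ≤ LinearMap.range (fₗ σ h.symm) := by
    rintro i j h _ ⟨a, rfl⟩
    exact ⟨_, f_signMap_bar σ h.symm a⟩
  by_cases h : i = j
  · rw [h]
  · rw [fSub_of_ne σ h, fSub_of_ne σ (Ne.symm h)]
    exact le_antisymm (key h) (key (Ne.symm h))

theorem gSub_comm (i j : Fin m) : gSub σ i j = gSub σ j i := by
  have key : ∀ {i j : Fin m} (h : i ≠ j),
      LinearMap.range (gₗ σ h) ≤ LinearMap.range (gₗ σ h.symm) := by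
    rintro i j h _ ⟨a, rfl⟩
    exact ⟨-signMap 𝒜 (σ.bar a), by rw [map_neg, gₗ_apply, gₗ_apply, g_signMap_bar, neg_neg]⟩
  by_cases h : i = j
  · rw [h]
  · rw [gSub_of_ne σ h, gSub_of_ne σ (Ne.symm h)]
    exact le_antisymm (key h) (key (Ne.symm h))

/-- The hypotheses `hx` and `hN` say that N is spanned by the values of the linear maps `x s`. The
form covers both a single range and the diagonal spaces, which have one map for each auxiliary
index. -/
theorem isGraded_of_homogeneous {N : Submodule k (Stp σ m)} {ι : Type*} (x : ι → R →ₗ[k] Stp σ m)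
    (hx : ∀ s a, x s a ∈ N) (hN : ∀ X : Submodule k (Stp σ m), (∀ s a, x s a ∈ X) → N ≤ X)
    (h : ∀ s p, ∀ a ∈ 𝒜 p, ∃ q, x s a ∈ (stpLie σ m).grade q) : (stpLie σ m).IsGraded N := by
  refine ⟨hN _ fun s a => ?_⟩
  induction a using homogeneous_induction 𝒜 with
  | add a b ha hb => rw [map_add]; exact add_mem ha hb
  | hom p a ha =>
    obtain ⟨q, hq⟩ := h s p a ha
    exact (stpLie σ m).mem_graded (hx s a) hq

theorem isGraded_range {x : R →ₗ[k] Stp σ m}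
    (h : ∀ p, ∀ a ∈ 𝒜 p, ∃ q, x a ∈ (stpLie σ m).grade q) :
    (stpLie σ m).IsGraded (LinearMap.range x) :=
  isGraded_of_homogeneous σ (fun _ : Unit => x) (fun _ a => ⟨a, rfl⟩)
    (fun X hX => by rintro _ ⟨a, rfl⟩; exact hX () a) (fun _ => h)

theorem fDiag_mem (hij : i ≠ j) {p : ZMod 2} {a : R} (ha : a ∈ 𝒜 p) :
    fDiag σ hij a ∈ (stpLie σ m).grade (0 + (p + 1)) :=
  (stpLie σ m).bracket_mem (t_mem σ hij (SetLike.one_mem_graded 𝒜)) (f_mem σ hij.symm ha)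

theorem gDiag_mem (hij : i ≠ j) {p : ZMod 2} {a : R} (ha : a ∈ 𝒜 p) :
    gDiag σ hij a ∈ (stpLie σ m).grade (p + 1 + 0) :=
  (stpLie σ m).bracket_mem (g_mem σ hij ha) (t_mem σ hij.symm (SetLike.one_mem_graded 𝒜))

instance isGraded_tSub : (stpLie σ m).IsGraded (tSub σ i j) := by
  unfold tSub
  split_ifs with h
  · exact isGraded_range σ fun p a ha => ⟨p, t_mem σ h ha⟩
  · infer_instance

instance isGraded_fSub : (stpLie σ m).IsGraded (fSub σ i j) := by
  unfold fSub
  split_ifs with h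
  · exact isGraded_range σ fun p a ha => ⟨_, f_mem σ h ha⟩
  · exact isGraded_of_homogeneous σ (fun s : {l // i ≠ l} => fDiagₗ σ s.2)
      (fun s a => Submodule.subset_span ⟨s.1, s.2, a, rfl⟩)
      (fun X hX => Submodule.span_le.mpr (by rintro _ ⟨l, h, a, rfl⟩; exact hX ⟨l, h⟩ a))
      (fun s p a ha => ⟨_, fDiag_mem σ s.2 ha⟩)

instance isGraded_gSub : (stpLie σ m).IsGraded (gSub σ i j) := by
  unfold gSub
  split_ifs with h
  · exact isGraded_range σ fun p a ha => ⟨_, g_mem σ h ha⟩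
  · exact isGraded_of_homogeneous σ (fun s : {l // i ≠ l} => gDiagₗ σ s.2)
      (fun s a => Submodule.subset_span ⟨s.1, s.2, a, rfl⟩)
      (fun X hX => Submodule.span_le.mpr (by rintro _ ⟨l, h, a, rfl⟩; exact hX ⟨l, h⟩ a))
      (fun s p a ha => ⟨_, gDiag_mem σ s.2 ha⟩)

/-- Equality, and not mere inclusion, holds because R is unital: z(a) = [x(a), y(1)]. -/
theorem brSub_range_eq {x y z : R →ₗ[k] Stp σ m}
    (h : ∀ a b, (stpLie σ m).bracket (x a) (y b) = z (a * b)) :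
    (stpLie σ m).brSub (LinearMap.range x) (LinearMap.range y) = LinearMap.range z := by
  refine le_antisymm (brSub_le.mpr ?_) ?_
  · rintro _ ⟨a, rfl⟩ _ ⟨b, rfl⟩
    exact ⟨_, (h a b).symm⟩
  · rintro _ ⟨a, rfl⟩
    have := h a 1
    rw [mul_one] at this
    rw [← this]
    exact brSub_mem ⟨a, rfl⟩ ⟨1, rfl⟩

theorem brSub_range_eq_bot {x y : R →ₗ[k] Stp σ m}
    (h : ∀ a b, (stpLie σ m).bracket (x a) (y b) = 0) :
    (stpLie σ m).brSub (LinearMap.range x) (LinearMap.range y) = ⊥ := by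
  rw [eq_bot_iff, brSub_le]
  rintro _ ⟨a, rfl⟩ _ ⟨b, rfl⟩
  exact h a b

theorem brSub_tSub_tSub (hij : i ≠ j) (hjl : j ≠ l) (hil : i ≠ l) :
    (stpLie σ m).brSub (tSub σ i j) (tSub σ j l) = tSub σ i l := by
  rw [tSub_of_ne σ hij, tSub_of_ne σ hjl, tSub_of_ne σ hil]
  exact brSub_range_eq σ (bracket_t_t σ hij hjl hil)

theorem brSub_tSub_fSub (hij : i ≠ j) (hjl : j ≠ l) (hil : i ≠ l) :
    (stpLie σ m).brSub (tSub σ i j) (fSub σ j l) = fSub σ i l := by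
  rw [tSub_of_ne σ hij, fSub_of_ne σ hjl, fSub_of_ne σ hil]
  exact brSub_range_eq σ (bracket_t_f σ hij hjl hil)

theorem brSub_gSub_tSub (hij : i ≠ j) (hjl : j ≠ l) (hil : i ≠ l) :
    (stpLie σ m).brSub (gSub σ i j) (tSub σ j l) = gSub σ i l := by
  rw [gSub_of_ne σ hij, tSub_of_ne σ hjl, gSub_of_ne σ hil]
  exact brSub_range_eq σ (bracket_g_t σ hij hjl hil)

theorem brSub_fSub_gSub (hij : i ≠ j) (hjl : j ≠ l) (hil : i ≠ l) :
    (stpLie σ m).brSub (fSub σ i j) (gSub σ j l) = tSub σ i l := by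
  rw [fSub_of_ne σ hij, gSub_of_ne σ hjl, tSub_of_ne σ hil]
  exact brSub_range_eq σ (bracket_f_g σ hij hjl hil)

theorem brSub_tSub_tSub_bot (hij : i ≠ j) (hnl : n ≠ l) (hjn : j ≠ n) (hil : i ≠ l) :
    (stpLie σ m).brSub (tSub σ i j) (tSub σ n l) = ⊥ := by
  rw [tSub_of_ne σ hij, tSub_of_ne σ hnl]
  exact brSub_range_eq_bot σ (bracket_t_t_zero σ hij hjn hnl hil.symm)

theorem brSub_tSub_fSub_bot (hij : i ≠ j) (hnl : n ≠ l) (hjn : j ≠ n) (hjl : j ≠ l) :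
    (stpLie σ m).brSub (tSub σ i j) (fSub σ n l) = ⊥ := by
  rw [tSub_of_ne σ hij, fSub_of_ne σ hnl]
  exact brSub_range_eq_bot σ (bracket_t_f_zero σ hij hjn hnl hjl.symm)

theorem brSub_gSub_tSub_bot (hij : i ≠ j) (hnl : n ≠ l) (hjn : j ≠ n) (hin : i ≠ n) :
    (stpLie σ m).brSub (gSub σ i j) (tSub σ n l) = ⊥ := by
  rw [gSub_of_ne σ hij, tSub_of_ne σ hnl]
  exact brSub_range_eq_bot σ (bracket_g_t_zero σ hij hnl hjn.symm hin)

theorem brSub_fSub_gSub_bot (hij : i ≠ j) (hnl : n ≠ l) (hin : i ≠ n) (hil : i ≠ l) (hjn : j ≠ n)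
    (hjl : j ≠ l) : (stpLie σ m).brSub (fSub σ i j) (gSub σ n l) = ⊥ := by
  rw [fSub_of_ne σ hij, gSub_of_ne σ hnl]
  exact brSub_range_eq_bot σ (bracket_f_g_zero σ hij hin hil hjn hjl hnl)

theorem brSub_fSub_fSub_bot (hij : i ≠ j) (hnl : n ≠ l) :
    (stpLie σ m).brSub (fSub σ i j) (fSub σ n l) = ⊥ := by
  rw [fSub_of_ne σ hij, fSub_of_ne σ hnl]
  exact brSub_range_eq_bot σ (bracket_f_f σ hij hnl)

theorem brSub_gSub_gSub_bot (hij : i ≠ j) (hnl : n ≠ l) :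
    (stpLie σ m).brSub (gSub σ i j) (gSub σ n l) = ⊥ := by
  rw [gSub_of_ne σ hij, gSub_of_ne σ hnl]
  exact brSub_range_eq_bot σ (bracket_g_g σ hij hnl)

theorem brSub_tSub_fSub_diag (hm : 3 ≤ m) (hij : i ≠ j) :
    (stpLie σ m).brSub (tSub σ i j) (fSub σ j i) ≤ fSub σ i i := by
  rw [tSub_of_ne σ hij, fSub_of_ne σ hij.symm, fSub_self, brSub_le]
  rintro _ ⟨a, rfl⟩ _ ⟨b, rfl⟩
  exact Submodule.subset_span ⟨j, hij, _, bracket_t_f_diag σ hm hij hij a b⟩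

theorem brSub_gSub_tSub_diag (hm : 3 ≤ m) (hij : i ≠ j) :
    (stpLie σ m).brSub (gSub σ i j) (tSub σ j i) ≤ gSub σ i i := by
  rw [tSub_of_ne σ hij.symm, gSub_of_ne σ hij, gSub_self, brSub_le]
  rintro _ ⟨a, rfl⟩ _ ⟨b, rfl⟩
  exact Submodule.subset_span ⟨j, hij, _, bracket_g_t_diag σ hm hij hij a b⟩

/-- The inequalities say that the three underlying indices in `Fin m` are distinct. Each of the
eight distributions over the two copies is then one of the four product relations, possibly
reflected. -/
theorem brSub_rootSpace_eq (u v w : Fin m ⊕ Fin m) (huv : u ≠ v) (huv' : u ≠ v.swap) (hvw : v ≠ w)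
    (hvw' : v ≠ w.swap) (huw : u ≠ w) (huw' : u ≠ w.swap) :
    (stpLie σ m).brSub (rootSpace σ u v) (rootSpace σ v w) = rootSpace σ u w := by
  revert u v w
  rintro (i | i) (j | j) (l | l) h1 h2 h3 h4 h5 h6 <;>
    simp only [Sum.swap_inl, Sum.swap_inr, ne_eq, Sum.inl.injEq, Sum.inr.injEq, reduceCtorEq,
      not_false_eq_true] at h1 h2 h3 h4 h5 h6
  · exact brSub_tSub_tSub σ h1 h3 h5
  · exact brSub_tSub_fSub σ h1 h4 h6
  · exact brSub_fSub_gSub σ h2 h4 h5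
  · simp only [rootSpace]
    rw [brSub_comm, fSub_comm σ i, fSub_comm σ i]
    exact brSub_tSub_fSub σ (Ne.symm h3) (Ne.symm h2) (Ne.symm h6)
  · exact brSub_gSub_tSub σ h2 h3 h6
  · simp only [rootSpace]
    rw [brSub_comm, gSub_comm σ i, fSub_comm σ j]
    exact brSub_fSub_gSub σ (Ne.symm h4) (Ne.symm h2) (Ne.symm h5)
  · simp only [rootSpace]
    rw [brSub_comm, gSub_comm σ j, gSub_comm σ i]
    exact brSub_gSub_tSub σ (Ne.symm h4) (Ne.symm h1) (Ne.symm h6)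
  · simp only [rootSpace]
    rw [brSub_comm]
    exact brSub_tSub_tSub σ (Ne.symm h3) (Ne.symm h1) (Ne.symm h5)

theorem brSub_rootSpace_eq_bot (u v w x : Fin m ⊕ Fin m) (huv : u ≠ v) (huv' : u ≠ v.swap)
    (hwx : w ≠ x) (hwx' : w ≠ x.swap) (hvw : v ≠ w) (hux : u ≠ x) (hvx : v ≠ x.swap)
    (huw : u ≠ w.swap) : (stpLie σ m).brSub (rootSpace σ u v) (rootSpace σ w x) = ⊥ := by
  revert u v w x
  rintro (i | i) (j | j) (n | n) (l | l) h1 h2 h3 h4 h5 h6 h7 h8 <;>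
    simp only [Sum.swap_inl, Sum.swap_inr, ne_eq, Sum.inl.injEq, Sum.inr.injEq, reduceCtorEq,
      not_false_eq_true] at h1 h2 h3 h4 h5 h6 h7 h8 <;>
    simp only [rootSpace]
  · exact brSub_tSub_tSub_bot σ h1 h3 h5 h6
  · exact brSub_tSub_fSub_bot σ h1 h4 h5 h7
  · rw [brSub_comm]
    exact brSub_gSub_tSub_bot σ h4 h1 (Ne.symm h6) (Ne.symm h8)
  · exact brSub_tSub_tSub_bot σ h1 (Ne.symm h3) h7 h8
  · rw [brSub_comm]
    exact brSub_tSub_fSub_bot σ h3 h2 (Ne.symm h6) (Ne.symm h7)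
  · exact brSub_fSub_fSub_bot σ h2 h4
  · exact brSub_fSub_gSub_bot σ h2 h4 h8 h6 h5 h7
  · rw [brSub_comm]
    exact brSub_tSub_fSub_bot σ (Ne.symm h3) h2 (Ne.symm h8) (Ne.symm h5)
  · exact brSub_gSub_tSub_bot σ h2 h3 h5 h8
  · rw [brSub_comm]
    exact brSub_fSub_gSub_bot σ h4 h2 (Ne.symm h8) (Ne.symm h5) (Ne.symm h6) (Ne.symm h7)
  · exact brSub_gSub_gSub_bot σ h2 h4
  · exact brSub_gSub_tSub_bot σ h2 (Ne.symm h3) h7 h6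
  · exact brSub_tSub_tSub_bot σ (Ne.symm h1) h3 h8 h7
  · exact brSub_tSub_fSub_bot σ (Ne.symm h1) h4 h8 h6
  · rw [brSub_comm]
    exact brSub_gSub_tSub_bot σ h4 (Ne.symm h1) (Ne.symm h7) (Ne.symm h5)
  · exact brSub_tSub_tSub_bot σ (Ne.symm h1) (Ne.symm h3) h6 h5

/-- A generator f_i(a) is by definition [t_il(1), f_li(a)], an element of the summand of `inl l`.
Conversely `bracket_t_f_diag` places the summand of every index in the span of the f_i(a), and the
summand of `inr l` is the one of `inl l` with its factors exchanged. The g's behave alike. -/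
theorem rootSpace_diag (hm : 3 ≤ m) (u : Fin m ⊕ Fin m) : rootSpace σ u u.swap =
    ⨆ y, ⨆ (_ : y ≠ u ∧ y ≠ u.swap),
      (stpLie σ m).brSub (rootSpace σ u y) (rootSpace σ y u.swap) := by
  revert u
  rintro (i | i)
  · refine le_antisymm ?_ (iSup_le fun y => iSup_le ?_)
    · change fSub σ i i ≤ _
      rw [fSub_self]
      refine Submodule.span_le.mpr ?_
      rintro _ ⟨l, hl, a, rfl⟩
      refine Submodule.mem_iSup_of_mem (.inl l) (Submodule.mem_iSup_of_mem ⟨by simpa using hl.symm, by simp⟩ ?_)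
      change _ ∈ (stpLie σ m).brSub (tSub σ i l) (fSub σ l i)
      rw [tSub_of_ne σ hl, fSub_of_ne σ hl.symm]
      exact brSub_mem ⟨1, rfl⟩ ⟨a, rfl⟩
    · rintro ⟨h1, h2⟩
      rcases y with l | l <;>
        simp only [Sum.swap_inl, ne_eq, Sum.inl.injEq, Sum.inr.injEq, reduceCtorEq] at h1 h2
      · exact brSub_tSub_fSub_diag σ hm (Ne.symm h1)
      · simp only [rootSpace, Sum.swap_inl]
        rw [brSub_comm, fSub_comm]
        exact brSub_tSub_fSub_diag σ hm (Ne.symm h2)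
  · refine le_antisymm ?_ (iSup_le fun y => iSup_le ?_)
    · change gSub σ i i ≤ _
      rw [gSub_self]
      refine Submodule.span_le.mpr ?_
      rintro _ ⟨l, hl, a, rfl⟩
      refine Submodule.mem_iSup_of_mem (.inl l) (Submodule.mem_iSup_of_mem ⟨by simp, by simpa using hl.symm⟩ ?_)
      change _ ∈ (stpLie σ m).brSub (gSub σ i l) (tSub σ l i)
      rw [tSub_of_ne σ hl.symm, gSub_of_ne σ hl]
      exact brSub_mem ⟨a, rfl⟩ ⟨1, rfl⟩
    · rintro ⟨h1, h2⟩
      rcases y with l | l <;>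
        simp only [Sum.swap_inr, ne_eq, Sum.inl.injEq, Sum.inr.injEq, reduceCtorEq] at h1 h2
      · exact brSub_gSub_tSub_diag σ hm (Ne.symm h2)
      · simp only [rootSpace, Sum.swap_inr]
        rw [brSub_comm, gSub_comm]
        exact brSub_gSub_tSub_diag σ hm (Ne.symm h1)

theorem isRootFamily (hm : 3 ≤ m) :
    (stpLie σ m).IsRootFamily (Sum.swap : Fin m ⊕ Fin m → _) (rootSpace σ) where
  invol := Sum.swap_swap
  ne := by rintro (i | i) <;> simp
  exists_third := by
    rintro (i | i) (j | j) <;> obtain ⟨l, hi, hj⟩ := exists_third_index hm i j <;>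
      exact ⟨.inl l, by simp [hi.symm, hj.symm]⟩
  graded := by rintro (i | i) (j | j) <;> simp only [rootSpace] <;> infer_instance
  symm := by
    rintro (i | i) (j | j)
    · rfl
    · exact fSub_comm σ i j
    · exact gSub_comm σ i j
    · rfl
  brSub_eq := brSub_rootSpace_eq σ
  brSub_eq_bot := brSub_rootSpace_eq_bot σ
  diag := rootSpace_diag σ hm

/-! ### The height and the triangular parts. -/

/-- The height of an index: `m, ..., 1` on the first copy of `Fin m`, `-m, ..., -1` on the
second. -/
def height : Fin m ⊕ Fin m → ℤ
  | .inl i => m - i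
  | .inr i => -(m - i)

theorem height_swap (u : Fin m ⊕ Fin m) : height u.swap = -height u := by
  rcases u with i | i <;> simp [height]

theorem height_injective : Function.Injective (height (m := m)) := by
  rintro (i | i) (j | j) h <;> simp only [height] at h
  · congr 1; omega
  · omega
  · omega
  · congr 1; omega

/-- Heights on the second copy are negative, so every f is positive and every g is negative, and
t_ij is positive exactly when i < j. Listing f_ij for i < j only is enough, because f_ij and f_ji
span the same space. -/
theorem posPart_eq : posPart σ m = rootSum (rootSpace σ) (fun u v => height v < height u) := by
  refine le_antisymm (Submodule.span_le.mpr ?_) ?_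
  · rintro x ((⟨i, j, h, a, rfl⟩ | ⟨i, j, h, a, rfl⟩) | ⟨i, j, h, a, rfl⟩)
    · refine IsRootFamily.le_rootSum (u := .inl i) (v := .inl j) (by simp [height, h]) ?_
      simp only [rootSpace, tSub_of_ne σ h.ne]
      exact ⟨a, rfl⟩
    · refine IsRootFamily.le_rootSum (u := .inl i) (v := .inr j) (by simp only [height]; omega) ?_
      simp only [rootSpace, fSub_of_ne σ h.ne]
      exact ⟨a, rfl⟩
    · refine IsRootFamily.le_rootSum (u := .inl i) (v := .inr i) (by simp only [height]; omega) ?_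
      simp only [rootSpace, fSub_self]
      exact Submodule.subset_span ⟨j, h, a, rfl⟩
  · have ht : ∀ i j : Fin m, i < j → tSub σ i j ≤ posPart σ m := by
      intro i j h
      rw [tSub_of_ne σ h.ne]
      rintro _ ⟨a, rfl⟩
      exact Submodule.subset_span (Or.inl (Or.inl ⟨i, j, h, a, rfl⟩))
    have hf : ∀ i j : Fin m, i < j → fSub σ i j ≤ posPart σ m := by
      intro i j h
      rw [fSub_of_ne σ h.ne]
      rintro _ ⟨a, rfl⟩
      exact Submodule.subset_span (Or.inl (Or.inr ⟨i, j, h, a, rfl⟩))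
    refine iSup_le fun u => iSup_le fun v => iSup_le fun h => ?_
    rcases u with i | i <;> rcases v with j | j <;> simp only [height] at h
    · exact ht i j (by omega)
    · rcases lt_trichotomy i j with hij | rfl | hij
      · exact hf i j hij
      · simp only [rootSpace, fSub_self]
        refine Submodule.span_le.mpr ?_
        rintro _ ⟨l, hl, a, rfl⟩
        exact Submodule.subset_span (Or.inr ⟨i, l, hl, a, rfl⟩)
      · simp only [rootSpace]
        rw [fSub_comm]
        exact hf j i hij
    · omega
    · exact ht j i (by omega)

theorem negPart_eq : negPart σ m = rootSum (rootSpace σ) (fun u v => height u < height v) := by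
  refine le_antisymm (Submodule.span_le.mpr ?_) ?_
  · rintro x ((⟨i, j, h, a, rfl⟩ | ⟨i, j, h, a, rfl⟩) | ⟨i, j, h, a, rfl⟩)
    · refine IsRootFamily.le_rootSum (u := .inl i) (v := .inl j) (by simp [height, h]) ?_
      simp only [rootSpace, tSub_of_ne σ h.ne']
      exact ⟨a, rfl⟩
    · refine IsRootFamily.le_rootSum (u := .inr i) (v := .inl j) (by simp only [height]; omega) ?_
      simp only [rootSpace, gSub_of_ne σ h.ne']
      exact ⟨a, rfl⟩
    · refine IsRootFamily.le_rootSum (u := .inr i) (v := .inl i) (by simp only [height]; omega) ?_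
      simp only [rootSpace, gSub_self]
      exact Submodule.subset_span ⟨j, h, a, rfl⟩
  · have ht : ∀ i j : Fin m, j < i → tSub σ i j ≤ negPart σ m := by
      intro i j h
      rw [tSub_of_ne σ h.ne']
      rintro _ ⟨a, rfl⟩
      exact Submodule.subset_span (Or.inl (Or.inl ⟨i, j, h, a, rfl⟩))
    have hg : ∀ i j : Fin m, j < i → gSub σ i j ≤ negPart σ m := by
      intro i j h
      rw [gSub_of_ne σ h.ne']
      rintro _ ⟨a, rfl⟩
      exact Submodule.subset_span (Or.inl (Or.inr ⟨i, j, h, a, rfl⟩))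
    refine iSup_le fun u => iSup_le fun v => iSup_le fun h => ?_
    rcases u with i | i <;> rcases v with j | j <;> simp only [height] at h
    · exact ht i j (by omega)
    · omega
    · rcases lt_trichotomy i j with hij | rfl | hij
      · simp only [rootSpace]
        rw [gSub_comm]
        exact hg j i hij
      · simp only [rootSpace, gSub_self]
        refine Submodule.span_le.mpr ?_
        rintro _ ⟨l, hl, a, rfl⟩
        exact Submodule.subset_span (Or.inr ⟨i, l, hl, a, rfl⟩)
      · exact hg i j hij
    · exact ht j i (by omega)

/-- The span defining `zeroPart` uses only brackets of f's with g's. The brackets [t_ij, t_ji] are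
contained in it: passing through the index `inr l`, `brSub_opposite_le` bounds them by [f_il, g_li]
and [f_jl, g_lj]. -/
theorem zeroPart_eq (hm : 3 ≤ m) : zeroPart σ m = (stpLie σ m).cartan Sum.swap (rootSpace σ) := by
  have hE := isRootFamily σ hm
  have := hE.graded
  refine le_antisymm (Submodule.span_le.mpr ?_) ?_
  · rintro _ ⟨i, j, hij, a, b, rfl⟩
    refine IsRootFamily.le_cartan (u := .inl i) (v := .inr j) (by simp) (by simpa using hij) ?_
    simp only [rootSpace, fSub_of_ne σ hij, gSub_of_ne σ hij.symm]
    exact brSub_mem ⟨a, rfl⟩ ⟨b, rfl⟩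
  · have hf : ∀ {i j : Fin m}, i ≠ j →
        (stpLie σ m).brSub (rootSpace σ (.inl i) (.inr j)) (rootSpace σ (.inr j) (.inl i)) ≤
          zeroPart σ m := by
      intro i j h
      simp only [rootSpace, fSub_of_ne σ h, gSub_of_ne σ h.symm, brSub_le]
      rintro _ ⟨a, rfl⟩ _ ⟨b, rfl⟩
      exact Submodule.subset_span ⟨i, j, h, a, b, rfl⟩
    have ht : ∀ {i j : Fin m}, i ≠ j →
        (stpLie σ m).brSub (tSub σ i j) (tSub σ j i) ≤ zeroPart σ m := by
      intro i j h
      obtain ⟨l, hi, hj⟩ := exists_third_index hm i j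
      refine (hE.brSub_opposite_le (u := .inl i) (v := .inl j) (z := .inr l) (by simpa using h)
        (by simp) (by simp) (by simpa using hi.symm) (by simp) (by simpa using hj.symm)).trans ?_
      refine sup_le (hf hi) ?_
      rw [brSub_comm]
      exact hf hj
    refine iSup_le fun u => iSup_le fun v => iSup_le fun h => ?_
    rcases u with i | i <;> rcases v with j | j <;>
      simp only [Sum.swap_inl, Sum.swap_inr, ne_eq, Sum.inl.injEq, Sum.inr.injEq, reduceCtorEq,
        not_false_eq_true, true_and, and_true] at h
    · exact ht h
    · exact hf h
    · rw [brSub_comm]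
      exact hf (Ne.symm h)
    · exact ht (Ne.symm h)

theorem rootSum_ne_eq : rootSum (rootSpace σ) (· ≠ ·) = negPart σ m ⊔ posPart σ m := by
  rw [negPart_eq, posPart_eq]
  refine le_antisymm ?_ ?_
  · refine iSup_le fun u => iSup_le fun v => iSup_le fun h => ?_
    rcases lt_or_gt_of_ne (height_injective.ne h) with h | h
    · exact le_sup_of_le_left (IsRootFamily.le_rootSum h)
    · exact le_sup_of_le_right (IsRootFamily.le_rootSum h)
  · refine sup_le ?_ ?_ <;>
    · refine iSup_le fun u => iSup_le fun v => iSup_le fun h => IsRootFamily.le_rootSum ?_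
      rintro rfl
      exact lt_irrefl _ h

/-- The Steinberg periplectic Lie superalgebra is the sum of its three parts. -/
theorem sup_eq_top (hm : 3 ≤ m) : negPart σ m ⊔ posPart σ m ⊔ zeroPart σ m = ⊤ := by
  have hE := isRootFamily σ hm
  rw [← rootSum_ne_eq, zeroPart_eq σ hm]
  refine eq_top_of_presented (steinbergRel_homogeneous σ m) ?_ hE.brSub_sup_le
  intro x
  refine Submodule.mem_sup_left ?_
  cases x with
  | t i j hij p a =>
    refine IsRootFamily.le_rootSum (u := .inl i) (v := .inl j) (by simpa using hij) ?_
    simp only [rootSpace, tSub_of_ne σ hij]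
    exact ⟨a, t_of_mem σ hij a.2⟩
  | f i j hij p a =>
    refine IsRootFamily.le_rootSum (u := .inl i) (v := .inr j) (by simp) ?_
    simp only [rootSpace, fSub_of_ne σ hij]
    exact ⟨a, f_of_mem σ hij a.2⟩
  | g i j hij p a =>
    refine IsRootFamily.le_rootSum (u := .inr i) (v := .inl j) (by simp) ?_
    simp only [rootSpace, gSub_of_ne σ hij]
    exact ⟨a, g_of_mem σ hij a.2⟩

theorem isGraded_posPart (hm : 3 ≤ m) : (stpLie σ m).IsGraded (posPart σ m) :=
  posPart_eq σ (m := m) ▸ (isRootFamily σ hm).isGraded_rootSum _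

theorem isGraded_negPart (hm : 3 ≤ m) : (stpLie σ m).IsGraded (negPart σ m) :=
  negPart_eq σ (m := m) ▸ (isRootFamily σ hm).isGraded_rootSum _

theorem isGraded_zeroPart (hm : 3 ≤ m) : (stpLie σ m).IsGraded (zeroPart σ m) :=
  zeroPart_eq σ hm ▸ (isRootFamily σ hm).isGraded_cartan

theorem posPart_isSub (hm : 3 ≤ m) : (stpLie σ m).IsSub (posPart σ m) := by
  have := isGraded_posPart σ hm
  refine isSub_of_brSub_le ?_
  rw [posPart_eq]
  exact (isRootFamily σ hm).brSub_rootSum_le (fun u => lt_irrefl _)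
    (fun u v w h1 h2 => h2.trans h1)
    (fun u v h => by simp only [height_swap]; omega)

theorem negPart_isSub (hm : 3 ≤ m) : (stpLie σ m).IsSub (negPart σ m) := by
  have := isGraded_negPart σ hm
  refine isSub_of_brSub_le ?_
  rw [negPart_eq]
  exact (isRootFamily σ hm).brSub_rootSum_le (fun u => lt_irrefl _)
    (fun u v w h1 h2 => h1.trans h2)
    (fun u v h => by simp only [height_swap]; omega)

theorem zeroPart_isSub (hm : 3 ≤ m) : (stpLie σ m).IsSub (zeroPart σ m) := by
  have := isGraded_zeroPart σ hm
  refine isSub_of_brSub_le ?_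
  rw [zeroPart_eq σ hm]
  exact (isRootFamily σ hm).brSub_cartan_cartan_le

theorem brSub_zeroPart_posPart_le (hm : 3 ≤ m) :
    (stpLie σ m).brSub (zeroPart σ m) (posPart σ m) ≤ posPart σ m := by
  rw [zeroPart_eq σ hm, posPart_eq]
  exact (isRootFamily σ hm).brSub_cartan_rootSum_le fun u => lt_irrefl _

theorem brSub_zeroPart_negPart_le (hm : 3 ≤ m) :
    (stpLie σ m).brSub (zeroPart σ m) (negPart σ m) ≤ negPart σ m := by
  rw [zeroPart_eq σ hm, negPart_eq]
  exact (isRootFamily σ hm).brSub_cartan_rootSum_le fun u => lt_irrefl _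

end Stp

end Steinberg

section Steinberg

variable {k R : Type*} [CommRing k] [Ring R] [Algebra k R] {𝒜 : ZMod 2 → Submodule k R}
  [GradedAlgebra 𝒜]

/-! ### The matrix representation -/

/-- The matrices of the generators. -/
def SteinbergGen.toMatrix (σ : Superinvolution 𝒜) {m : ℕ} : SteinbergGen 𝒜 m → SuperMatrix R m
  | .t i j _ _ a => tMat σ i j a
  | .f i j _ _ a => fMat σ i j a
  | .g i j _ _ a => gMat σ i j a

theorem SteinbergGen.toMatrix_mem (σ : Superinvolution 𝒜) {m : ℕ} (x : SteinbergGen 𝒜 m) :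
    x.toMatrix σ ∈ (glLie 𝒜 m).grade x.parity := by
  cases x with
  | t i j _ p a => exact tMat_mem σ i j a.2
  | f i j _ p a => exact fMat_mem σ i j a.2
  | g i j _ p a => exact gMat_mem σ i j a.2

-- Each relation is a specialization of a general matrix bracket formula, in which the inequalities
-- select the surviving terms.
open SteinbergGen in
theorem SteinbergRel.freeLift_eq_zero {σ : Superinvolution 𝒜} {m : ℕ}
    {x : FreeNonUnitalNonAssocAlgebra k (SteinbergGen 𝒜 m)} (hx : SteinbergRel σ m x) :
    (glLie 𝒜 m).freeLift (SteinbergGen.toMatrix σ) x = 0 := by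
  have hT : ∀ {i j : Fin m} (h : i ≠ j) {p : ZMod 2} (a : 𝒜 p),
      (glLie 𝒜 m).freeLift (SteinbergGen.toMatrix σ) (T h a) = tMat σ i j a :=
    fun h _ a => (glLie 𝒜 m).freeLift_of _ (SteinbergGen.t _ _ h _ a)
  have hF : ∀ {i j : Fin m} (h : i ≠ j) {p : ZMod 2} (a : 𝒜 p),
      (glLie 𝒜 m).freeLift (SteinbergGen.toMatrix σ) (F h a) = fMat σ i j a :=
    fun h _ a => (glLie 𝒜 m).freeLift_of _ (SteinbergGen.f _ _ h _ a)
  have hG : ∀ {i j : Fin m} (h : i ≠ j) {p : ZMod 2} (a : 𝒜 p),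
      (glLie 𝒜 m).freeLift (SteinbergGen.toMatrix σ) (G h a) = gMat σ i j a :=
    fun h _ a => (glLie 𝒜 m).freeLift_of _ (SteinbergGen.g _ _ h _ a)
  cases hx with
  | t_linear hij c d a b =>
    simp only [map_sub, map_add, map_smul, hT, Submodule.coe_add, Submodule.coe_smul, tMat_add,
      tMat_smul, sub_self]
  | f_linear hij c d a b =>
    simp only [map_sub, map_add, map_smul, hF, Submodule.coe_add, Submodule.coe_smul, fMat_add,
      fMat_smul, sub_self]
  | g_linear hij c d a b =>
    simp only [map_sub, map_add, map_smul, hG, Submodule.coe_add, Submodule.coe_smul, gMat_add,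
      gMat_smul, sub_self]
  | @f_bar i j hij p a =>
    have e : ((superSign p • a : 𝒜 p) : R) = signMap 𝒜 (a : R) := (signMap_apply 𝒜 a.2).symm
    rw [map_sub, hF, hF, e, ← fMat_signMap_bar σ j i, σ.bar_bar, sub_self]
  | @g_bar i j hij p a =>
    have e : ((superSign p • a : 𝒜 p) : R) = signMap 𝒜 (a : R) := (signMap_apply 𝒜 a.2).symm
    rw [map_add, hG, hG, e, ← neg_neg (gMat σ i j _), ← gMat_signMap_bar σ j i, σ.bar_bar,
      neg_add_cancel]
  | t_t hij hjl hil a b =>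
    rw [map_sub, LieSuperalgebra.freeLift_mul, hT, hT, hT, glLie_tMat_tMat σ _ _ _ _ a.2 b.2,
      if_pos rfl, if_neg hil, smul_zero, sub_zero, sub_self]
  | t_t_zero hij hjn hnl hli a b =>
    rw [LieSuperalgebra.freeLift_mul, hT, hT, glLie_tMat_tMat σ _ _ _ _ a.2 b.2,
      if_neg hjn, if_neg hli.symm, smul_zero, sub_zero]
  | t_f hij hjl hil a b =>
    rw [map_sub, LieSuperalgebra.freeLift_mul, hT, hF, hF, glLie_tMat_fMat,
      if_pos rfl, if_neg hjl, add_zero, sub_self]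
  | t_f_zero hij hjn hnl hlj a b =>
    rw [LieSuperalgebra.freeLift_mul, hT, hF, glLie_tMat_fMat,
      if_neg hjn, if_neg hlj.symm, add_zero]
  | g_t hij hjl hil a b =>
    rw [map_sub, LieSuperalgebra.freeLift_mul, hT, hG, hG, glLie_gMat_tMat,
      if_pos rfl, if_neg hij, sub_zero, sub_self]
  | g_t_zero hij hnl hnj hin a b =>
    rw [LieSuperalgebra.freeLift_mul, hT, hG, glLie_gMat_tMat,
      if_neg hnj.symm, if_neg hin, sub_zero]
  | f_f hij hnl a b =>
    rw [LieSuperalgebra.freeLift_mul, hF, hF, glLie_fMat_fMat_hom σ _ _ _ _ a.2 b.2]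
  | g_g hij hnl a b =>
    rw [LieSuperalgebra.freeLift_mul, hG, hG, glLie_gMat_gMat_hom σ _ _ _ _ a.2 b.2]
  | f_g hij hjl hil a b =>
    rw [map_sub, LieSuperalgebra.freeLift_mul, hT, hF, hG, glLie_fMat_gMat,
      if_pos rfl, if_neg hij, if_neg hjl, if_neg hil, add_zero, sub_zero, sub_zero, sub_self]
  | f_g_zero hij hin hil hjn hjl hnl a b =>
    rw [LieSuperalgebra.freeLift_mul, hF, hG, glLie_fMat_gMat,
      if_neg hjn, if_neg hin, if_neg hjl, if_neg hil, add_zero, sub_zero, sub_zero]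

namespace Stp

open LieSuperalgebra

/-- Homomorphisms to the Lie superalgebra of all matrices that send `t_{ij}(a)`, `f_{ij}(a)` and
`g_{ij}(a)` to the matrices of the same names. -/
structure IsMatrixHom [Invertible (2 : k)] (σ : Superinvolution 𝒜) {m : ℕ}
    (φ : Stp σ m →ₗ[k] SuperMatrix R m) : Prop where
  isHom : (stpLie σ m).IsHom (glLie 𝒜 m) φ
  map_t : ∀ {i j : Fin m} (hij : i ≠ j) (a : R), φ (t σ hij a) = tMat σ i j a
  map_f : ∀ {i j : Fin m} (hij : i ≠ j) (a : R), φ (f σ hij a) = fMat σ i j a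
  map_g : ∀ {i j : Fin m} (hij : i ≠ j) (a : R), φ (g σ hij a) = gMat σ i j a

variable [Invertible (2 : k)] (σ : Superinvolution 𝒜) (m : ℕ)

theorem exists_isMatrixHom : ∃ φ : Stp σ m →ₗ[k] SuperMatrix R m, IsMatrixHom σ φ := by
  obtain ⟨φ, hφ, h⟩ := exists_isHom_presented (M := glLie 𝒜 m) (steinbergRel_homogeneous σ m)
    (SteinbergGen.toMatrix_mem σ) (fun x hx => hx.freeLift_eq_zero)
  refine ⟨φ, hφ, ?_, ?_, ?_⟩
  · intro i j hij a
    induction a using homogeneous_induction 𝒜 with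
    | add a b ha hb => rw [t_add, map_add, ha, hb, tMat_add]
    | hom p a ha =>
      rw [t_of_mem σ hij ha]
      exact h (SteinbergGen.t i j hij p ⟨a, ha⟩)
  · intro i j hij a
    induction a using homogeneous_induction 𝒜 with
    | add a b ha hb => rw [f_add, map_add, ha, hb, fMat_add]
    | hom p a ha =>
      rw [f_of_mem σ hij ha]
      exact h (SteinbergGen.f i j hij p ⟨a, ha⟩)
  · intro i j hij a
    induction a using homogeneous_induction 𝒜 with
    | add a b ha hb => rw [g_add, map_add, ha, hb, gMat_add]
    | hom p a ha =>
      rw [g_of_mem σ hij ha]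
      exact h (SteinbergGen.g i j hij p ⟨a, ha⟩)

variable {σ m}

namespace IsMatrixHom

variable {φ : Stp σ m →ₗ[k] SuperMatrix R m} {i j : Fin m}

theorem map_fDiag (hφ : IsMatrixHom σ φ) (hij : i ≠ j) (a : R) :
    φ (fDiag σ hij a) = fMat σ i i a := by
  rw [fDiag, hφ.isHom.map_bracket, hφ.map_t, hφ.map_f, glLie_tMat_fMat, if_pos rfl,
    if_neg hij.symm, one_mul, add_zero]

theorem map_gDiag (hφ : IsMatrixHom σ φ) (hij : i ≠ j) (a : R) :
    φ (gDiag σ hij a) = gMat σ i i a := by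
  rw [gDiag, hφ.isHom.map_bracket, hφ.map_t, hφ.map_g, glLie_gMat_tMat, if_pos rfl,
    if_neg hij, mul_one, sub_zero]

theorem map_h (hφ : IsMatrixHom σ φ) (hij : i ≠ j) (a b : R) :
    φ (h σ hij a b) =
      tMat σ i i (a * b) - tMat σ j j (signMap 𝒜 (σ.bar a) * signMap 𝒜 (σ.bar b)) := by
  rw [h, hφ.isHom.map_bracket, hφ.map_f, hφ.map_g, glLie_fMat_gMat, if_pos rfl,
    if_neg hij, if_neg hij.symm, if_pos rfl, add_zero, sub_zero]

end IsMatrixHom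

/-! ### The matrix representation is injective on the positive and on the negative part -/

/-- The sum of the `B i j (x i j)` over `i < j`. -/
def upperSum {V : Type*} [AddCommGroup V] [Module k V]
    (B : ∀ i j : Fin m, i < j → SuperMatrix R m →ₗ[k] V) : SuperMatrix R m →ₗ[k] V :=
  ∑ i, ∑ j, if h : i < j then B i j h else 0

omit [Invertible (2 : k)] in
theorem upperSum_eq_zero {V : Type*} [AddCommGroup V] [Module k V]
    {B : ∀ i j : Fin m, i < j → SuperMatrix R m →ₗ[k] V} {X : SuperMatrix R m}
    (hX : ∀ i j h, B i j h X = 0) : upperSum B X = 0 := by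
  simp only [upperSum, LinearMap.sum_apply]
  refine Finset.sum_eq_zero fun i _ => Finset.sum_eq_zero fun j _ => ?_
  split_ifs with h
  · exact hX i j h
  · rfl

omit [Invertible (2 : k)] in
theorem upperSum_eq_single {V : Type*} [AddCommGroup V] [Module k V]
    {B : ∀ i j : Fin m, i < j → SuperMatrix R m →ₗ[k] V} {X : SuperMatrix R m} {n l : Fin m}
    (hnl : n < l) (hX : ∀ i j h, ¬ (i = n ∧ j = l) → B i j h X = 0) :
    upperSum B X = B n l hnl X := by
  simp only [upperSum, LinearMap.sum_apply]
  rw [Finset.sum_eq_single n, Finset.sum_eq_single l]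
  · rw [dif_pos hnl]
  · intro j _ hj
    split_ifs with h
    · exact hX _ _ h (by simp [hj])
    · rfl
  · simp
  · intro i _ hi
    refine Finset.sum_eq_zero fun j _ => ?_
    split_ifs with h
    · exact hX _ _ h (by simp [hi])
    · rfl
  · simp

variable (σ)

/-- A linear map that recovers an element of the positive part from its matrix. -/
noncomputable def posSection (c : ∀ i : Fin m, {l // i ≠ l}) : SuperMatrix R m →ₗ[k] Stp σ m :=
  upperSum (fun i j h => tₗ σ h.ne ∘ₗ Matrix.entryLinearMap k R (.inl i) (.inl j) +
    fₗ σ h.ne ∘ₗ Matrix.entryLinearMap k R (.inl i) (.inr j)) +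
  ∑ i, ⅟(2 : k) • fDiagₗ σ (c i).2 ∘ₗ Matrix.entryLinearMap k R (.inl i) (.inr i)

/-- A linear map that recovers an element of the negative part from its matrix. -/
noncomputable def negSection (c : ∀ i : Fin m, {l // i ≠ l}) : SuperMatrix R m →ₗ[k] Stp σ m :=
  upperSum (fun i j h => tₗ σ h.ne' ∘ₗ Matrix.entryLinearMap k R (.inl j) (.inl i) +
    gₗ σ h.ne' ∘ₗ Matrix.entryLinearMap k R (.inr j) (.inl i)) +
  ∑ i, ⅟(2 : k) • gDiagₗ σ (c i).2 ∘ₗ Matrix.entryLinearMap k R (.inr i) (.inl i)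

variable (c : ∀ i : Fin m, {l // i ≠ l})

theorem posSection_tMat {i j : Fin m} (hij : i < j) (a : R) :
    posSection σ c (tMat σ i j a) = t σ hij.ne a := by
  rw [posSection, LinearMap.add_apply, upperSum_eq_single hij]
  · simp [tMat, tₗ_apply]
  · intro n l _ h
    have : ¬ (i = n ∧ j = l) := fun h' => h ⟨h'.1.symm, h'.2.symm⟩
    simp [tMat, this]

theorem posSection_tMat_of_le {i j : Fin m} (hij : j ≤ i) (a : R) :
    posSection σ c (tMat σ i j a) = 0 := by
  rw [posSection, LinearMap.add_apply, upperSum_eq_zero]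
  · simp [tMat]
  · intro n l h
    have : ¬ (i = n ∧ j = l) := by rintro ⟨rfl, rfl⟩; exact absurd h (not_lt.mpr hij)
    simp [tMat, this]

theorem posSection_gMat (i j : Fin m) (a : R) : posSection σ c (gMat σ i j a) = 0 := by
  rw [posSection, LinearMap.add_apply, upperSum_eq_zero]
  · simp [gMat]
  · simp [gMat]

/-- The matrix f_ij(a) has a second entry at position (j, m + i). As j > i, that position is not
read by the section, so nothing is counted twice. -/
theorem posSection_fMat {i j : Fin m} (hij : i < j) (a : R) :
    posSection σ c (fMat σ i j a) = f σ hij.ne a := by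
  rw [posSection, LinearMap.add_apply, upperSum_eq_single hij]
  · have h1 : ∀ n, ¬ (i = n ∧ j = n) := by rintro n ⟨rfl, rfl⟩; exact lt_irrefl _ hij
    have h2 : ∀ n, ¬ (j = n ∧ i = n) := by rintro n ⟨rfl, rfl⟩; exact lt_irrefl _ hij
    simp [fMat, h1, h2, fₗ_apply, hij.ne']
  · intro n l hnl h
    have h1 : ¬ (i = n ∧ j = l) := fun h' => h ⟨h'.1.symm, h'.2.symm⟩
    have h2 : ¬ (j = n ∧ i = l) := by rintro ⟨rfl, rfl⟩; exact lt_asymm hij hnl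
    simp [fMat, h1, h2]

/-- Both terms of f_ii(a) fall on the same entry, which is a + ρ(bar a). Its image under f_i is 2
f_i(a) by `fDiag_signMap_bar`, whence the factor 1/2 in the section. -/
theorem posSection_fMat_diag (hm : 3 ≤ m) {i j : Fin m} (hij : i ≠ j) (a : R) :
    posSection σ c (fMat σ i i a) = fDiag σ hij a := by
  rw [posSection, LinearMap.add_apply, upperSum_eq_zero]
  · rw [zero_add, LinearMap.sum_apply, Finset.sum_eq_single i]
    · have e : fMat σ i i a (.inl i) (.inr i) = a + signMap 𝒜 (σ.bar a) := by simp [fMat]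
      rw [LinearMap.smul_apply, LinearMap.comp_apply, Matrix.entryLinearMap_apply, e, fDiagₗ_apply,
        fDiag_add, fDiag_signMap_bar σ hm, ← two_smul k, smul_smul, invOf_mul_self, one_smul]
      exact fDiag_eq σ hm _ hij a
    · intro n _ hn
      simp [fMat, hn.symm]
    · simp
  · intro n l h
    have h1 : ¬ (i = n ∧ i = l) := by rintro ⟨rfl, rfl⟩; exact lt_irrefl _ h
    simp [fMat, h1]

/-- In `negSection` the summand for n < l reads the transposed position (l, n), so the hypothesis j
< i singles out the summand of (j, i). -/
theorem negSection_tMat {i j : Fin m} (hij : j < i) (a : R) :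
    negSection σ c (tMat σ i j a) = t σ hij.ne' a := by
  rw [negSection, LinearMap.add_apply, upperSum_eq_single hij]
  · simp [tMat, tₗ_apply]
  · intro n l _ h
    have : ¬ (i = l ∧ j = n) := fun h' => h ⟨h'.2.symm, h'.1.symm⟩
    simp [tMat, this]

theorem negSection_tMat_of_le {i j : Fin m} (hij : i ≤ j) (a : R) :
    negSection σ c (tMat σ i j a) = 0 := by
  rw [negSection, LinearMap.add_apply, upperSum_eq_zero]
  · simp [tMat]
  · intro n l h
    have : ¬ (i = l ∧ j = n) := by rintro ⟨rfl, rfl⟩; exact absurd h (not_lt.mpr hij)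
    simp [tMat, this]

theorem negSection_fMat (i j : Fin m) (a : R) : negSection σ c (fMat σ i j a) = 0 := by
  rw [negSection, LinearMap.add_apply, upperSum_eq_zero]
  · simp [fMat]
  · simp [fMat]

theorem negSection_gMat {i j : Fin m} (hij : j < i) (a : R) :
    negSection σ c (gMat σ i j a) = g σ hij.ne' a := by
  rw [negSection, LinearMap.add_apply, upperSum_eq_single hij]
  · have h1 : ∀ n, ¬ (i = n ∧ j = n) := by rintro n ⟨rfl, rfl⟩; exact lt_irrefl _ hij
    have h2 : ∀ n, ¬ (j = n ∧ i = n) := by rintro n ⟨rfl, rfl⟩; exact lt_irrefl _ hij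
    simp [gMat, h1, h2, gₗ_apply, hij.ne]
  · intro n l hnl h
    have h1 : ¬ (i = l ∧ j = n) := fun h' => h ⟨h'.2.symm, h'.1.symm⟩
    have h2 : ¬ (j = l ∧ i = n) := by rintro ⟨rfl, rfl⟩; exact lt_asymm hij hnl
    simp [gMat, h1, h2]

/-- Here the entry is a - ρ(bar a), and the minus sign is compensated by the antisymmetry of g_i
under the involution. -/
theorem negSection_gMat_diag (hm : 3 ≤ m) {i j : Fin m} (hij : i ≠ j) (a : R) :
    negSection σ c (gMat σ i i a) = gDiag σ hij a := by
  rw [negSection, LinearMap.add_apply, upperSum_eq_zero]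
  · rw [zero_add, LinearMap.sum_apply, Finset.sum_eq_single i]
    · have e : gMat σ i i a (.inr i) (.inl i) = a - signMap 𝒜 (σ.bar a) := by simp [gMat]
      rw [LinearMap.smul_apply, LinearMap.comp_apply, Matrix.entryLinearMap_apply, e, map_sub,
        gDiagₗ_apply, gDiagₗ_apply, gDiag_signMap_bar σ hm, sub_neg_eq_add, ← two_smul k, smul_smul,
        invOf_mul_self, one_smul]
      exact gDiag_eq σ hm _ hij a
    · intro n _ hn
      simp [gMat, hn.symm]
    · simp
  · intro n l h
    have h1 : ¬ (i = l ∧ i = n) := by rintro ⟨rfl, rfl⟩; exact lt_irrefl _ h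
    simp [gMat, h1]

variable {σ} {φ : Stp σ m →ₗ[k] SuperMatrix R m}

/-- The section is a left inverse of φ on the positive part. Together with its vanishing on the two
other parts, this extracts the positive component of an element from its matrix. -/
theorem posSection_apply_pos (hm : 3 ≤ m) (hφ : IsMatrixHom σ φ) {x : Stp σ m}
    (hx : x ∈ posPart σ m) : posSection σ c (φ x) = x := by
  refine LinearMap.eqOn_span (f := posSection σ c ∘ₗ φ) (g := LinearMap.id) ?_ hx
  rintro x ((⟨i, j, h, a, rfl⟩ | ⟨i, j, h, a, rfl⟩) | ⟨i, j, h, a, rfl⟩)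
  · simp [hφ.map_t, posSection_tMat σ c h]
  · simp [hφ.map_f, posSection_fMat σ c h]
  · simp [hφ.map_fDiag, posSection_fMat_diag σ c hm h]

theorem negSection_apply_neg (hm : 3 ≤ m) (hφ : IsMatrixHom σ φ) {x : Stp σ m}
    (hx : x ∈ negPart σ m) : negSection σ c (φ x) = x := by
  refine LinearMap.eqOn_span (f := negSection σ c ∘ₗ φ) (g := LinearMap.id) ?_ hx
  rintro x ((⟨i, j, h, a, rfl⟩ | ⟨i, j, h, a, rfl⟩) | ⟨i, j, h, a, rfl⟩)
  · simp [hφ.map_t, negSection_tMat σ c h]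
  · simp [hφ.map_g, negSection_gMat σ c h]
  · simp [hφ.map_gDiag, negSection_gMat_diag σ c hm h]

theorem posSection_apply_neg (hφ : IsMatrixHom σ φ) {x : Stp σ m}
    (hx : x ∈ negPart σ m) : posSection σ c (φ x) = 0 := by
  refine LinearMap.eqOn_span (f := posSection σ c ∘ₗ φ) (g := 0) ?_ hx
  rintro x ((⟨i, j, h, a, rfl⟩ | ⟨i, j, h, a, rfl⟩) | ⟨i, j, h, a, rfl⟩)
  · simp [hφ.map_t, posSection_tMat_of_le σ c h.le]
  · simp [hφ.map_g, posSection_gMat]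
  · simp [hφ.map_gDiag, posSection_gMat]

theorem negSection_apply_pos (hφ : IsMatrixHom σ φ) {x : Stp σ m}
    (hx : x ∈ posPart σ m) : negSection σ c (φ x) = 0 := by
  refine LinearMap.eqOn_span (f := negSection σ c ∘ₗ φ) (g := 0) ?_ hx
  rintro x ((⟨i, j, h, a, rfl⟩ | ⟨i, j, h, a, rfl⟩) | ⟨i, j, h, a, rfl⟩)
  · simp [hφ.map_t, negSection_tMat_of_le σ c h.le]
  · simp [hφ.map_f, negSection_fMat]
  · simp [hφ.map_fDiag, negSection_fMat]

theorem posSection_apply_zero (hφ : IsMatrixHom σ φ) {x : Stp σ m}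
    (hx : x ∈ zeroPart σ m) : posSection σ c (φ x) = 0 := by
  refine LinearMap.eqOn_span (f := posSection σ c ∘ₗ φ) (g := 0) ?_ hx
  rintro _ ⟨i, j, h, a, b, rfl⟩
  simp [hφ.map_h, posSection_tMat_of_le σ c le_rfl]

theorem negSection_apply_zero (hφ : IsMatrixHom σ φ) {x : Stp σ m}
    (hx : x ∈ zeroPart σ m) : negSection σ c (φ x) = 0 := by
  refine LinearMap.eqOn_span (f := negSection σ c ∘ₗ φ) (g := 0) ?_ hx
  rintro _ ⟨i, j, h, a, b, rfl⟩
  simp [hφ.map_h, negSection_tMat_of_le σ c le_rfl]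

end Stp

end Steinberg

section Steinberg

variable {k R : Type*} [CommRing k] [Ring R] [Algebra k R] {𝒜 : ZMod 2 → Submodule k R}
  [GradedAlgebra 𝒜]

namespace Stp

open LieSuperalgebra

variable (σ : Superinvolution 𝒜) {m : ℕ}

/-! ### The image of the matrix representation -/

theorem tMat_mem_pTilde (i j : Fin m) (a : R) : tMat σ i j a ∈ pTilde σ m := by
  change prp σ _ = _
  ext (u | u) (v | v) <;>
    simp [prp, tMat, Matrix.toBlocks₁₁, Matrix.toBlocks₁₂, Matrix.toBlocks₂₁, Matrix.toBlocks₂₂,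
      Matrix.single_apply, apply_ite σ.bar, σ.bar_bar, and_comm]

theorem fMat_mem_pTilde (i j : Fin m) (a : R) : fMat σ i j a ∈ pTilde σ m := by
  change prp σ _ = _
  ext (u | u) (v | v) <;>
    simp [prp, fMat, Matrix.toBlocks₁₁, Matrix.toBlocks₁₂, Matrix.toBlocks₂₁, Matrix.toBlocks₂₂,
      Matrix.single_apply, apply_ite σ.bar, apply_ite (signMap 𝒜), σ.bar_bar, and_comm,
      ← signMap_bar, signMap_signMap, add_comm]

theorem gMat_mem_pTilde (i j : Fin m) (a : R) : gMat σ i j a ∈ pTilde σ m := by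
  change prp σ _ = _
  ext (u | u) (v | v) <;>
    simp [prp, gMat, Matrix.toBlocks₁₁, Matrix.toBlocks₁₂, Matrix.toBlocks₂₁, Matrix.toBlocks₂₂,
      Matrix.single_apply, apply_ite σ.bar, apply_ite (signMap 𝒜), σ.bar_bar, and_comm,
      ← signMap_bar, signMap_signMap]

theorem bracket_mem_periplectic {X Y : SuperMatrix R m} (hX : X ∈ pTilde σ m)
    (hY : Y ∈ pTilde σ m) : (glLie 𝒜 m).bracket X Y ∈ periplectic σ m :=
  Submodule.subset_span ⟨X, hX, Y, hY, rfl⟩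

theorem tMat_mem_periplectic (hm : 3 ≤ m) {i j : Fin m} (hij : i ≠ j) (a : R) :
    tMat σ i j a ∈ periplectic σ m := by
  obtain ⟨l, hi, hj⟩ := exists_third_index hm i j
  have := bracket_mem_periplectic σ (fMat_mem_pTilde σ i l a) (gMat_mem_pTilde σ l j 1)
  rwa [glLie_fMat_gMat, if_pos rfl, if_neg hi, if_neg hj.symm, if_neg hij, mul_one, add_zero,
    sub_zero, sub_zero] at this

theorem fMat_mem_periplectic (hm : 3 ≤ m) (i j : Fin m) (a : R) :
    fMat σ i j a ∈ periplectic σ m := by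
  obtain ⟨l, hi, hj⟩ := exists_third_index hm i j
  have := bracket_mem_periplectic σ (tMat_mem_pTilde σ i l 1) (fMat_mem_pTilde σ l j a)
  rwa [glLie_tMat_fMat, if_pos rfl, if_neg hj.symm, one_mul, add_zero] at this

theorem gMat_mem_periplectic (hm : 3 ≤ m) (i j : Fin m) (a : R) :
    gMat σ i j a ∈ periplectic σ m := by
  obtain ⟨l, hi, hj⟩ := exists_third_index hm i j
  have := bracket_mem_periplectic σ (gMat_mem_pTilde σ i l a) (tMat_mem_pTilde σ l j 1)
  rwa [glLie_gMat_tMat, if_pos rfl, if_neg hi, mul_one, sub_zero] at this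

/-- A skew-symmetric matrix is a combination of the matrices `t_{ij}(a)`, `f_{ij}(a)` and
`g_{ij}(a)`. -/
theorem eq_sum_of_mem_pTilde [Invertible (2 : k)] {X : SuperMatrix R m} (hX : X ∈ pTilde σ m) :
    X = ∑ i, ∑ j, (tMat σ i j (X (.inl i) (.inl j)) +
      ⅟(2 : k) • (fMat σ i j (X (.inl i) (.inr j)) + gMat σ i j (X (.inr i) (.inl j)))) := by
  have hX' : prp σ X = -X := hX
  have e22 : ∀ i j, σ.bar (X (.inl j) (.inl i)) = -X (.inr i) (.inr j) := fun i j =>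
    congrFun (congrFun hX' (.inr i)) (.inr j)
  have e12 : ∀ i j, signMap 𝒜 (σ.bar (X (.inl j) (.inr i))) = X (.inl i) (.inr j) := fun i j => by
    rw [signMap_bar]
    exact neg_inj.mp (congrFun (congrFun hX' (.inl i)) (.inr j))
  have e21 : ∀ i j, signMap 𝒜 (σ.bar (X (.inr j) (.inl i))) = -X (.inr i) (.inl j) := fun i j => by
    rw [signMap_bar]
    exact congrFun (congrFun hX' (.inr i)) (.inl j)
  -- The sum over all i and j meets each entry of the off-diagonal blocks twice, from f_ij and f_ji
  -- or from g_ij and g_ji; this is the reason for the factor 1/2.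
  have h2 : ∀ x : R, ⅟(2 : k) • (x + x) = x := fun x => by
    rw [← two_smul k x, smul_smul, invOf_mul_self, one_smul]
  have s : ∀ (u v : Fin m) (x : Fin m → Fin m → R),
      ∑ i, ∑ j, (if i = u ∧ j = v then x i j else 0) = x u v := by
    intro u v x
    simp [ite_and]
  have s' : ∀ (u v : Fin m) (x : Fin m → Fin m → R),
      ∑ i, ∑ j, (if j = u ∧ i = v then x i j else 0) = x v u := by
    intro u v x
    simp [ite_and, and_comm]
  ext (u | u) (v | v) <;>
    simp only [Matrix.sum_apply, Matrix.add_apply, Matrix.smul_apply, tMat, fMat, gMat,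
      Matrix.sub_apply, Matrix.single_apply, Sum.inl.injEq, Sum.inr.injEq, reduceCtorEq,
      false_and, and_false, if_false, sub_zero, zero_sub, add_zero, zero_add, smul_zero,
      Finset.sum_const_zero, ← Finset.smul_sum, Finset.sum_add_distrib, Finset.sum_sub_distrib,
      s, s', e22, e12, e21, sub_neg_eq_add, h2]
  simp only [Finset.sum_neg_distrib, s', neg_neg]

variable [Invertible (2 : k)] {σ} {φ : Stp σ m →ₗ[k] SuperMatrix R m}

/-- By `sup_eq_top` these elements span linearly, so a linear statement can be tested on them
without any closure under brackets. -/
theorem le_of_parts (hm : 3 ≤ m) {N : Submodule k (Stp σ m)}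
    (ht : ∀ {i j : Fin m} (h : i ≠ j) a, t σ h a ∈ N)
    (hf : ∀ {i j : Fin m} (h : i ≠ j) a, f σ h a ∈ N)
    (hg : ∀ {i j : Fin m} (h : i ≠ j) a, g σ h a ∈ N)
    (hfd : ∀ {i j : Fin m} (h : i ≠ j) a, fDiag σ h a ∈ N)
    (hgd : ∀ {i j : Fin m} (h : i ≠ j) a, gDiag σ h a ∈ N)
    (hh : ∀ {i j : Fin m} (h : i ≠ j) a b, Stp.h σ h a b ∈ N) (x : Stp σ m) : x ∈ N := by
  suffices key : negPart σ m ⊔ posPart σ m ⊔ zeroPart σ m ≤ N from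
    key (by rw [sup_eq_top σ hm]; trivial)
  refine sup_le (sup_le ?_ ?_) ?_ <;> refine Submodule.span_le.mpr ?_
  · rintro x ((⟨i, j, h, a, rfl⟩ | ⟨i, j, h, a, rfl⟩) | ⟨i, j, h, a, rfl⟩)
    exacts [ht _ _, hg _ _, hgd _ _]
  · rintro x ((⟨i, j, h, a, rfl⟩ | ⟨i, j, h, a, rfl⟩) | ⟨i, j, h, a, rfl⟩)
    exacts [ht _ _, hf _ _, hfd _ _]
  · rintro _ ⟨i, j, h, a, b, rfl⟩
    exact hh _ _ _

theorem IsMatrixHom.apply_mem (hm : 3 ≤ m) (hφ : IsMatrixHom σ φ) (x : Stp σ m) :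
    φ x ∈ periplectic σ m := by
  refine le_of_parts hm (N := (periplectic σ m).comap φ) ?_ ?_ ?_ ?_ ?_ ?_ x <;> intro i j h a
  · exact Submodule.mem_comap.mpr (hφ.map_t h a ▸ tMat_mem_periplectic σ hm h a)
  · exact Submodule.mem_comap.mpr (hφ.map_f h a ▸ fMat_mem_periplectic σ hm i j a)
  · exact Submodule.mem_comap.mpr (hφ.map_g h a ▸ gMat_mem_periplectic σ hm i j a)
  · exact Submodule.mem_comap.mpr (hφ.map_fDiag h a ▸ fMat_mem_periplectic σ hm i i a)
  · exact Submodule.mem_comap.mpr (hφ.map_gDiag h a ▸ gMat_mem_periplectic σ hm i i a)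
  · intro b
    rw [Submodule.mem_comap, Stp.h, hφ.isHom.map_bracket, hφ.map_f, hφ.map_g]
    exact bracket_mem_periplectic σ (fMat_mem_pTilde σ i j a) (gMat_mem_pTilde σ j i b)

theorem IsMatrixHom.eq (hm : 3 ≤ m) (hφ : IsMatrixHom σ φ) {φ' : Stp σ m →ₗ[k] SuperMatrix R m}
    (hφ' : IsMatrixHom σ φ') : φ = φ' := by
  refine LinearMap.ext fun x => ?_
  refine le_of_parts hm (N := LinearMap.eqLocus φ φ') ?_ ?_ ?_ ?_ ?_ ?_ x <;> intro i j h a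
  · exact (hφ.map_t h a).trans (hφ'.map_t h a).symm
  · exact (hφ.map_f h a).trans (hφ'.map_f h a).symm
  · exact (hφ.map_g h a).trans (hφ'.map_g h a).symm
  · exact (hφ.map_fDiag h a).trans (hφ'.map_fDiag h a).symm
  · exact (hφ.map_gDiag h a).trans (hφ'.map_gDiag h a).symm
  · intro b
    exact (hφ.map_h h a b).trans (hφ'.map_h h a b).symm

/-- Modulo the image, the skew-symmetric matrices are diagonal and concentrated at any given
index. -/
theorem IsMatrixHom.exists_eq_add (hm : 3 ≤ m) (hφ : IsMatrixHom σ φ) (l : Fin m)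
    {X : SuperMatrix R m} (hX : X ∈ pTilde σ m) : ∃ x a, X = φ x + tMat σ l l a := by
  have key : X ∈ LinearMap.range φ ⊔ LinearMap.range (tMatₗ σ l l) := by
    rw [eq_sum_of_mem_pTilde σ hX]
    refine sum_mem fun i _ => sum_mem fun j _ => ?_
    obtain ⟨n, hn, -⟩ := exists_third_index hm i i
    refine add_mem ?_ (Submodule.mem_sup_left (Submodule.smul_mem _ _ (add_mem ?_ ?_)))
    · by_cases hij : i = j
      · subst hij
        by_cases hil : i = l
        · subst hil
          exact Submodule.mem_sup_right ⟨_, rfl⟩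
        · have e := hφ.map_h hil (X (.inl i) (.inl i)) 1
          rw [mul_one, eq_sub_iff_add_eq] at e
          rw [← e]
          exact Submodule.add_mem_sup ⟨_, rfl⟩ ⟨_, rfl⟩
      · exact Submodule.mem_sup_left ⟨_, hφ.map_t hij _⟩
    · by_cases hij : i = j
      · subst hij
        exact ⟨_, hφ.map_fDiag hn _⟩
      · exact ⟨_, hφ.map_f hij _⟩
    · by_cases hij : i = j
      · subst hij
        exact ⟨_, hφ.map_gDiag hn _⟩
      · exact ⟨_, hφ.map_g hij _⟩
  obtain ⟨_, ⟨x, rfl⟩, _, ⟨a, rfl⟩, h⟩ := Submodule.mem_sup.mp key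
  exact ⟨x, a, h.symm⟩

omit [Invertible (2 : k)] in
variable (σ) in
theorem glLie_tMat_gMat_diag {i n l : Fin m} (hn : i ≠ n) (hl : i ≠ l) (a b : R) :
    (glLie 𝒜 m).bracket (tMat σ i i a) (gMat σ n l b) = 0 := by
  induction a using homogeneous_induction 𝒜 with
  | add a a' ha ha' => simp only [tMat_add, map_add, LinearMap.add_apply, ha, ha', add_zero]
  | hom p a ha =>
    induction b using homogeneous_induction 𝒜 with
    | add b b' hb hb' => simp only [gMat_add, map_add, hb, hb', add_zero]
    | hom q b hb =>
      rw [(glLie 𝒜 m).antisymm (tMat_mem σ i i ha) (gMat_mem σ n l hb), glLie_gMat_tMat,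
        if_neg hl.symm, if_neg hn.symm, sub_zero, smul_zero, neg_zero]

instance isGraded_pTilde : (glLie 𝒜 m).IsGraded (pTilde σ m) :=
  ⟨(pTilde_isSub σ m).graded⟩

theorem IsMatrixHom.brSub_range_le (hφ : IsMatrixHom σ φ) :
    (glLie 𝒜 m).brSub (LinearMap.range φ) (LinearMap.range φ) ≤ LinearMap.range φ := by
  rw [brSub_le]
  rintro _ ⟨x, rfl⟩ _ ⟨y, rfl⟩
  exact ⟨_, hφ.isHom.map_bracket x y⟩

/-- The image is normalized by the skew-symmetric matrices. -/
theorem IsMatrixHom.brSub_pTilde_range_le (hm : 3 ≤ m) (hφ : IsMatrixHom σ φ) :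
    (glLie 𝒜 m).brSub (pTilde σ m) (LinearMap.range φ) ≤ LinearMap.range φ := by
  have hE := isRootFamily σ hm
  have hgr := hE.graded
  -- If y involves only the indices i and j, the diagonal correction of X is placed at a third index
  -- l, where it commutes with φ y; then [X, φ y] is a bracket of two images.
  have key : ∀ {i j : Fin m} {y : Stp σ m},
      (∀ l a, l ≠ i → l ≠ j → (glLie 𝒜 m).bracket (tMat σ l l a) (φ y) = 0) →
      ∀ X ∈ pTilde σ m, (glLie 𝒜 m).bracket X (φ y) ∈ LinearMap.range φ := by
    intro i j y h X hX
    obtain ⟨l, hi, hj⟩ := exists_third_index hm i j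
    obtain ⟨x, a, rfl⟩ := hφ.exists_eq_add hm l hX
    rw [map_add, LinearMap.add_apply, h l a hi.symm hj.symm, add_zero, ← hφ.isHom.map_bracket]
    exact ⟨_, rfl⟩
  have ht : ∀ {i j : Fin m}, i ≠ j →
      (glLie 𝒜 m).brSub (pTilde σ m) ((tSub σ i j).map φ) ≤ LinearMap.range φ := by
    intro i j hij
    rw [tSub_of_ne σ hij, brSub_le]
    rintro X hX _ ⟨_, ⟨b, rfl⟩, rfl⟩
    refine key (i := i) (j := j) (fun l a hl hl' => ?_) X hX
    rw [tₗ_apply, hφ.map_t]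
    exact glLie_tMat_tMat_diag σ hl hl' a b
  have hreg : ∀ u v : Fin m ⊕ Fin m, u ≠ v → u ≠ v.swap →
      (glLie 𝒜 m).brSub (pTilde σ m) ((rootSpace σ u v).map φ) ≤ LinearMap.range φ := by
    rintro (i | i) (j | j) h1 h2
    · exact ht (by simpa using h1)
    · have hij : i ≠ j := by simpa using h2
      simp only [rootSpace, fSub_of_ne σ hij, brSub_le]
      rintro X hX _ ⟨_, ⟨b, rfl⟩, rfl⟩
      refine key (i := i) (j := j) (fun l a hl hl' => ?_) X hX
      rw [fₗ_apply, hφ.map_f, glLie_tMat_fMat, if_neg hl, if_neg hl', add_zero]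
    · have hij : i ≠ j := by simpa using h2
      simp only [rootSpace, gSub_of_ne σ hij, brSub_le]
      rintro X hX _ ⟨_, ⟨b, rfl⟩, rfl⟩
      refine key (i := i) (j := j) (fun l a hl hl' => ?_) X hX
      rw [gₗ_apply, hφ.map_g]
      exact glLie_tMat_gMat_diag σ hl hl' a b
    · exact ht (by simpa using h1.symm)
  -- By Jacobi, the property of being sent into the image by all skew-symmetric matrices passes from
  -- two submodules to their bracket. This takes care of the diagonal root spaces and of the Cartan
  -- part.
  have hbr : ∀ M N : Submodule k (Stp σ m), (stpLie σ m).IsGraded M → (stpLie σ m).IsGraded N →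
      (glLie 𝒜 m).brSub (pTilde σ m) (M.map φ) ≤ LinearMap.range φ →
      (glLie 𝒜 m).brSub (pTilde σ m) (N.map φ) ≤ LinearMap.range φ →
      (glLie 𝒜 m).brSub (pTilde σ m) (((stpLie σ m).brSub M N).map φ) ≤ LinearMap.range φ := by
    intro M N _ _ hM hN
    have := hφ.isHom.isGraded_map M
    have := hφ.isHom.isGraded_map N
    rw [hφ.isHom.map_brSub]
    refine brSub_jacobi ?_ ?_
    · exact (brSub_mono _ hM LinearMap.map_le_range).trans hφ.brSub_range_le
    · exact (brSub_mono _ LinearMap.map_le_range hN).trans hφ.brSub_range_le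
  have htop : rootSum (rootSpace σ) (· ≠ ·) ⊔ (stpLie σ m).cartan Sum.swap (rootSpace σ) = ⊤ := by
    rw [rootSum_ne_eq, ← zeroPart_eq σ hm, sup_eq_top σ hm]
  conv_lhs => rw [← Submodule.map_top, ← htop]
  simp only [rootSum, cartan, Submodule.map_sup, Submodule.map_iSup, brSub_sup_right,
    brSub_iSup_right]
  refine sup_le ?_ ?_ <;> refine iSup_le fun u => iSup_le fun v => iSup_le fun huv => ?_
  · by_cases h : v = u.swap
    · subst h
      obtain ⟨y, hy1, hy2, -, -⟩ := hE.exists_third u u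
      rw [hE.diag_eq hy1 hy2]
      refine hbr _ _ (hgr _ _) (hgr _ _) (hreg _ _ hy1.symm ?_) (hreg _ _ hy2 ?_)
      · rintro rfl
        exact hy2 (Sum.swap_swap y).symm
      · rwa [Sum.swap_swap]
    · refine hreg u v huv ?_
      rintro rfl
      exact h (Sum.swap_swap v).symm
  · refine hbr _ _ (hgr _ _) (hgr _ _) (hreg _ _ huv.1 huv.2) (hreg _ _ huv.1.symm ?_)
    rintro rfl
    exact huv.2 (Sum.swap_swap u).symm

/-- Write X = φ x + t_ii(a) and Y = φ y + t_ll(b) with i ≠ l. The two corrections commute, so [X, Y]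
= [X, φ y] + [φ x, t_ll(b)], and both terms lie in the image because it is normalized. -/
theorem IsMatrixHom.periplectic_le_range (hm : 3 ≤ m) (hφ : IsMatrixHom σ φ) :
    periplectic σ m ≤ LinearMap.range φ := by
  have hN := hφ.brSub_pTilde_range_le hm
  have hgr : (glLie 𝒜 m).IsGraded (LinearMap.range φ) := by
    have : (stpLie σ m).IsGraded (⊤ : Submodule k (Stp σ m)) :=
      ⟨by rw [top_inf_eq, top_inf_eq, (stpLie σ m).isCompl.sup_eq_top]⟩
    rw [← Submodule.map_top]
    exact hφ.isHom.isGraded_map ⊤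
  refine Submodule.span_le.mpr ?_
  rintro _ ⟨X, hX, Y, hY, rfl⟩
  let i : Fin m := ⟨0, by omega⟩
  obtain ⟨l, hl, -⟩ := exists_third_index hm i i
  obtain ⟨x, a, rfl⟩ := hφ.exists_eq_add hm i hX
  obtain ⟨y, b, rfl⟩ := hφ.exists_eq_add hm l hY
  have e : (glLie 𝒜 m).bracket (φ x + tMat σ i i a) (tMat σ l l b) =
      (glLie 𝒜 m).bracket (φ x) (tMat σ l l b) := by
    rw [map_add, LinearMap.add_apply, glLie_tMat_tMat_diag σ hl hl, add_zero]
  rw [map_add, e]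
  refine add_mem (hN (brSub_mem hX ⟨y, rfl⟩)) (hN ?_)
  rw [brSub_comm]
  exact brSub_mem ⟨x, rfl⟩ (tMat_mem_pTilde σ l l b)

/-! ### The triangular decomposition and the kernel -/

theorem exists_decomposition (hm : 3 ≤ m) (x : Stp σ m) :
    ∃ n ∈ negPart σ m, ∃ p ∈ posPart σ m, ∃ z ∈ zeroPart σ m, x = n + p + z := by
  have hx : x ∈ negPart σ m ⊔ posPart σ m ⊔ zeroPart σ m := by
    rw [sup_eq_top σ hm]
    trivial
  obtain ⟨_, h, z, hz, rfl⟩ := Submodule.mem_sup.mp hx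
  obtain ⟨n, hn, p, hp, rfl⟩ := Submodule.mem_sup.mp h
  exact ⟨n, hn, p, hp, z, hz, rfl⟩

theorem IsMatrixHom.parts_eq_zero (hm : 3 ≤ m) (hφ : IsMatrixHom σ φ) {n p z : Stp σ m}
    (hn : n ∈ negPart σ m) (hp : p ∈ posPart σ m) (hz : z ∈ zeroPart σ m)
    (h : φ (n + p + z) = 0) : n = 0 ∧ p = 0 := by
  choose c hc _ using fun i : Fin m => exists_third_index hm i i
  let c' : ∀ i : Fin m, {l // i ≠ l} := fun i => ⟨c i, hc i⟩
  constructor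
  · have := congrArg (negSection σ c') h
    rwa [map_add, map_add, map_add, map_add, negSection_apply_neg c' hm hφ hn,
      negSection_apply_pos c' hφ hp, negSection_apply_zero c' hφ hz, map_zero, add_zero,
      add_zero] at this
  · have := congrArg (posSection σ c') h
    rwa [map_add, map_add, map_add, map_add, posSection_apply_neg c' hφ hn,
      posSection_apply_pos c' hm hφ hp, posSection_apply_zero c' hφ hz, map_zero, add_zero,
      zero_add] at this

-- The zero component needs no injectivity of φ: once the two outer components vanish, the relation
-- n + z + p = 0 itself gives z = 0.
variable (σ) in
theorem isInternal_parts (hm : 3 ≤ m) :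
    DirectSum.IsInternal ![negPart σ m, zeroPart σ m, posPart σ m] := by
  obtain ⟨φ, hφ⟩ := exists_isMatrixHom σ m
  rw [DirectSum.isInternal_submodule_iff_iSupIndep_and_iSup_eq_top]
  constructor
  · rw [iSupIndep_iff_finsetSum_eq_zero_imp_eq_zero]
    have key : ∀ n ∈ negPart σ m, ∀ z ∈ zeroPart σ m, ∀ p ∈ posPart σ m, n + z + p = 0 →
        n = 0 ∧ z = 0 ∧ p = 0 := by
      intro n hn z hz p hp h
      rw [add_right_comm] at h
      obtain ⟨rfl, rfl⟩ := hφ.parts_eq_zero hm hn hp hz (by rw [h, map_zero])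
      exact ⟨rfl, by simpa using h, rfl⟩
    intro s v hv h
    -- The independence criterion concerns an arbitrary finite subset of indices; the family is
    -- extended by zero to all three.
    have hv' : ∀ i, (if i ∈ s then v i else 0) ∈
        (![negPart σ m, zeroPart σ m, posPart σ m] : Fin 3 → Submodule k (Stp σ m)) i := by
      intro i
      split_ifs with hi
      · exact hv i hi
      · exact zero_mem _
    rw [← Finset.univ_inter s, ← Finset.sum_ite_mem, Fin.sum_univ_three] at h
    obtain ⟨h0, h1, h2⟩ := key _ (hv' 0) _ (hv' 1) _ (hv' 2) h
    intro i hi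
    fin_cases i
    · exact (if_pos hi).symm.trans h0
    · exact (if_pos hi).symm.trans h1
    · exact (if_pos hi).symm.trans h2
  · rw [iSup_fin_three]
    change negPart σ m ⊔ zeroPart σ m ⊔ posPart σ m = ⊤
    rw [sup_right_comm, sup_eq_top σ hm]

theorem IsMatrixHom.ker_le_zeroPart (hm : 3 ≤ m) (hφ : IsMatrixHom σ φ) :
    LinearMap.ker φ ≤ zeroPart σ m := by
  intro x hx
  obtain ⟨n, hn, p, hp, z, hz, rfl⟩ := exists_decomposition hm x
  obtain ⟨rfl, rfl⟩ := hφ.parts_eq_zero hm hn hp hz hx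
  rwa [add_zero, zero_add]

/-- A kernel element lies in the zero part, so it maps the positive part to itself. The result also
lies in the kernel, and φ is injective on the positive part, so it is zero. The negative part is
treated alike, and the zero part consists of brackets of root vectors, hence is killed by Jacobi. -/
theorem IsMatrixHom.ker_le_center (hm : 3 ≤ m) (hφ : IsMatrixHom σ φ) :
    LinearMap.ker φ ≤ (stpLie σ m).center := by
  have hE := isRootFamily σ hm
  have := hE.graded
  have hK := hφ.isHom.isGraded_ker
  have hker : ∀ x ∈ LinearMap.ker φ, ∀ y, φ ((stpLie σ m).bracket x y) = 0 := by
    intro x hx y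
    rw [hφ.isHom.map_bracket, LinearMap.mem_ker.mp hx, LinearMap.map_zero₂]
  have hpos : (stpLie σ m).brSub (LinearMap.ker φ) (posPart σ m) ≤ ⊥ := by
    rw [brSub_le]
    intro x hx y hy
    have h := brSub_le.mp (brSub_zeroPart_posPart_le σ hm) x (hφ.ker_le_zeroPart hm hx) y hy
    exact (hφ.parts_eq_zero hm (zero_mem _) h (zero_mem _)
      (by rw [zero_add, add_zero, hker x hx])).2
  have hneg : (stpLie σ m).brSub (LinearMap.ker φ) (negPart σ m) ≤ ⊥ := by
    rw [brSub_le]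
    intro x hx y hy
    have h := brSub_le.mp (brSub_zeroPart_negPart_le σ hm) x (hφ.ker_le_zeroPart hm hx) y hy
    exact (hφ.parts_eq_zero hm h (zero_mem _) (zero_mem _)
      (by rw [add_zero, add_zero, hker x hx])).1
  have hroot : ∀ u v, u ≠ v → (stpLie σ m).brSub (LinearMap.ker φ) (rootSpace σ u v) = ⊥ := by
    intro u v huv
    rw [eq_bot_iff]
    refine (brSub_mono _ le_rfl ((IsRootFamily.le_rootSum (r := (· ≠ ·)) huv).trans_eq
      (rootSum_ne_eq σ))).trans ?_
    rw [brSub_sup_right]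
    exact sup_le hneg hpos
  have hzero : (stpLie σ m).brSub (LinearMap.ker φ) (zeroPart σ m) ≤ ⊥ := by
    rw [zeroPart_eq σ hm]
    simp only [cartan, brSub_iSup_right]
    refine iSup_le fun u => iSup_le fun v => iSup_le fun huv => brSub_jacobi ?_ ?_
    · rw [hroot u v huv.1, brSub_bot_left]
    · rw [hroot v u huv.1.symm, brSub_bot_right]
  intro x hx
  rw [LieSuperalgebra.center, LinearMap.mem_ker]
  refine LinearMap.ext fun y => ?_
  obtain ⟨n, hn, p, hp, z, hz, rfl⟩ := exists_decomposition hm y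
  rw [map_add, map_add, (Submodule.mem_bot k).mp (hneg (brSub_mem hx hn)),
    (Submodule.mem_bot k).mp (hpos (brSub_mem hx hp)),
    (Submodule.mem_bot k).mp (hzero (brSub_mem hx hz)), add_zero, add_zero, LinearMap.zero_apply]

theorem IsCanonicalHom.isMatrixHom {ψ : Stp σ m →ₗ[k] periplectic σ m}
    (hψ : IsCanonicalHom σ m ψ) : IsMatrixHom σ ((periplectic σ m).subtype ∘ₗ ψ) where
  isHom := ⟨fun p x hx => hψ.isHom.map_grade p x hx,
    fun x y => congrArg Subtype.val (hψ.isHom.map_bracket x y)⟩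
  map_t hij a := hψ.map_t _ _ hij a
  map_f hij a := hψ.map_f _ _ hij a
  map_g hij a := hψ.map_g _ _ hij a

theorem IsMatrixHom.isCanonicalHom (hm : 3 ≤ m) (hφ : IsMatrixHom σ φ) :
    IsCanonicalHom σ m (φ.codRestrict (periplectic σ m) (hφ.apply_mem hm)) where
  isHom := ⟨fun p x hx => hφ.isHom.map_grade p x hx,
    fun x y => Subtype.ext (hφ.isHom.map_bracket x y)⟩
  map_t _ _ hij a := hφ.map_t hij a
  map_f _ _ hij a := hφ.map_f hij a
  map_g _ _ hij a := hφ.map_g hij a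

end Stp

end Steinberg

/-! ### The proposition; φ is corestricted to the periplectic superalgebra. -/

theorem mainTheorem6 {k R : Type*} [CommRing k] [Invertible (2 : k)] [Ring R] [Algebra k R]
    (𝒜 : ZMod 2 → Submodule k R) [GradedAlgebra 𝒜] (σ : Superinvolution 𝒜)
    (m : ℕ) (hm : 3 ≤ m) :
    -- the triangular decomposition
    (DirectSum.IsInternal ![Stp.negPart σ m, Stp.zeroPart σ m, Stp.posPart σ m] ∧
      (stpLie σ m).IsSub (Stp.negPart σ m) ∧
      (stpLie σ m).IsSub (Stp.zeroPart σ m) ∧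
      (stpLie σ m).IsSub (Stp.posPart σ m) ∧
      (∀ x ∈ Stp.zeroPart σ m, ∀ y ∈ Stp.negPart σ m,
        (stpLie σ m).bracket x y ∈ Stp.negPart σ m) ∧
      (∀ x ∈ Stp.zeroPart σ m, ∀ y ∈ Stp.posPart σ m,
        (stpLie σ m).bracket x y ∈ Stp.posPart σ m)) ∧
    -- the canonical homomorphism exists, is unique, and is a central extension
    ∃ ψ : Stp σ m →ₗ[k] periplectic σ m,
      Stp.IsCanonicalHom σ m ψ ∧
      (∀ ψ' : Stp σ m →ₗ[k] periplectic σ m, Stp.IsCanonicalHom σ m ψ' → ψ' = ψ) ∧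
      LieSuperalgebra.IsCentralExtension (stpLie σ m) (periplecticLie σ m) ψ ∧
      LinearMap.ker ψ ≤ Stp.zeroPart σ m := by
  obtain ⟨φ, hφ⟩ := Stp.exists_isMatrixHom σ m
  refine ⟨⟨Stp.isInternal_parts σ hm, Stp.negPart_isSub σ hm, Stp.zeroPart_isSub σ hm,
    Stp.posPart_isSub σ hm, LieSuperalgebra.brSub_le.mp (Stp.brSub_zeroPart_negPart_le σ hm),
    LieSuperalgebra.brSub_le.mp (Stp.brSub_zeroPart_posPart_le σ hm)⟩,
    φ.codRestrict (periplectic σ m) (hφ.apply_mem hm), hφ.isCanonicalHom hm, ?_,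
    ⟨(hφ.isCanonicalHom hm).isHom, ?_, ?_⟩, ?_⟩
  · intro ψ' hψ'
    refine LinearMap.ext fun x => ?_
    exact Subtype.ext (LinearMap.congr_fun (hψ'.isMatrixHom.eq hm hφ) x)
  · rintro ⟨X, hX⟩
    obtain ⟨x, rfl⟩ := hφ.periplectic_le_range hm hX
    exact ⟨x, rfl⟩
  · rw [LinearMap.ker_codRestrict]
    exact hφ.ker_le_center hm
  · rw [LinearMap.ker_codRestrict]
    exact hφ.ker_le_zeroPart hm
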